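/- **Setting.** Let $\Omega\subset\mathbb P(\mathbb R^d)$ be a properly convex domain (a non-empty open set that is a bounded convex subset of some affine chart) and let $\operatorname{Aut}(\Omega)=\{g\in\mathrm{PGL}_d(\mathbb R): g\Omega=\Omega\}$. For a set $C'$ that is properly convex and open in its span, $H_{C'}$ denotes its Hilbert metric, $\partial C'=\overline{C'}\setminus C'$, and $\mathcal N_{\Omega}(A;r)$ is the open $r$-neighborhood of $A\subset\Omega$ for $H_\Omega$. For $x\in\overline{C'}$ the open face $F_{C'}(x)$ consists of $x$ and of all $y\in\overline{C'}$ such that some open line segment in $\overline{C'}$ contains $x$ and $y$. For $A,B\subset F_\Omega(x)$, $H^{\mathrm{Haus}}_{F_\Omega(x)}(A,B)$ is the Hausdorff distance for $H_{F_\Omega(x)}$. Let $(\Omega,\mathcal C,\Lambda)$ be a naive convex co-compact triple: $\Lambda\le\operatorname{Aut}(\Omega)$ is an infinite discrete subgroup, and $\mathcal C\subset\Omega$ is a non-empty convex subset, closed in $\Omega$ and $\Lambda$-invariant, on which $\Lambda$ acts co-compactly. A simplex is a set $S=g\{[x_1:\dots:x_{k+1}:0:\dots:0]: x_1,\dots,x_{k+1}>0\}$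 with $g\in\mathrm{PGL}_d(\mathbb R)$ and $k\ge 2$. It is properly embedded in $\mathcal C$ if $S\subset\mathcal C$ and the inclusion is a proper map, and a properly embedded simplex in $\mathcal C$ is maximal if it is not contained in a larger one. A family $\mathcal S$ of maximal properly embedded simplices in $\mathcal C$ is called - *isolated* if it is closed and discrete in the space of non-empty closed subsets of $\Omega$ with the local Hausdorff topology, in which the sets $\{B : A\cap B_\Omega(x_0;r)\subset\mathcal N_\Omega(B;\varepsilon),\ B\cap B_\Omega(x_0;r)\subset\mathcal N_\Omega(A;\varepsilon)\}$ with $r,\varepsilon>0$ ($B_\Omega(x_0;r)$ being the open ball for $H_\Omega$ and $x_0\in\Omega$ any base point) form a neighborhood basis at $A$; - *coarsely complete* if there is $D>0$ such that every properly embedded simplex in $\mathcal C$ is contained in $\mathcal N_\Omega(S';D)$ for some $S'\in\mathcal S$; - *$\Lambda$-invariant* if $gS\in\mathcal S$ for all $S\in\mathcal S$ and $g\in\Lambda$. **Theorem.** Let $\mathcal S_0$ be an isolated, coarsely complete and $\Lambda$-invariant family of maximal properly embedded simplices in $\mathcal C$. Then there exists an isolated, coarsely complete and $\Lambda$-invariant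 subfamily $\mathcal S\subset\mathcal S_0$ with the following additional property: there exists $D_1>0$ such that for every $S\in\mathcal S$ and every $x\in\partial S$, $$H^{\mathrm{Haus}}_{F_\Omega(x)}\big(\overline{\mathcal C}\cap F_\Omega(x),\,F_S(x)\big)\le D_1 .$$ -/

import Mathlib

open Set Topology
open scoped Pointwise ENNReal MatrixGroups LinearAlgebra.Projectivization

noncomputable section

/-- The real projective space `ℙ(ℝ^d)`. -/
abbrev ProjSpace (d : ℕ) : Type := ℙ ℝ (Fin d → ℝ)

/-- The quotient topology of `ℝ^d \ {0} → ℙ(ℝ^d)`. -/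
instance projSpaceTopology (d : ℕ) : TopologicalSpace (ProjSpace d) :=
  TopologicalSpace.coinduced
    (fun v : {v : Fin d → ℝ // v ≠ 0} => Projectivization.mk ℝ v.1 v.2) inferInstance

/-- The quotient topology of `GL_d(ℝ) → PGL_d(ℝ)`. -/
instance pglTopology (d : ℕ) : TopologicalSpace PGL(Fin d, ℝ) :=
  TopologicalSpace.coinduced
    (fun g : GL (Fin d) ℝ => (Matrix.ProjGenLinGroup.mk g : PGL(Fin d, ℝ))) inferInstance

namespace ConvexProjective

variable {d : ℕ}

/-- `v` is a nonzero vector and `[v] = p`. -/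
def Lifts (v : Fin d → ℝ) (p : ProjSpace d) : Prop :=
  ∃ hv : v ≠ 0, Projectivization.mk ℝ v hv = p

/-! ### Convexity -/

/-- `C` is contained in the affine chart `{[v] : f v ≠ 0}`. -/
def InChart (f : (Fin d → ℝ) →ₗ[ℝ] ℝ) (C : Set (ProjSpace d)) : Prop :=
  ∀ p ∈ C, ∀ v, Lifts v p → f v ≠ 0

/-- The image of `C` under the identification of the affine chart `{[v] : f v ≠ 0}` with the
affine hyperplane `{v : f v = 1}`. -/
def chartImage (f : (Fin d → ℝ) →ₗ[ℝ] ℝ) (C : Set (ProjSpace d)) : Set (Fin d → ℝ) :=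
  {v | f v = 1 ∧ ∃ p ∈ C, Lifts v p}

/-- `C` is a convex subset of some affine chart. -/
def IsConvex (C : Set (ProjSpace d)) : Prop :=
  ∃ f : (Fin d → ℝ) →ₗ[ℝ] ℝ, f ≠ 0 ∧ InChart f C ∧ Convex ℝ (chartImage f C)

/-- `C` is a bounded convex subset of some affine chart. -/
def IsProperlyConvex (C : Set (ProjSpace d)) : Prop :=
  ∃ f : (Fin d → ℝ) →ₗ[ℝ] ℝ, f ≠ 0 ∧ InChart f C ∧ Convex ℝ (chartImage f C) ∧
    Bornology.IsBounded (chartImage f C)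

/-- A properly convex domain: non-empty, open and properly convex (hence connected). -/
def IsProperlyConvexDomain (Ω : Set (ProjSpace d)) : Prop :=
  Ω.Nonempty ∧ IsOpen Ω ∧ IsProperlyConvex Ω

/-- The smallest linear subspace containing `C`. -/
def linSpan (C : Set (ProjSpace d)) : Submodule ℝ (Fin d → ℝ) :=
  ⨆ p ∈ C, p.submodule

/-- The relative interior of `C`: its interior in the projective subspace that it spans. -/
def relInterior (C : Set (ProjSpace d)) : Set (ProjSpace d) :=
  {p | p ∈ C ∧ ∃ U : Set (ProjSpace d), IsOpen U ∧ p ∈ U ∧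
    ∀ q ∈ U, q.submodule ≤ linSpan C → q ∈ C}

/-- The boundary `∂C`: the closure of `C` minus its relative interior. -/
def bdry (C : Set (ProjSpace d)) : Set (ProjSpace d) :=
  closure C \ relInterior C

/-! ### The Hilbert metric -/

/-- The open projective line segment `{[v + s w] : s > 0}` with end points `[v]`, `[w]`. -/
def openSeg (v w : Fin d → ℝ) : Set (ProjSpace d) :=
  {p | ∃ s : ℝ, 0 < s ∧ Lifts (v + s • w) p}

/-- The points `a, x, y, b` lie in this order on a projective line, `a, b` are distinct from each
other and from `x, y`, `x ≠ y`, and the cross ratio `|x-b| |y-a| / (|x-a| |y-b|)` is `c`.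
Here `a = [v]`, `b = [w]`, `x = [v + s w]`, `y = [v + t w]` with `0 < s < t`, and the cross ratio
of four points with homogeneous coordinates `∞, s, t, 0` in this sense is `t / s`. -/
def HasCrossRatio (a x y b : ProjSpace d) (c : ℝ) : Prop :=
  ∃ (v w : Fin d → ℝ) (s t : ℝ), LinearIndependent ℝ ![v, w] ∧ 0 < s ∧ s < t ∧
    Lifts v a ∧ Lifts (v + s • w) x ∧ Lifts (v + t • w) y ∧ Lifts w b ∧ c = t / s

/-- The Hilbert distance `H_C(x, y) = (1/2) log [a, x, y, b]` of two points `x, y` of a properly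
convex set `C` that is open in its span, where `a, b ∈ ∂C` are the points in which the line through
`x, y` meets `∂C`, in the order `a, x, y, b`. The set below has exactly one element if `x ≠ y`;
it is empty if `x = y`, and then the value is `0`. -/
def hilbertDist (C : Set (ProjSpace d)) (x y : ProjSpace d) : ℝ :=
  sSup {r | ∃ a ∈ bdry C, ∃ b ∈ bdry C, ∃ c, HasCrossRatio a x y b c ∧ r = (1 / 2) * Real.log c}

/-- The open ball `B_Ω(x; r)` of the Hilbert metric. -/
def hilbertBall (Ω : Set (ProjSpace d)) (x : ProjSpace d) (r : ℝ) : Set (ProjSpace d) :=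
  {y | y ∈ Ω ∧ hilbertDist Ω x y < r}

/-- The tubular neighborhood `N_Ω(A; r)`. -/
def hilbertNhd (Ω A : Set (ProjSpace d)) (r : ℝ) : Set (ProjSpace d) :=
  ⋃ x ∈ A, hilbertBall Ω x r

/-- The (possibly infinite) Hausdorff distance of `A, B ⊆ F` in the Hilbert metric of `F`. -/
def hilbertHausdorffDist (F A B : Set (ProjSpace d)) : ℝ≥0∞ :=
  max (⨆ a ∈ A, ⨅ b ∈ B, ENNReal.ofReal (hilbertDist F a b))
    (⨆ b ∈ B, ⨅ a ∈ A, ENNReal.ofReal (hilbertDist F a b))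

/-! ### Faces -/

/-- The open face `F_C(x)`: the point `x` together with all `y` such that some open line segment in
the closure of `C` contains both `x` and `y`. -/
def openFace (C : Set (ProjSpace d)) (x : ProjSpace d) : Set (ProjSpace d) :=
  {x} ∪ {y | y ∈ closure C ∧ ∃ v w : Fin d → ℝ, LinearIndependent ℝ ![v, w] ∧
    openSeg v w ⊆ closure C ∧ x ∈ openSeg v w ∧ y ∈ openSeg v w}

/-! ### Properly embedded simplices -/

/-- A simplex of dimension at least two, open in its span: the set of all
`[t_0 v_0 + ... + t_k v_k]` with all `t_i > 0`, where `k ≥ 2` and the `v_i` are linearly independent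
(so it is the image of a standard simplex under an element of `PGL_d(ℝ)`). -/
def IsSimplex (S : Set (ProjSpace d)) : Prop :=
  ∃ k : ℕ, 2 ≤ k ∧ ∃ v : Fin (k + 1) → Fin d → ℝ, LinearIndependent ℝ v ∧
    S = {p | ∃ t : Fin (k + 1) → ℝ, (∀ i, 0 < t i) ∧ Lifts (∑ i, t i • v i) p}

/-- `A ⊆ B`, and the inclusion is a proper map. -/
def IsProperlyEmbedded (A B : Set (ProjSpace d)) : Prop :=
  ∃ h : A ⊆ B, IsProperMap (Set.inclusion h)

/-- `S` is a properly embedded simplex in `C`. -/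
def IsProperlyEmbeddedSimplex (C S : Set (ProjSpace d)) : Prop :=
  IsSimplex S ∧ IsProperlyEmbedded S C

/-- `S` is a properly embedded simplex in `C` that is not contained in a larger one. -/
def IsMaximalProperlyEmbeddedSimplex (C S : Set (ProjSpace d)) : Prop :=
  Maximal (IsProperlyEmbeddedSimplex C) S

/-! ### The local Hausdorff topology -/

/-- The non-empty subsets of `Ω` that are closed in `Ω`. -/
abbrev ClosedIn (Ω : Set (ProjSpace d)) : Type :=
  {A : Set (ProjSpace d) // A.Nonempty ∧ A ⊆ Ω ∧ ∃ K, IsClosed K ∧ A = K ∩ Ω}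

/-- The basic neighborhood of `A` consisting of all non-empty closed subsets `B` of `Ω` that are
`ε`-close to `A` within the ball of radius `r` about `x`. -/
def localHausdorffNhd (Ω : Set (ProjSpace d)) (A : ClosedIn Ω) (x : ProjSpace d) (r ε : ℝ) :
    Set (ClosedIn Ω) :=
  {B | A.1 ∩ hilbertBall Ω x r ⊆ hilbertNhd Ω B.1 ε ∧ B.1 ∩ hilbertBall Ω x r ⊆ hilbertNhd Ω A.1 ε}

/-- The local Hausdorff topology induced by the Hilbert metric (Hausdorff convergence on bounded
sets) on the non-empty closed subsets of `Ω`: the sets `localHausdorffNhd Ω A x r ε`, for `r > 0`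
and `ε > 0`, form a neighborhood basis at `A`, whatever the base point `x ∈ Ω` is. -/
@[reducible] def localHausdorffTopology (Ω : Set (ProjSpace d)) : TopologicalSpace (ClosedIn Ω) where
  IsOpen 𝒰 := ∀ A ∈ 𝒰, ∀ x ∈ Ω, ∃ r > (0 : ℝ), ∃ ε > (0 : ℝ), localHausdorffNhd Ω A x r ε ⊆ 𝒰
  isOpen_univ := fun _ _ _ _ => ⟨1, one_pos, 1, one_pos, subset_univ _⟩
  isOpen_inter := by
    intro 𝒰 𝒱 hU hV A hA x hx
    obtain ⟨r, hr, ε, hε, h⟩ := hU A hA.1 x hx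
    obtain ⟨r', hr', ε', hε', h'⟩ := hV A hA.2 x hx
    have hball : ∀ {y : ProjSpace d} {a b : ℝ}, a ≤ b → hilbertBall Ω y a ⊆ hilbertBall Ω y b :=
      fun hab z hz => ⟨hz.1, hz.2.trans_le hab⟩
    have hnhd : ∀ {B : Set (ProjSpace d)} {a b : ℝ}, a ≤ b → hilbertNhd Ω B a ⊆ hilbertNhd Ω B b :=
      fun hab => iUnion₂_mono fun _ _ => hball hab
    refine ⟨max r r', lt_max_of_lt_left hr, min ε ε', lt_min hε hε', fun B hB => ⟨h ?_, h' ?_⟩⟩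
    · exact ⟨fun z hz => hnhd (min_le_left _ _) (hB.1 ⟨hz.1, hball (le_max_left _ _) hz.2⟩),
        fun z hz => hnhd (min_le_left _ _) (hB.2 ⟨hz.1, hball (le_max_left _ _) hz.2⟩)⟩
    · exact ⟨fun z hz => hnhd (min_le_right _ _) (hB.1 ⟨hz.1, hball (le_max_right _ _) hz.2⟩),
        fun z hz => hnhd (min_le_right _ _) (hB.2 ⟨hz.1, hball (le_max_right _ _) hz.2⟩)⟩
  isOpen_sUnion := by
    intro 𝒯 h𝒯 A ⟨𝒰, h𝒰, hA⟩ x hx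
    obtain ⟨r, hr, ε, hε, h⟩ := h𝒯 𝒰 h𝒰 A hA x hx
    exact ⟨r, hr, ε, hε, h.trans (subset_sUnion_of_mem h𝒰)⟩

/-! ### Naive convex co-compact triples and families of simplices -/

/-- `(Ω, C, Λ)` is a naive convex co-compact triple: `Ω` is a properly convex domain, `Λ` is an
infinite discrete group of automorphisms of `Ω`, and `C` is a non-empty convex subset of `Ω`,
closed in `Ω` and invariant under `Λ`, on which `Λ` acts co-compactly. -/
structure IsNaiveConvexCocompactTriple (Ω C : Set (ProjSpace d))
    (Λ : Subgroup PGL(Fin d, ℝ)) : Prop where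
  domain : IsProperlyConvexDomain Ω
  aut : ∀ g ∈ Λ, g • Ω = Ω
  infinite : (Λ : Set PGL(Fin d, ℝ)).Infinite
  discrete : IsDiscrete (Λ : Set PGL(Fin d, ℝ))
  nonempty : C.Nonempty
  subset : C ⊆ Ω
  closed : ∃ K, IsClosed K ∧ C = K ∩ Ω
  convex : IsConvex C
  invariant : ∀ g ∈ Λ, g • C = C
  cocompact : ∃ K ⊆ C, IsCompact K ∧ ⋃ g ∈ Λ, g • K = C

/-- The family `𝒮` is closed and discrete in the local Hausdorff topology induced by `H_Ω`. -/
def IsIsolated (Ω : Set (ProjSpace d)) (𝒮 : Set (Set (ProjSpace d))) : Prop :=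
  IsClosed[localHausdorffTopology Ω] {A : ClosedIn Ω | A.1 ∈ 𝒮} ∧
    @IsDiscrete _ (localHausdorffTopology Ω) {A : ClosedIn Ω | A.1 ∈ 𝒮}

/-- Every properly embedded simplex in `C` is contained in a uniformly bounded tubular neighborhood
of some member of `𝒮`. -/
def IsCoarselyComplete (Ω C : Set (ProjSpace d)) (𝒮 : Set (Set (ProjSpace d))) : Prop :=
  ∃ D : ℝ, 0 < D ∧ ∀ S, IsProperlyEmbeddedSimplex C S → ∃ S' ∈ 𝒮, S ⊆ hilbertNhd Ω S' D

/-- The family `𝒮` is invariant under `Λ`. -/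
def IsInvariantFamily (Λ : Subgroup PGL(Fin d, ℝ)) (𝒮 : Set (Set (ProjSpace d))) : Prop :=
  ∀ S ∈ 𝒮, ∀ g ∈ Λ, g • S ∈ 𝒮

end ConvexProjective

end

/-! Lift the problem to ℝ^d. Over Ω lies a closed normal cone K, and u ≤ v iff v - u ∈ K is a vector
space order. Projective notions become order notions. Two points of the closure of Ω lie in the same
open face iff their lifts in K are comparable. If αZ ≤ Y ≤ βZ, then the Hilbert distance in the face
is at most (1/2) log(β/α), and in Ω the best constants give equality. Lying in a bounded
neighborhood of a cone becomes `Near`. A properly embedded simplex becomes a cone `hull v` whose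
positive combinations are interior to K while its facets are not. An isolated family becomes a
locally finite family of cones, so that along an ultrafilter the translates of a member through a
fixed compact set are eventually constant.

The subfamily consists of the coarsely maximal members: those Q such that every member coarsely
containing Q is coarsely contained in Q. Isolation passes to subfamilies and invariance is formal.
Coarse containment cannot lower the number of vertices, and if the numbers agree it can be reversed
(`exists_injection`, `coarselyLE_of_card_eq`). Hence every member lies coarsely in a maximal one,
and finiteness of the number of orbits makes the constants uniform.

One half of the Hausdorff estimate holds because the simplex lies in the core. For the other half,
suppose that points y_m of the core in the open face of a fixed J have nearly optimal nearness
constants M_m → ∞. Translate them back by `recurrence` and let w be the limit of the translates of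
y_m / M_m. It lies in a closed face of a maximal simplex. If w is comparable to a point of that
simplex, then M_m can be halved for a suitable m, a contradiction.

What remains is qualitative (`exists_comparable_of_le`): a core point w in a proper closed face of a
maximal simplex is comparable to a point of the simplex. The proof is by induction on the face. At a
vertex, a counterexample would produce in the limit a properly embedded simplex with one vertex
more, coarsely containing a translate of the maximal one. In a larger face, add vertices to w until
one more would enter the open face. Call the result e, and join e and variable points a of a facet
with the opposite face. These simplices are near finitely many members, which colors the points a.
Gallai's theorem finds in one color points that are almost the vertices of the facet, at a scale
where the error vanishes in the limit. The member Q of that color then coarsely contains the maximal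
simplex, hence is coarsely contained in it. As e is near Q, it is comparable to a point of the
simplex, and w drops to a smaller face. -/

noncomputable section

set_option linter.unusedSectionVars false

/-! ### Comparability and coarse containment in ordered vector spaces -/

namespace OrderedCone

open Filter

section Basic

variable {V : Type*} [NormedAddCommGroup V] [NormedSpace ℝ V] [PartialOrder V]

variable (V) in
/-- The interior of the cone of non-negative vectors. -/
def posInterior : Set V := interior {v : V | 0 ≤ v}

/-- `p` is comparable, with constant `D`, to an element of `Q`. -/
def Near (D : ℝ) (Q : Set V) (p : V) : Prop := ∃ q ∈ Q, q ≤ p ∧ p ≤ D • q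

/-- Each of the vectors `u`, `v` is dominated by a multiple of the other one. -/
def Comparable (u v : V) : Prop := ∃ M : ℝ, 0 < M ∧ u ≤ M • v ∧ v ≤ M • u

/-- The cone `Q` is contained in a bounded neighborhood of the cone `Q'`. -/
def CoarselyLE (Q Q' : Set V) : Prop := ∃ D : ℝ, 0 < D ∧ ∀ p ∈ Q, Near D Q' p

/-- The closed cone generated by a finite family of vectors. -/
def hull {ι : Type*} [Fintype ι] (v : ι → V) : Set V :=
  {x | ∃ t : ι → ℝ, (∀ i, 0 ≤ t i) ∧ x = ∑ i, t i • v i}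

/-- The family `v` spans a simplicial cone in `P` that meets the interior of the cone of
non-negative vectors, but whose facets do not. -/
structure IsProperSimplex {ι : Type*} [Fintype ι] (P : Set V) (v : ι → V) : Prop where
  mem : ∀ i, v i ∈ P
  sum_mem : ∑ i, v i ∈ posInterior V
  facet : ∀ i, ∑ j, v j - v i ∉ posInterior V

lemma nonneg_of_mem_posInterior {u : V} (h : u ∈ posInterior V) : 0 ≤ u := interior_subset (s := {v : V | 0 ≤ v}) h

lemma isOpen_posInterior : IsOpen (posInterior V) := isOpen_interior

variable [IsOrderedAddMonoid V] [IsOrderedModule ℝ V]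

lemma posInterior_mono {u v : V} (hu : u ∈ posInterior V) (huv : u ≤ v) : v ∈ posInterior V := by
  have h : (fun x => x + (v - u)) '' posInterior V ⊆ posInterior V := by
    apply interior_maximal
    · rintro _ ⟨x, hx, rfl⟩
      exact add_nonneg (nonneg_of_mem_posInterior hx) (sub_nonneg.2 huv)
    · exact (Homeomorph.addRight (v - u)).isOpenMap _ isOpen_posInterior
  exact h ⟨u, hu, by simp⟩

lemma smul_mem_posInterior {u : V} {c : ℝ} (hc : 0 < c) (hu : u ∈ posInterior V) :
    c • u ∈ posInterior V := by
  have h : (fun x : V => c • x) '' posInterior V ⊆ posInterior V := by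
    apply interior_maximal
    · rintro _ ⟨x, hx, rfl⟩
      exact smul_nonneg hc.le (nonneg_of_mem_posInterior hx)
    · exact (Homeomorph.smulOfNeZero c hc.ne').isOpenMap _ isOpen_posInterior
  exact h ⟨u, hu, rfl⟩

lemma smul_mem_posInterior_iff {u : V} {c : ℝ} (hc : 0 < c) :
    c • u ∈ posInterior V ↔ u ∈ posInterior V := by
  refine ⟨fun h => ?_, smul_mem_posInterior hc⟩
  have := smul_mem_posInterior (inv_pos.2 hc) h
  rwa [smul_smul, inv_mul_cancel₀ hc.ne', one_smul] at this

lemma mem_posInterior_of_le_smul {u v : V} {M : ℝ} (hM : 0 < M) (hv : v ∈ posInterior V)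
    (h : v ≤ M • u) : u ∈ posInterior V :=
  (smul_mem_posInterior_iff hM).1 (posInterior_mono hv h)

/-- Interior points are order units: u - s v stays interior for small s > 0, and one divides by s.
-/
lemma exists_le_smul_of_mem_posInterior {u : V} (hu : u ∈ posInterior V) (v : V) :
    ∃ M : ℝ, 0 < M ∧ M • u - v ∈ posInterior V := by
  have h : Tendsto (fun s : ℝ => u - s • v) (𝓝[>] 0) (𝓝 u) := by
    have : Continuous fun s : ℝ => u - s • v := by fun_prop
    simpa using (this.tendsto 0).mono_left nhdsWithin_le_nhds
  obtain ⟨s, hs, hs0⟩ := ((h.eventually (isOpen_posInterior.mem_nhds hu)).and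
    self_mem_nhdsWithin).exists
  refine ⟨s⁻¹, inv_pos.2 hs0, ?_⟩
  have := smul_mem_posInterior (inv_pos.2 hs0) hs
  rwa [smul_sub, smul_smul, inv_mul_cancel₀ (ne_of_gt hs0), one_smul] at this

lemma exists_le_smul {u : V} (hu : u ∈ posInterior V) (v : V) : ∃ M : ℝ, 0 < M ∧ v ≤ M • u := by
  obtain ⟨M, hM, h⟩ := exists_le_smul_of_mem_posInterior hu v
  exact ⟨M, hM, sub_nonneg.1 (nonneg_of_mem_posInterior h)⟩

lemma smul_le_smul_coeff {u : V} {a b : ℝ} (hu : 0 ≤ u) (h : a ≤ b) : a • u ≤ b • u :=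
  smul_le_smul_of_nonneg_right h hu

lemma smul_le_smul_vec {u v : V} {a : ℝ} (ha : 0 ≤ a) (h : u ≤ v) : a • u ≤ a • v :=
  smul_le_smul_of_nonneg_left h ha

lemma Comparable.of_le_le {u v : V} {a b : ℝ} (hu : 0 ≤ u) (hv : 0 ≤ v) (h1 : u ≤ a • v)
    (h2 : v ≤ b • u) : Comparable u v :=
  ⟨max 1 (max a b), by positivity,
    h1.trans (smul_le_smul_coeff hv (by simp)), h2.trans (smul_le_smul_coeff hu (by simp))⟩

lemma Comparable.trans {u v w : V} (h : Comparable u v) (h' : Comparable v w) :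
    Comparable u w := by
  obtain ⟨M, hM, h1, h2⟩ := h
  obtain ⟨N, hN, h3, h4⟩ := h'
  refine ⟨M * N, by positivity, h1.trans ?_, h4.trans ?_⟩
  · rw [mul_smul]; exact smul_le_smul_vec hM.le h3
  · rw [mul_comm, mul_smul]; exact smul_le_smul_vec hN.le h2

lemma Near.mono {D D' : ℝ} {Q : Set V} {p : V} (hQ : ∀ q ∈ Q, 0 ≤ q) (h : Near D Q p)
    (hD : D ≤ D') : Near D' Q p := by
  obtain ⟨q, hq, h1, h2⟩ := h
  exact ⟨q, hq, h1, h2.trans (smul_le_smul_coeff (hQ q hq) hD)⟩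

lemma Near.comparable {D : ℝ} {Q : Set V} {p : V} (hQ : ∀ q ∈ Q, 0 ≤ q) (h : Near D Q p) :
    ∃ q ∈ Q, Comparable p q := by
  obtain ⟨q, hq, h1, h2⟩ := h
  exact ⟨q, hq, Comparable.of_le_le ((hQ q hq).trans h1) (hQ q hq) h2 (by simpa using h1 : q ≤ (1 : ℝ) • p)⟩

lemma Near.of_comparable {D : ℝ} {Q : Set V} {p p' : V}
    (hQ : ∀ c : ℝ, 0 ≤ c → ∀ q ∈ Q, c • q ∈ Q) (h : Near D Q p) (hD : 0 < D)
    (hp : Comparable p' p) : ∃ D' : ℝ, 0 < D' ∧ Near D' Q p' := by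
  obtain ⟨q, hq, h1, h2⟩ := h
  obtain ⟨M, hM, h3, h4⟩ := hp
  refine ⟨M * D * M, by positivity, M⁻¹ • q, hQ _ (by positivity) _ hq, ?_, ?_⟩
  · have := smul_le_smul_vec (inv_nonneg.2 hM.le) (h1.trans h4)
    rwa [smul_smul, inv_mul_cancel₀ hM.ne', one_smul] at this
  · rw [smul_smul, mul_assoc, mul_inv_cancel₀ hM.ne', mul_one, mul_smul]
    exact h3.trans (smul_le_smul_vec hM.le h2)

lemma Near.trans {D D' : ℝ} {Q Q' : Set V} {p : V} (hD : 0 ≤ D) (h : Near D Q p)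
    (h' : ∀ q ∈ Q, Near D' Q' q) : Near (D * D') Q' p := by
  obtain ⟨q, hq, h1, h2⟩ := h
  obtain ⟨q', hq', h3, h4⟩ := h' q hq
  refine ⟨q', hq', h3.trans h1, h2.trans ?_⟩
  rw [mul_smul]
  exact smul_le_smul_vec hD h4

lemma Near.add {D : ℝ} {Q : Set V} {p p' : V} (hQ : ∀ q ∈ Q, ∀ q' ∈ Q, q + q' ∈ Q)
    (h : Near D Q p) (h' : Near D Q p') : Near D Q (p + p') := by
  obtain ⟨q, hq, h1, h2⟩ := h
  obtain ⟨q', hq', h3, h4⟩ := h'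
  exact ⟨q + q', hQ q hq q' hq', add_le_add h1 h3, by rw [smul_add]; exact add_le_add h2 h4⟩

lemma Near.smul {D c : ℝ} {Q : Set V} {p : V} (hQ : ∀ (c : ℝ), 0 ≤ c → ∀ q ∈ Q, c • q ∈ Q)
    (hc : 0 ≤ c) (h : Near D Q p) : Near D Q (c • p) := by
  obtain ⟨q, hq, h1, h2⟩ := h
  exact ⟨c • q, hQ c hc q hq, smul_le_smul_vec hc h1, by
    rw [smul_comm]; exact smul_le_smul_vec hc h2⟩

lemma CoarselyLE.trans {Q Q' Q'' : Set V} (h : CoarselyLE Q Q') (h' : CoarselyLE Q' Q'') :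
    CoarselyLE Q Q'' := by
  obtain ⟨D, hD, h1⟩ := h
  obtain ⟨D', hD', h2⟩ := h'
  exact ⟨D * D', by positivity, fun p hp => (h1 p hp).trans hD.le h2⟩

end Basic

/-! ### Finitely generated cones -/

section Hull

variable {V : Type*} [NormedAddCommGroup V] [NormedSpace ℝ V] [PartialOrder V]
variable {ι κ : Type*} [Fintype ι] [Fintype κ]

lemma mem_hull_self (v : ι → V) (i : ι) : v i ∈ hull v := by
  classical
  exact ⟨Pi.single i 1, fun j => by by_cases h : j = i <;> simp [h], by
    simp [Pi.single_apply, ite_smul]⟩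

lemma hull_add (v : ι → V) : ∀ x ∈ hull v, ∀ y ∈ hull v, x + y ∈ hull v := by
  rintro _ ⟨t, ht, rfl⟩ _ ⟨s, hs, rfl⟩
  exact ⟨t + s, fun i => add_nonneg (ht i) (hs i), by simp [add_smul, Finset.sum_add_distrib]⟩

lemma hull_smul (v : ι → V) : ∀ c : ℝ, 0 ≤ c → ∀ x ∈ hull v, c • x ∈ hull v := by
  rintro c hc _ ⟨t, ht, rfl⟩
  exact ⟨c • t, fun i => mul_nonneg hc (ht i), by simp [Finset.smul_sum, mul_smul]⟩

lemma zero_mem_hull (v : ι → V) : (0 : V) ∈ hull v := ⟨0, fun _ => le_rfl, by simp⟩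

lemma hull_subset_of_cone {v : ι → V} {P : Set V} (h0 : (0 : V) ∈ P)
    (hadd : ∀ x ∈ P, ∀ y ∈ P, x + y ∈ P) (hsmul : ∀ c : ℝ, 0 ≤ c → ∀ x ∈ P, c • x ∈ P)
    (hv : ∀ i, v i ∈ P) : hull v ⊆ P := by
  rintro _ ⟨t, ht, rfl⟩
  exact Finset.sum_induction _ (· ∈ P) (fun a b ha hb => hadd a ha b hb) h0
    fun i _ => hsmul _ (ht i) _ (hv i)

lemma sum_mem_hull (v : ι → V) (J : Finset ι) (c : ι → ℝ) (hc : ∀ i ∈ J, 0 ≤ c i) :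
    ∑ i ∈ J, c i • v i ∈ hull v :=
  Finset.sum_induction _ (· ∈ hull v) (fun a b ha hb => hull_add v a ha b hb) (zero_mem_hull v)
    fun i hi => hull_smul v _ (hc i hi) _ (mem_hull_self v i)

lemma hull_image (g : V →ₗ[ℝ] V) (v : ι → V) : g '' hull v = hull (fun i => g (v i)) := by
  ext x
  constructor
  · rintro ⟨_, ⟨t, ht, rfl⟩, rfl⟩
    exact ⟨t, ht, by simp⟩
  · rintro ⟨t, ht, rfl⟩
    exact ⟨_, ⟨t, ht, rfl⟩, by simp⟩

lemma hull_comp_equiv (v : ι → V) (e : κ ≃ ι) : hull (v ∘ e) = hull v := by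
  ext x
  constructor
  · rintro ⟨t, ht, rfl⟩
    exact ⟨t ∘ e.symm, fun i => ht _, (Fintype.sum_equiv e _ _ fun i => by simp)⟩
  · rintro ⟨t, ht, rfl⟩
    exact ⟨t ∘ e, fun i => ht _, (Fintype.sum_equiv e _ _ fun i => by simp).symm⟩

lemma hull_smul_pos (v : ι → V) (c : ι → ℝ) (hc : ∀ i, 0 < c i) :
    hull (fun i => c i • v i) = hull v := by
  ext x
  constructor
  · rintro ⟨t, ht, rfl⟩
    exact ⟨t * c, fun i => mul_nonneg (ht i) (hc i).le, by simp [mul_smul]⟩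
  · rintro ⟨t, ht, rfl⟩
    exact ⟨fun i => t i / c i, fun i => div_nonneg (ht i) (hc i).le, by
      simp [smul_smul, div_mul_cancel₀ _ (hc _).ne']⟩

variable [IsOrderedAddMonoid V] [IsOrderedModule ℝ V]

lemma hull_nonneg {v : ι → V} (hv : ∀ i, 0 ≤ v i) : ∀ x ∈ hull v, 0 ≤ x := by
  rintro _ ⟨t, ht, rfl⟩
  exact Finset.sum_nonneg fun i _ => smul_nonneg (ht i) (hv i)

/-- `Near` with a fixed constant is stable under sums and non-negative multiples, so generators
suffice and the constant does not grow. -/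
lemma near_of_mem_hull {v : ι → V} {D : ℝ} {Q : Set V} (h0 : (0 : V) ∈ Q)
    (hadd : ∀ x ∈ Q, ∀ y ∈ Q, x + y ∈ Q) (hsmul : ∀ c : ℝ, 0 ≤ c → ∀ x ∈ Q, c • x ∈ Q)
    (h : ∀ i, Near D Q (v i)) : ∀ x ∈ hull v, Near D Q x := by
  rintro _ ⟨t, ht, rfl⟩
  exact Finset.sum_induction _ (Near D Q) (fun a b ha hb => ha.add hadd hb)
    ⟨0, h0, le_rfl, by simp⟩ fun i _ => (h i).smul hsmul (ht i)

end Hull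

/-! ### Rigidity of properly embedded simplicial cones -/

namespace IsProperSimplex

variable {V : Type*} [NormedAddCommGroup V] [NormedSpace ℝ V] [PartialOrder V]
  [IsOrderedAddMonoid V] [IsOrderedModule ℝ V]
variable {ι κ : Type*} [Fintype ι] [Fintype κ] {P P' : Set V} {v : ι → V} {u : κ → V}

/-- A non-negative combination lies in the interior if and only if all coefficients are positive. -/
lemma pos_of_mem_posInterior (hP : ∀ p ∈ P, 0 ≤ p) (hv : IsProperSimplex P v) {t : ι → ℝ}
    (h : ∑ i, t i • v i ∈ posInterior V) (i : ι) : 0 < t i := by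
  classical
  by_contra! hi
  refine hv.facet i ?_
  have hM : ∃ M : ℝ, 0 < M ∧ ∀ j, t j ≤ M :=
    ⟨∑ j, |t j| + 1, by positivity, fun j => (le_abs_self _).trans
      ((Finset.single_le_sum (f := fun j => |t j|) (fun _ _ => abs_nonneg _)
        (Finset.mem_univ j)).trans (by simp))⟩
  obtain ⟨M, hM, htM⟩ := hM
  refine mem_posInterior_of_le_smul hM h ?_
  rw [← Finset.sum_erase_eq_sub (Finset.mem_univ i), ← Finset.add_sum_erase _ _ (Finset.mem_univ i),
    Finset.smul_sum]
  have h1 : t i • v i ≤ 0 := smul_nonpos_of_nonpos_of_nonneg hi (hP _ (hv.mem i))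
  calc _ ≤ 0 + ∑ j ∈ Finset.univ.erase i, t j • v j := by gcongr
    _ ≤ _ := by
      rw [zero_add]
      exact Finset.sum_le_sum fun j _ => smul_le_smul_coeff (hP _ (hv.mem j)) (htM j)

lemma mem_posInterior (hP : ∀ p ∈ P, 0 ≤ p) (hv : IsProperSimplex P v) {t : ι → ℝ}
    (ht : ∀ i, 0 < t i) : ∑ i, t i • v i ∈ posInterior V := by
  have : ∃ m : ℝ, 0 < m ∧ ∀ i, m ≤ t i := by
    rcases isEmpty_or_nonempty ι with h | h
    · exact ⟨1, one_pos, fun i => h.elim i⟩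
    · obtain ⟨i, hi⟩ := Finite.exists_min t
      exact ⟨t i, ht i, hi⟩
  obtain ⟨m, hm, hmt⟩ := this
  refine posInterior_mono (smul_mem_posInterior hm hv.sum_mem) ?_
  rw [Finset.smul_sum]
  exact Finset.sum_le_sum fun j _ => smul_le_smul_coeff (hP _ (hv.mem j)) (hmt j)

/-- A positive coefficient at i ∉ J would bound v i by a multiple of the sum of the other
generators. The facet opposite to i would then dominate a multiple of the full sum and be interior.
-/
lemma coeff_eq_zero_of_le (hP : ∀ p ∈ P, 0 ≤ p) (hv : IsProperSimplex P v) {t : ι → ℝ}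
    (ht : ∀ i, 0 ≤ t i) {J : Finset ι} {C : ℝ} (hC : 0 < C)
    (h : ∑ i, t i • v i ≤ C • ∑ i ∈ J, v i) {i : ι} (hi : i ∉ J) : t i = 0 := by
  classical
  have hv0 : ∀ i, 0 ≤ v i := fun i => hP _ (hv.mem i)
  by_contra h0
  have hti : 0 < t i := (ht i).lt_of_ne' h0
  have h1 : t i • v i ≤ C • ∑ i ∈ J, v i :=
    (Finset.single_le_sum (f := fun i => t i • v i)
      (fun j _ => smul_nonneg (ht j) (hv0 j)) (Finset.mem_univ i)).trans h
  have h2 : ∑ i ∈ J, v i ≤ ∑ j, v j - v i := by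
    rw [← Finset.sum_erase_eq_sub (Finset.mem_univ i)]
    exact Finset.sum_le_sum_of_subset_of_nonneg
      (fun j hj => Finset.mem_erase.2 ⟨fun h => hi (h ▸ hj), Finset.mem_univ j⟩)
      fun i _ _ => hv0 i
  refine hv.facet i (mem_posInterior_of_le_smul (M := (t i)⁻¹ * C + 1)
    (by positivity) hv.sum_mem ?_)
  have h3 := smul_le_smul_vec (inv_nonneg.2 hti.le) h1
  rw [smul_smul, inv_mul_cancel₀ hti.ne', one_smul, smul_smul] at h3
  calc ∑ j, v j = v i + (∑ j, v j - v i) := by abel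
    _ ≤ ((t i)⁻¹ * C) • (∑ j, v j - v i) + (1 : ℝ) • (∑ j, v j - v i) :=
      add_le_add (h3.trans (smul_le_smul_vec (by positivity) h2)) (by rw [one_smul])
    _ = _ := (add_smul _ _ _).symm

/-- Adding 1 to every coefficient outside J makes the combination dominate a multiple of the full
sum. It is then interior, so all its coefficients are positive, while those in J were not changed.
-/
lemma coeff_pos_of_le (hP : ∀ p ∈ P, 0 ≤ p) (hv : IsProperSimplex P v) {t : ι → ℝ}
    (ht : ∀ i, 0 ≤ t i) {J : Finset ι} {C : ℝ} (hC : 0 < C)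
    (h : ∑ i ∈ J, v i ≤ C • ∑ i, t i • v i) {i : ι} (hi : i ∈ J) : 0 < t i := by
  classical
  have hv0 : ∀ i, 0 ≤ v i := fun i => hP _ (hv.mem i)
  have h1 : ∑ j, (t j + if j ∈ J then 0 else 1) • v j = ∑ j, t j • v j + ∑ j ∈ Jᶜ, v j := by
    simp only [add_smul, Finset.sum_add_distrib, ite_smul, zero_smul, one_smul]
    congr 1
    rw [← Finset.sum_subset (Finset.subset_univ Jᶜ) fun j _ hj => by simp_all]
    exact Finset.sum_congr rfl fun j hj => by simp [Finset.mem_compl.1 hj]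
  have h2 := hv.pos_of_mem_posInterior hP (t := fun j => t j + if j ∈ J then 0 else 1)
    (mem_posInterior_of_le_smul (M := C + 1) (by linarith) hv.sum_mem (by
      rw [h1, ← Finset.sum_add_sum_compl J v, smul_add]
      refine add_le_add (h.trans (smul_le_smul_coeff (Finset.sum_nonneg fun j _ =>
        smul_nonneg (ht j) (hv0 j)) (by linarith))) ?_
      exact (one_smul ℝ _).ge.trans (smul_le_smul_coeff (Finset.sum_nonneg fun i _ => hv0 i)
        (by linarith)))) i
  simpa [hi] using h2

/-- A relation with positive maximal coefficient g k could be divided by g k and subtracted from the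
sum of all generators. The same interior vector would then be a combination with coefficient 0 at k.
-/
lemma linearIndependent (hP : ∀ p ∈ P, 0 ≤ p) (hv : IsProperSimplex P v) :
    LinearIndependent ℝ v := by
  rw [Fintype.linearIndependent_iff]
  have key : ∀ g : ι → ℝ, ∑ i, g i • v i = 0 → ∀ i, g i ≤ 0 := by
    intro g hg i
    by_contra! hi
    have : Nonempty ι := ⟨i⟩
    obtain ⟨k, hk⟩ := Finite.exists_max g
    have hk0 : 0 < g k := hi.trans_le (hk i)
    have h1 : ∑ j, (1 - g j / g k) • v j = ∑ j, v j := by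
      simp only [sub_smul, one_smul, Finset.sum_sub_distrib, div_eq_inv_mul, mul_smul,
        ← Finset.smul_sum, hg, smul_zero, sub_zero]
    have := hv.pos_of_mem_posInterior hP (h1 ▸ hv.sum_mem) k
    simp [div_self hk0.ne'] at this
  intro g hg i
  have h1 := key g hg i
  have h2 := key (-g) (by simp [hg]) i
  simp only [Pi.neg_apply] at h2
  linarith

lemma hull_nonneg (hP : ∀ p ∈ P, 0 ≤ p) (hv : IsProperSimplex P v) : ∀ x ∈ hull v, 0 ≤ x :=
  OrderedCone.hull_nonneg fun i => hP _ (hv.mem i)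

/-- The facet opposite to i is not interior, so the approximations of the other generators together
miss some u k. The sum of all of them is interior and misses nothing. Hence this u k belongs to v i
alone. -/
lemma exists_injection (hP' : ∀ p ∈ P', 0 ≤ p) (hv : IsProperSimplex P v)
    (hu : IsProperSimplex P' u) {D : ℝ} (hD : 0 < D) (α : ι → κ → ℝ) (hα : ∀ i k, 0 ≤ α i k)
    (h1 : ∀ i, ∑ k, α i k • u k ≤ v i) (h2 : ∀ i, v i ≤ D • ∑ k, α i k • u k) :
    ∃ t : ι → κ, Function.Injective t ∧ (∀ i, 0 < α i (t i)) ∧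
      ∀ i j, j ≠ i → α j (t i) = 0 := by
  classical
  have hsum : ∀ s : Finset ι, ∑ i ∈ s, ∑ k, α i k • u k = ∑ k, (∑ i ∈ s, α i k) • u k := by
    intro s
    rw [Finset.sum_comm]
    simp_rw [Finset.sum_smul]
  have hex : ∀ i, ∃ k, ∀ j, j ≠ i → α j k = 0 := by
    intro i
    by_contra! hcon
    refine hv.facet i ?_
    rw [← Finset.sum_erase_eq_sub (Finset.mem_univ i)]
    refine posInterior_mono ?_ (Finset.sum_le_sum fun j _ => h1 j)
    rw [hsum]
    refine hu.mem_posInterior hP' fun k => ?_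
    obtain ⟨j, hj, hjk⟩ := hcon k
    exact (Finset.sum_pos_iff_of_nonneg fun j _ => hα j k).2
      ⟨j, by simp [hj], (hα j k).lt_of_ne' hjk⟩
  choose t ht using hex
  have hpos : ∀ i, 0 < α i (t i) := by
    intro i
    have h3 : ∑ k, (∑ i, α i k) • u k ∈ posInterior V := by
      rw [← hsum]
      refine mem_posInterior_of_le_smul hD hv.sum_mem ?_
      rw [Finset.smul_sum]
      exact Finset.sum_le_sum fun j _ => h2 j
    have := hu.pos_of_mem_posInterior hP' h3 (t i)
    rwa [Finset.sum_eq_single i (fun j _ hj => ht i j hj) (by simp)] at this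
  refine ⟨t, fun i j hij => ?_, hpos, ht⟩
  by_contra hne
  have := hpos i
  rw [hij, ht j i hne] at this
  exact lt_irrefl _ this

lemma exists_coeff {D : ℝ} (h : ∀ i, Near D (hull u) (v i)) : ∃ α : ι → κ → ℝ,
    (∀ i k, 0 ≤ α i k) ∧ (∀ i, ∑ k, α i k • u k ≤ v i) ∧ ∀ i, v i ≤ D • ∑ k, α i k • u k := by
  choose q hq h1 h2 using h
  choose α hα hqα using hq
  exact ⟨α, hα, fun i => hqα i ▸ h1 i, fun i => hqα i ▸ h2 i⟩

lemma card_le (hP' : ∀ p ∈ P', 0 ≤ p) (hv : IsProperSimplex P v)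
    (hu : IsProperSimplex P' u) {D : ℝ} (hD : 0 < D) (h : ∀ i, Near D (hull u) (v i)) :
    Fintype.card ι ≤ Fintype.card κ := by
  obtain ⟨α, hα, h1, h2⟩ := exists_coeff h
  obtain ⟨t, ht, -⟩ := hv.exists_injection hP' hu hD α hα h1 h2
  exact Fintype.card_le_of_injective t ht

/-- When the numbers of generators agree, the private generators of `exists_injection` exhaust all u
k. Each v i is then approximated by a multiple of a single generator. -/
lemma exists_bijection (hP' : ∀ p ∈ P', 0 ≤ p) (hv : IsProperSimplex P v)
    (hu : IsProperSimplex P' u) {D : ℝ} (hD : 0 < D) (h : ∀ i, Near D (hull u) (v i))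
    (hcard : Fintype.card κ = Fintype.card ι) :
    ∃ (t : ι ≃ κ) (c : ι → ℝ), (∀ i, 0 < c i) ∧ (∀ i, c i • u (t i) ≤ v i) ∧
      ∀ i, v i ≤ D • c i • u (t i) := by
  obtain ⟨α, hα, h1, h2⟩ := exists_coeff h
  obtain ⟨t, ht, hpos, h0⟩ := hv.exists_injection hP' hu hD α hα h1 h2
  have hb : Function.Bijective t := (Fintype.bijective_iff_injective_and_card t).2 ⟨ht, hcard.symm⟩
  have hsum : ∀ i, ∑ k, α i k • u k = α i (t i) • u (t i) := by
    intro i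
    refine Finset.sum_eq_single (t i) (fun k _ hk => ?_) (by simp)
    obtain ⟨j, rfl⟩ := hb.2 k
    rw [h0 j i fun hij => hk (by rw [hij]), zero_smul]
  exact ⟨Equiv.ofBijective t hb, fun i => α i (t i), hpos, fun i => by simpa [hsum] using h1 i,
    fun i => by simpa [hsum] using h2 i⟩

/-- The bijection bounds each v i above and below by multiples of its partner, and such a bound can
be read backwards. -/
lemma coarselyLE_of_card_eq (hP' : ∀ p ∈ P', 0 ≤ p)
    (hv : IsProperSimplex P v) (hu : IsProperSimplex P' u) (h : CoarselyLE (hull v) (hull u))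
    (hcard : Fintype.card κ = Fintype.card ι) : CoarselyLE (hull u) (hull v) := by
  obtain ⟨D, hD, h⟩ := h
  obtain ⟨t, c, hc, h1, h2⟩ := hv.exists_bijection hP' hu hD
    (fun i => h _ (mem_hull_self v i)) hcard
  refine ⟨D, hD, near_of_mem_hull (zero_mem_hull v) (hull_add v) (hull_smul v) fun k => ?_⟩
  obtain ⟨i, rfl⟩ := t.surjective k
  refine ⟨(D * c i)⁻¹ • v i, hull_smul v _ (by have := hc i; positivity) _ (mem_hull_self v i), ?_, ?_⟩
  · have := smul_le_smul_vec (by have := hc i; positivity : 0 ≤ (D * c i)⁻¹) (h2 i)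
    rwa [smul_smul D, smul_smul, inv_mul_cancel₀ (by have := hc i; positivity), one_smul] at this
  · have := smul_le_smul_vec (by have := hc i; positivity : 0 ≤ (c i)⁻¹) (h1 i)
    rw [smul_smul, inv_mul_cancel₀ (hc i).ne', one_smul] at this
    rwa [mul_inv, mul_smul, smul_smul, mul_inv_cancel₀ hD.ne', one_smul]

lemma comp_equiv (hv : IsProperSimplex P v) (e : κ ≃ ι) : IsProperSimplex P (v ∘ e) where
  mem i := hv.mem _
  sum_mem := by
    have := hv.sum_mem
    rwa [← Equiv.sum_comp e] at this
  facet i := by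
    have := hv.facet (e i)
    rwa [← Equiv.sum_comp e] at this

end IsProperSimplex

end OrderedCone

/-! ### Ultralimits, cone systems and recurrence -/

namespace OrderedCone

open Filter

/-- Order intervals are bounded. -/
class NormalOrder (V : Type*) [NormedAddCommGroup V] [PartialOrder V] : Prop where
  exists_bound : ∃ c : ℝ, 0 < c ∧ ∀ u v : V, 0 ≤ u → u ≤ v → ‖u‖ ≤ c * ‖v‖

lemma exists_eventually_eq_of_finite {α β : Type*} {U : Ultrafilter α} {F : Set β} (hF : F.Finite)
    {f : α → β} (h : ∀ᶠ n in U, f n ∈ F) : ∃ b ∈ F, ∀ᶠ n in U, f n = b := by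
  have : (⋃ b ∈ F, {n | f n = b}) ∈ U := by
    filter_upwards [h] with n hn
    simpa using hn
  exact (Ultrafilter.finite_biUnion_mem_iff hF).1 this

lemma exists_tendsto_of_mem_compact {α E : Type*} [TopologicalSpace E] {U : Ultrafilter α}
    {Z : Set E} (hZ : IsCompact Z) {x : α → E} (h : ∀ᶠ n in U, x n ∈ Z) :
    ∃ a ∈ Z, Tendsto x U (𝓝 a) :=
  hZ.ultrafilter_le_nhds' (U.map x) h

lemma exists_tendsto_of_bounded {α E : Type*} [NormedAddCommGroup E] [ProperSpace E]
    {U : Ultrafilter α} {x : α → E} {R : ℝ} (h : ∀ᶠ n in U, ‖x n‖ ≤ R) :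
    ∃ a, Tendsto x U (𝓝 a) := by
  obtain ⟨a, -, ha⟩ := exists_tendsto_of_mem_compact (isCompact_closedBall (0 : E) R)
    (U := U) (x := x) (by simpa using h)
  exact ⟨a, ha⟩

section Limits

lemma isClosed_hull {V : Type*} [NormedAddCommGroup V] [NormedSpace ℝ V]
    {ι : Type*} [Fintype ι] {v : ι → V} (hv : LinearIndependent ℝ v) :
    IsClosed (hull v) := by
  have h1 : hull v = Fintype.linearCombination ℝ v '' {t | ∀ i, 0 ≤ t i} := by
    ext x
    simp only [hull, Set.mem_ofPred_eq, mem_image, Fintype.linearCombination_apply, eq_comm]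
  rw [h1]
  refine (LinearMap.isClosedEmbedding_of_injective ?_).isClosedMap _ ?_
  · rw [LinearMap.ker_eq_bot]
    exact linearIndependent_iff_injective_fintypeLinearCombination.1 hv
  · rw [Set.ofPred_forall]
    exact isClosed_iInter fun i => isClosed_le continuous_const (continuous_apply i)

variable {V : Type*} [NormedAddCommGroup V] [NormedSpace ℝ V] [FiniteDimensional ℝ V]
  [PartialOrder V] [IsOrderedAddMonoid V] [IsOrderedModule ℝ V] [OrderClosedTopology V]
  [NormalOrder V]
variable {α : Type*} {U : Ultrafilter α}

/-- Normality of the order bounds the norms, and bounded families converge along an ultrafilter. -/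
lemma exists_tendsto_of_le {x y : α → V} {b : V} (hy : Tendsto y U (𝓝 b))
    (h0 : ∀ᶠ n in U, 0 ≤ x n) (h : ∀ᶠ n in U, x n ≤ y n) : ∃ a, Tendsto x U (𝓝 a) := by
  have : ProperSpace V := FiniteDimensional.proper ℝ V
  obtain ⟨c, hc, hn⟩ := NormalOrder.exists_bound (V := V)
  refine exists_tendsto_of_bounded (R := c * (‖b‖ + 1)) ?_
  filter_upwards [h0, h, hy.norm.eventually (gt_mem_nhds (lt_add_one ‖b‖))] with n h1 h2 h3
  exact (hn _ _ h1 h2).trans (by gcongr)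

/-- The approximating points are squeezed between 0 and a convergent family, so they have a limit
too, and closed inequalities survive. -/
lemma near_of_tendsto {D : ℝ} {Q : Set V} (hQ : IsClosed Q) (hQ0 : ∀ q ∈ Q, 0 ≤ q)
    {x : α → V} {a : V} (hx : Tendsto x U (𝓝 a)) (h : ∀ᶠ n in U, Near D Q (x n)) : Near D Q a := by
  have : ∀ n, ∃ q, Near D Q (x n) → q ∈ Q ∧ q ≤ x n ∧ x n ≤ D • q := fun n => by
    by_cases hn : Near D Q (x n)
    · obtain ⟨q, hq⟩ := hn
      exact ⟨q, fun _ => hq⟩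
    · exact ⟨0, fun h => absurd h hn⟩
  choose q hq using this
  have h' := h.mono fun n hn => hq n hn
  obtain ⟨b, hb⟩ := exists_tendsto_of_le hx (h'.mono fun n hn => hQ0 _ hn.1)
    (h'.mono fun n hn => hn.2.1)
  exact ⟨b, hQ.mem_of_tendsto hb (h'.mono fun n hn => hn.1),
    le_of_tendsto_of_tendsto hb hx (h'.mono fun n hn => hn.2.1),
    le_of_tendsto_of_tendsto hx (hb.const_smul D) (h'.mono fun n hn => hn.2.2)⟩

lemma notMem_posInterior_of_tendsto {x : α → V} {a : V} (hx : Tendsto x U (𝓝 a))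
    (h : ∀ᶠ n in U, x n ∉ posInterior V) : a ∉ posInterior V := fun ha =>
  let ⟨_, h1, h2⟩ := (h.and (hx.eventually (isOpen_posInterior.mem_nhds ha))).exists
  h1 h2

/-- A vector `x ≥ 0` is an order unit, continuously in the norm, of the space of all vectors that it
dominates. -/
lemma exists_le_norm_smul {x : V} (hx : 0 ≤ x) : ∃ C : ℝ, 0 < C ∧
    ∀ y : V, (∃ M : ℝ, y ≤ M • x ∧ -y ≤ M • x) → y ≤ (C * ‖y‖) • x := by
  -- The vectors bounded on both sides by multiples of x form a finite-dimensional space. Bounding a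
  -- basis in the order and the coordinates by the norm bounds every vector.
  let W : Submodule ℝ V :=
    { carrier := {y | ∃ M : ℝ, y ≤ M • x ∧ -y ≤ M • x}
      zero_mem' := ⟨0, by simp⟩
      add_mem' := by
        rintro a b ⟨M, h1, h2⟩ ⟨N, h3, h4⟩
        exact ⟨M + N, by rw [add_smul]; exact add_le_add h1 h3, by
          rw [add_smul, neg_add]; exact add_le_add h2 h4⟩
      smul_mem' := by
        rintro c y ⟨M, h1, h2⟩
        refine ⟨|c| * M, ?_⟩
        rw [mul_smul]
        rcases abs_cases c with ⟨hc, hc'⟩ | ⟨hc, hc'⟩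
        · rw [hc, ← smul_neg]
          exact ⟨smul_le_smul_vec hc' h1, smul_le_smul_vec hc' h2⟩
        · rw [hc]
          have h3 := smul_le_smul_vec (neg_pos.2 hc').le h1
          have h4 := smul_le_smul_vec (neg_pos.2 hc').le h2
          rw [neg_smul] at h3
          rw [smul_neg, neg_smul, neg_neg] at h4
          exact ⟨h4, h3⟩ }
  let b := Module.finBasis ℝ W
  have hb : ∀ i, ∃ M : ℝ, 0 ≤ M ∧ ((b i : W) : V) ≤ M • x ∧ -((b i : W) : V) ≤ M • x := fun i => by
    obtain ⟨M, h1, h2⟩ := (b i).2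
    exact ⟨max M 0, le_max_right _ _, h1.trans (smul_le_smul_coeff hx (le_max_left _ _)),
      h2.trans (smul_le_smul_coeff hx (le_max_left _ _))⟩
  choose M hM0 hM1 hM2 using hb
  let φ : ∀ i, W →L[ℝ] ℝ := fun i => LinearMap.toContinuousLinearMap (b.coord i)
  refine ⟨∑ i, ‖φ i‖ * M i + 1, add_pos_of_nonneg_of_pos
    (Finset.sum_nonneg fun i _ => mul_nonneg (norm_nonneg (φ i)) (hM0 i)) one_pos, fun y hy => ?_⟩
  have h1 : y = ∑ i, φ i ⟨y, hy⟩ • ((b i : W) : V) := by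
    have := congrArg W.subtype (b.sum_repr ⟨y, hy⟩)
    rw [map_sum] at this
    exact this.symm
  have h2 : ∀ i, φ i ⟨y, hy⟩ • ((b i : W) : V) ≤ (‖φ i‖ * M i * ‖y‖) • x := fun i => by
    have h3 : ‖φ i ⟨y, hy⟩‖ ≤ ‖φ i‖ * ‖y‖ := (φ i).le_opNorm _
    have h4 : φ i ⟨y, hy⟩ • ((b i : W) : V) ≤ (|φ i ⟨y, hy⟩| * M i) • x := by
      rw [mul_smul]
      rcases abs_cases (φ i ⟨y, hy⟩) with ⟨hc, hc'⟩ | ⟨hc, hc'⟩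
      · rw [hc]
        exact smul_le_smul_vec hc' (hM1 i)
      · rw [hc]
        have := smul_le_smul_vec (neg_pos.2 hc').le (hM2 i)
        rwa [smul_neg, neg_smul, neg_neg] at this
    refine h4.trans (smul_le_smul_coeff hx ?_)
    rw [mul_right_comm]
    exact mul_le_mul_of_nonneg_right h3 (hM0 i)
  calc y = ∑ i, φ i ⟨y, hy⟩ • ((b i : W) : V) := h1
    _ ≤ ∑ i, (‖φ i‖ * M i * ‖y‖) • x := Finset.sum_le_sum fun i _ => h2 i
    _ ≤ _ := by
      rw [← Finset.sum_smul, ← Finset.sum_mul]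
      exact smul_le_smul_coeff hx (by gcongr; linarith)

/-- This turns nearness into incidence: a cone near a point of Z meets the compact thickening, so
local finiteness also covers cones that are merely near Z. -/
lemma isCompact_thickening {Z : Set V} (hZ : IsCompact Z) {D : ℝ} (hZ0 : ∀ z ∈ Z, 0 ≤ z)
    (hD : 0 < D) : IsCompact {q : V | ∃ z ∈ Z, q ≤ z ∧ z ≤ D • q} := by
  have : ProperSpace V := FiniteDimensional.proper ℝ V
  rw [isCompact_iff_ultrafilter_le_nhds']
  intro W hW
  have hex : ∀ q : V, ∃ z, (∃ z ∈ Z, q ≤ z ∧ z ≤ D • q) → z ∈ Z ∧ q ≤ z ∧ z ≤ D • q := fun q => by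
    by_cases hn : ∃ z ∈ Z, q ≤ z ∧ z ≤ D • q
    · obtain ⟨z, hz⟩ := hn
      exact ⟨z, fun _ => hz⟩
    · exact ⟨0, fun h => absurd h hn⟩
  choose z hz using hex
  have hW' : ∀ᶠ q in W, z q ∈ Z ∧ q ≤ z q ∧ z q ≤ D • q := by
    filter_upwards [hW] with q hq using hz q hq
  obtain ⟨a, haZ, ha⟩ := exists_tendsto_of_mem_compact hZ (hW'.mono fun q hq => hq.1)
  obtain ⟨b, hb⟩ := exists_tendsto_of_le (x := id) ha (hW'.mono fun q hq => by
    have h1 := (hZ0 _ hq.1).trans hq.2.2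
    have := smul_le_smul_vec (inv_nonneg.2 hD.le) h1
    rwa [smul_smul, inv_mul_cancel₀ hD.ne', one_smul, smul_zero] at this)
    (hW'.mono fun q hq => hq.2.1)
  exact ⟨b, ⟨a, haZ, le_of_tendsto_of_tendsto hb ha (hW'.mono fun q hq => hq.2.1),
    le_of_tendsto_of_tendsto ha (hb.const_smul D) (hW'.mono fun q hq => hq.2.2)⟩, hb⟩

end Limits

/-- A cocompact group of linear automorphisms of a closed convex cone `P` of non-negative vectors,
together with an invariant family `𝒞` of simplicial cones in `P` that is locally finite and coarsely
complete. -/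
structure ConeSystem (V : Type*) [NormedAddCommGroup V] [NormedSpace ℝ V] [PartialOrder V] where
  P : Set V
  𝒞 : Set (Set V)
  𝒢 : Set (V ≃L[ℝ] V)
  nonneg : ∀ p ∈ P, 0 ≤ p
  isClosed : IsClosed P
  zero_mem : (0 : V) ∈ P
  add_mem : ∀ p ∈ P, ∀ q ∈ P, p + q ∈ P
  smul_mem : ∀ c : ℝ, 0 ≤ c → ∀ p ∈ P, c • p ∈ P
  map_le : ∀ g ∈ 𝒢, ∀ u v, g u ≤ g v ↔ u ≤ v
  map_mem : ∀ g ∈ 𝒢, ∀ v, g v ∈ P ↔ v ∈ P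
  image_mem : ∀ g ∈ 𝒢, ∀ Q ∈ 𝒞, g '' Q ∈ 𝒞
  symm_mem : ∀ g ∈ 𝒢, g.symm ∈ 𝒢
  cocompact : ∃ Z : Set V, IsCompact Z ∧ Z ⊆ posInterior V ∧
    ∀ p ∈ P, p ∈ posInterior V → ∃ g ∈ 𝒢, g p ∈ Z
  simplicial : ∀ Q ∈ 𝒞, ∃ n : ℕ, 3 ≤ n ∧ ∃ v : Fin n → V, IsProperSimplex P v ∧ Q = hull v
  finite : ∀ Z : Set V, IsCompact Z → Z ⊆ posInterior V → {Q ∈ 𝒞 | (Q ∩ Z).Nonempty}.Finite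
  complete : ∃ D : ℝ, 0 < D ∧ ∀ (n : ℕ) (v : Fin n → V), 3 ≤ n → IsProperSimplex P v →
    ∃ Q ∈ 𝒞, ∀ i, Near D Q (v i)

namespace ConeSystem

variable {V : Type*} [NormedAddCommGroup V] [NormedSpace ℝ V] [FiniteDimensional ℝ V]
  [PartialOrder V] [IsOrderedAddMonoid V] [IsOrderedModule ℝ V] [OrderClosedTopology V]
  [NormalOrder V]
variable (s : ConeSystem V)

section Maps

variable {s} {g : V ≃L[ℝ] V}

lemma map_nonneg (hg : g ∈ s.𝒢) {v : V} : 0 ≤ g v ↔ 0 ≤ v := by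
  simpa using s.map_le g hg 0 v

lemma map_mem_posInterior (hg : g ∈ s.𝒢) {v : V} : g v ∈ posInterior V ↔ v ∈ posInterior V := by
  have h : g ⁻¹' {v : V | 0 ≤ v} = {v : V | 0 ≤ v} := by
    ext w
    exact map_nonneg hg
  have h2 : g ⁻¹' posInterior V = posInterior V := by
    have := g.toHomeomorph.preimage_interior {v : V | 0 ≤ v}
    change g ⁻¹' (interior _) = interior (g ⁻¹' _) at this
    rw [h] at this
    exact this
  exact Set.ext_iff.1 h2 v

lemma map_isProperSimplex (hg : g ∈ s.𝒢) {ι : Type*} [Fintype ι] {v : ι → V}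
    (hv : IsProperSimplex s.P v) : IsProperSimplex s.P fun i => g (v i) where
  mem i := (s.map_mem g hg _).2 (hv.mem i)
  sum_mem := by
    rw [← map_sum]
    exact (map_mem_posInterior hg).2 hv.sum_mem
  facet i := by
    rw [← map_sum, ← map_sub]
    exact fun h => hv.facet i ((map_mem_posInterior hg).1 h)

lemma image_hull {ι : Type*} [Fintype ι] (v : ι → V) : g '' hull v = hull fun i => g (v i) :=
  hull_image (g : V →ₗ[ℝ] V) v

lemma near_image (hg : g ∈ s.𝒢) {D : ℝ} {Q : Set V} {p : V} (h : Near D Q p) :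
    Near D (g '' Q) (g p) := by
  obtain ⟨q, hq, h1, h2⟩ := h
  exact ⟨g q, mem_image_of_mem _ hq, (s.map_le g hg _ _).2 h1, by
    rw [← map_smul]; exact (s.map_le g hg _ _).2 h2⟩

lemma coarselyLE_image (hg : g ∈ s.𝒢) {Q Q' : Set V} (h : CoarselyLE Q Q') :
    CoarselyLE (g '' Q) (g '' Q') := by
  obtain ⟨D, hD, h⟩ := h
  refine ⟨D, hD, ?_⟩
  rintro _ ⟨p, hp, rfl⟩
  exact near_image hg (h p hp)

lemma coarselyLE_of_image (hg : g ∈ s.𝒢) {Q Q' : Set V} (h : CoarselyLE (g '' Q) (g '' Q')) :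
    CoarselyLE Q Q' := by
  have := coarselyLE_image (s.symm_mem g hg) h
  simpa [image_image] using this

end Maps

lemma hull_subset {ι : Type*} [Fintype ι] {v : ι → V} (hv : IsProperSimplex s.P v) :
    hull v ⊆ s.P := hull_subset_of_cone s.zero_mem s.add_mem s.smul_mem hv.mem

lemma isClosed_hull {ι : Type*} [Fintype ι] {v : ι → V} (hv : IsProperSimplex s.P v) :
    IsClosed (hull v) := OrderedCone.isClosed_hull (hv.linearIndependent s.nonneg)

lemma exists_near {ι : Type*} [Fintype ι] : ∃ D : ℝ, 0 < D ∧ ∀ v : ι → V,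
    3 ≤ Fintype.card ι → IsProperSimplex s.P v → ∃ Q ∈ s.𝒞, ∀ x ∈ hull v, Near D Q x := by
  obtain ⟨D, hD, h⟩ := s.complete
  refine ⟨D, hD, fun v hc hv => ?_⟩
  let e := (Fintype.equivFin ι).symm
  obtain ⟨Q, hQ, hn⟩ := h _ (v ∘ e) hc (hv.comp_equiv e)
  obtain ⟨n, -, u, hu, rfl⟩ := s.simplicial Q hQ
  refine ⟨_, hQ, near_of_mem_hull (zero_mem_hull u) (hull_add u) (hull_smul u) fun i => ?_⟩
  simpa using hn (e.symm i)

/-- Only finitely many members of the family have a point near a given compact set. -/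
lemma finite_near {Z : Set V} (hZ : IsCompact Z) (hZi : Z ⊆ posInterior V) {D : ℝ} (hD : 0 < D) :
    {Q ∈ s.𝒞 | ∃ z ∈ Z, Near D Q z}.Finite := by
  refine (s.finite _ (isCompact_thickening hZ (fun z hz => nonneg_of_mem_posInterior (hZi hz)) hD)
    ?_).subset ?_
  · rintro q ⟨z, hz, h1, h2⟩
    exact mem_posInterior_of_le_smul hD (hZi hz) h2
  · rintro Q ⟨hQ, z, hz, q, hq, h1, h2⟩
    exact ⟨hQ, q, hq, z, hz, h1, h2⟩

/-- Points of the interior of a simplicial cone of the family that move arbitrarily can be brought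
back to a compact set, in such a way that the images of the cone and of its generators converge. -/
lemma recurrence {n : ℕ} {v : Fin n → V} (hv : IsProperSimplex s.P v) (hQ : hull v ∈ s.𝒞)
    {c : ℕ → Fin n → ℝ} (hc : ∀ m i, 0 < c m i) :
    ∃ (h : ℕ → V ≃L[ℝ] V) (u : Fin n → V) (γ : ℕ → Fin n → ℝ), (∀ m, h m ∈ s.𝒢) ∧
      IsProperSimplex s.P u ∧ hull u ∈ s.𝒞 ∧
      (∀ᶠ m in hyperfilter ℕ, h m '' hull v = hull u) ∧
      (∀ᶠ m in hyperfilter ℕ, ∀ i, h m (c m i • v i) = γ m i • u i) ∧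
      ∀ i, Tendsto (fun m => γ m i) (hyperfilter ℕ) (𝓝 1) := by
  obtain ⟨Z, hZ, hZi, hcoc⟩ := s.cocompact
  have hp : ∀ m, ∑ i, c m i • v i ∈ hull v := fun m => ⟨c m, fun i => (hc m i).le, rfl⟩
  have hg : ∀ m, ∃ g ∈ s.𝒢, g (∑ i, c m i • v i) ∈ Z := fun m =>
    hcoc _ (s.hull_subset hv (hp m)) (hv.mem_posInterior s.nonneg (hc m))
  choose h hh hhZ using hg
  -- All translates meet the compact set Z. By local finiteness they take finitely many values, and
  -- the ultrafilter selects one.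
  obtain ⟨Q₁, ⟨hQ₁, -⟩, heq⟩ := exists_eventually_eq_of_finite (U := hyperfilter ℕ)
    (s.finite Z hZ hZi) (f := fun m => h m '' hull v)
    (Eventually.of_forall fun m => ⟨s.image_mem _ (hh m) _ hQ, _, mem_image_of_mem _ (hp m), hhZ m⟩)
  obtain ⟨k, -, u, hu, rfl⟩ := s.simplicial Q₁ hQ₁
  have near1 : ∀ {κ κ' : Type} [Fintype κ] [Fintype κ'] {a : κ → V} {b : κ' → V}, hull a = hull b →
      ∀ i, Near 1 (hull b) (a i) := fun hab i => ⟨_, hab ▸ mem_hull_self _ i, le_rfl, by simp⟩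
  obtain rfl : k = n := by
    obtain ⟨m, hm⟩ := heq.exists
    rw [image_hull] at hm
    have hv' := map_isProperSimplex (hh m) hv
    have h1 := hv'.card_le s.nonneg hu one_pos (near1 hm)
    have h2 := hu.card_le s.nonneg hv' one_pos (near1 hm.symm)
    simp only [Fintype.card_fin] at h1 h2
    omega
  -- Equality of two simplicial cones is nearness with constant 1, so the bijection of generators
  -- holds up to positive scalars, with equality.
  have hex : ∀ m, ∃ (t : Fin k ≃ Fin k) (δ : Fin k → ℝ), h m '' hull v = hull u →
      ∀ i, 0 < δ i ∧ h m (c m i • v i) = δ i • u (t i) := by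
    intro m
    by_cases hm : h m '' hull v = hull u
    · have hm' := hm
      rw [image_hull] at hm'
      obtain ⟨t, δ, hδ, h1, h2⟩ := (map_isProperSimplex (hh m) hv).exists_bijection s.nonneg hu
        one_pos (near1 hm') rfl
      refine ⟨t, fun i => c m i * δ i, fun _ i => ⟨mul_pos (hc m i) (hδ i), ?_⟩⟩
      have h2' := h2 i
      rw [one_smul] at h2'
      rw [map_smul, mul_smul, le_antisymm h2' (h1 i)]
    · exact ⟨Equiv.refl _, 0, fun h => absurd h hm⟩
  choose t δ hδ using hex
  obtain ⟨t₀, -, ht₀⟩ := exists_eventually_eq_of_finite (U := hyperfilter ℕ)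
    (Set.finite_univ (α := Fin k ≃ Fin k)) (f := t) (by simp)
  obtain ⟨z, hzZ, hz⟩ := exists_tendsto_of_mem_compact (U := hyperfilter ℕ) hZ
    (Eventually.of_forall hhZ)
  have hev : ∀ᶠ m in hyperfilter ℕ, ∀ i, 0 < δ m i ∧ h m (c m i • v i) = δ m i • u (t₀ i) := by
    filter_upwards [heq, ht₀] with m h1 h2 i
    rw [← h2]
    exact hδ m h1 i
  have hpos : ∀ m i, 0 ≤ h m (c m i • v i) := fun m i =>
    (map_nonneg (hh m)).2 (smul_nonneg (hc m i).le (s.nonneg _ (hv.mem i)))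
  have hlim : ∀ i, ∃ r : ℝ, Tendsto (fun m => δ m i) (hyperfilter ℕ) (𝓝 r) := by
    intro i
    obtain ⟨x, hx⟩ := exists_tendsto_of_le (x := fun m => h m (c m i • v i)) hz
      (Eventually.of_forall fun m => hpos m i) (Eventually.of_forall fun m => by
        rw [map_sum]
        exact Finset.single_le_sum (f := fun i => h m (c m i • v i)) (fun j _ => hpos m j)
          (Finset.mem_univ i))
    have hu0 : 0 < ‖u (t₀ i)‖ := norm_pos_iff.2 ((hu.linearIndependent s.nonneg).ne_zero _)
    refine exists_tendsto_of_bounded (R := (‖x‖ + 1) / ‖u (t₀ i)‖) ?_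
    filter_upwards [hev, hx.norm.eventually (gt_mem_nhds (lt_add_one ‖x‖))] with m h1 h2
    rw [le_div_iff₀ hu0, ← norm_smul, ← (h1 i).2]
    exact h2.le
  choose r hr using hlim
  have hzr : z = ∑ i, r i • u (t₀ i) := by
    refine tendsto_nhds_unique hz ((tendsto_finsetSum _ fun i _ =>
      (hr i).smul_const (u (t₀ i))).congr' ?_)
    filter_upwards [hev] with m hm
    rw [map_sum]
    exact Finset.sum_congr rfl fun i _ => (hm i).2.symm
  -- The limit point is interior, so no coefficient degenerates. Absorbing the limits r into the
  -- generators normalizes the remaining scalars to tend to 1.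
  have hr0 : ∀ i, 0 < r i := (hu.comp_equiv t₀).pos_of_mem_posInterior s.nonneg (t := r)
    (by simpa [← hzr] using hZi hzZ)
  refine ⟨h, fun i => r i • u (t₀ i), fun m i => δ m i / r i, hh, ⟨fun i => ?_, ?_, fun i hi => ?_⟩,
    ?_, ?_, ?_, fun i => ?_⟩
  · exact s.smul_mem _ (hr0 i).le _ (hu.mem _)
  · simpa [← hzr] using hZi hzZ
  · classical
    have h1 : ∑ j, r j • u (t₀ j) - r i • u (t₀ i)
        = ∑ j, (if j = i then 0 else r j) • (u ∘ t₀) j := by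
      rw [← Finset.sum_erase_eq_sub (Finset.mem_univ i), ← Finset.sum_erase_add _ _ (Finset.mem_univ i)]
      simp only [if_true, zero_smul, add_zero]
      exact Finset.sum_congr rfl fun j hj => by simp [Finset.ne_of_mem_erase hj]
    rw [h1] at hi
    simpa using (hu.comp_equiv t₀).pos_of_mem_posInterior s.nonneg hi i
  · rwa [hull_smul_pos _ _ hr0, show (fun i => u (t₀ i)) = u ∘ t₀ from rfl, hull_comp_equiv]
  · rwa [hull_smul_pos _ _ hr0, show (fun i => u (t₀ i)) = u ∘ t₀ from rfl, hull_comp_equiv]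
  · filter_upwards [hev] with m hm i
    rw [(hm i).2, smul_smul, div_mul_cancel₀ _ (hr0 i).ne']
  · have := (hr i).div_const (r i)
    rwa [div_self (hr0 i).ne'] at this

end ConeSystem

end OrderedCone

/-! ### Coarsely maximal cones and the faces of their vertices -/

namespace OrderedCone

open Filter

namespace ConeSystem

variable {V : Type*} [NormedAddCommGroup V] [NormedSpace ℝ V] [FiniteDimensional ℝ V]
  [PartialOrder V] [IsOrderedAddMonoid V] [IsOrderedModule ℝ V] [OrderClosedTopology V]
  [NormalOrder V]
variable (s : ConeSystem V)

/-- The members of the family that are coarsely maximal. -/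
def maximal : Set (Set V) := {Q ∈ s.𝒞 | ∀ T ∈ s.𝒞, CoarselyLE Q T → CoarselyLE T Q}

lemma image_mem_maximal {g : V ≃L[ℝ] V} (hg : g ∈ s.𝒢) {Q : Set V} (hQ : Q ∈ s.maximal) :
    g '' Q ∈ s.maximal := by
  refine ⟨s.image_mem g hg Q hQ.1, fun T hT h => ?_⟩
  have h1 : g '' (g.symm '' T) = T := by simp [image_image]
  rw [← h1] at h ⊢
  exact coarselyLE_image hg (hQ.2 _ (s.image_mem _ (s.symm_mem g hg) T hT) (coarselyLE_of_image hg h))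

lemma nonneg_of_mem {Q : Set V} (hQ : Q ∈ s.𝒞) : ∀ q ∈ Q, 0 ≤ q := by
  obtain ⟨n, -, v, hv, rfl⟩ := s.simplicial Q hQ
  exact hv.hull_nonneg s.nonneg

lemma smul_mem_of_mem {Q : Set V} (hQ : Q ∈ s.𝒞) : ∀ c : ℝ, 0 ≤ c → ∀ q ∈ Q, c • q ∈ Q := by
  obtain ⟨n, -, v, hv, rfl⟩ := s.simplicial Q hQ
  exact hull_smul v

lemma isClosed_of_mem {Q : Set V} (hQ : Q ∈ s.𝒞) : IsClosed Q := by
  obtain ⟨n, -, v, hv, rfl⟩ := s.simplicial Q hQ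
  exact s.isClosed_hull hv

/-- If all generators of a simplicial cone are near a member of the family, with varying constants,
then the cone is coarsely contained in it. -/
lemma coarselyLE_of_near {n : ℕ} {v : Fin n → V} {Q : Set V} (hQ : Q ∈ s.𝒞)
    (h : ∀ i, ∃ D : ℝ, 0 < D ∧ Near D Q (v i)) : CoarselyLE (hull v) Q := by
  choose D hD h using h
  have hQ0 := s.nonneg_of_mem hQ
  obtain ⟨k, -, u, hu, rfl⟩ := s.simplicial Q hQ
  refine ⟨∑ i, D i + 1, add_pos_of_nonneg_of_pos (Finset.sum_nonneg fun i _ => (hD i).le) one_pos,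
    near_of_mem_hull (zero_mem_hull u) (hull_add u) (hull_smul u) fun i => (h i).mono hQ0 ?_⟩
  have := Finset.single_le_sum (f := D) (fun i _ => (hD i).le) (Finset.mem_univ i)
  linarith

section

variable {s} {n : ℕ} {v : Fin n → V}

/-- If `w` lies in the closed face generated by the generators in `J` and the segment from `w` to the
opposite face meets the interior, then `w` lies in the open face. -/
lemma exists_sum_le_smul (hv : IsProperSimplex s.P v) (hQ : hull v ∈ s.𝒞) (J : Finset (Fin n))
    {w : V} (hw : 0 ≤ w) {M : ℝ} (hM : 0 < M) (hwJ : w ≤ M • ∑ i ∈ J, v i)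
    (hwb : w + ∑ i ∈ Jᶜ, v i ∈ posInterior V) : ∃ M' : ℝ, 0 < M' ∧ ∑ i ∈ J, v i ≤ M' • w := by
  set b := ∑ i ∈ Jᶜ, v i with hb
  set x := ∑ i ∈ J, v i with hx
  have hb0 : 0 ≤ b := Finset.sum_nonneg fun i _ => s.nonneg _ (hv.mem i)
  have hx0 : 0 ≤ x := Finset.sum_nonneg fun i _ => s.nonneg _ (hv.mem i)
  obtain ⟨L, hL, hL1, hxL⟩ : ∃ L : ℝ, 0 < L ∧ 1 ≤ L ∧ x + b ≤ L • (w + b) := by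
    obtain ⟨L, hL, h⟩ := exists_le_smul hwb (x + b)
    exact ⟨max L 1, by positivity, le_max_right _ _,
      h.trans (smul_le_smul_coeff (add_nonneg hw hb0) (le_max_left _ _))⟩
  -- Follow the points x + (m + 1) b towards the opposite face. After translating back, x keeps
  -- bounded size while b itself tends to 0. The limit of the hypothesis about w + b becomes a
  -- statement about w alone.
  obtain ⟨h, u, γ, hh, hu, hQ₁, heq, hγ, hγ1⟩ := s.recurrence hv hQ
    (c := fun m i => if i ∈ J then 1 else (m + 1 : ℝ)) (fun m i => by split_ifs <;> positivity)
  set X := ∑ i ∈ J, u i with hX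
  set B := ∑ i ∈ Jᶜ, u i with hB
  have hX0 : 0 ≤ X := Finset.sum_nonneg fun i _ => s.nonneg _ (hu.mem i)
  have hhx : ∀ᶠ m in hyperfilter ℕ, h m x = ∑ i ∈ J, γ m i • u i := by
    filter_upwards [hγ] with m hm
    rw [hx, map_sum]
    exact Finset.sum_congr rfl fun i hi => by simpa [hi] using hm i
  have hhb : ∀ᶠ m in hyperfilter ℕ, h m ((m + 1 : ℝ) • b) = ∑ i ∈ Jᶜ, γ m i • u i := by
    filter_upwards [hγ] with m hm
    rw [hb, Finset.smul_sum, map_sum]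
    exact Finset.sum_congr rfl fun i hi => by simpa [Finset.mem_compl.1 hi] using hm i
  have hlim : ∀ K : Finset (Fin n), Tendsto (fun m => ∑ i ∈ K, γ m i • u i) (hyperfilter ℕ)
      (𝓝 (∑ i ∈ K, u i)) := fun K => by
    simpa using tendsto_finsetSum K fun i _ => (hγ1 i).smul_const (u i)
  have hlx : Tendsto (fun m => h m x) (hyperfilter ℕ) (𝓝 X) :=
    (hlim J).congr' (hhx.mono fun m hm => hm.symm)
  have hlb : Tendsto (fun m : ℕ => h m ((m + 1 : ℝ) • b)) (hyperfilter ℕ) (𝓝 B) :=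
    (hlim Jᶜ).congr' (hhb.mono fun m hm => hm.symm)
  have hw1 : ∀ m, h m w ≤ M • h m x := fun m => by
    rw [← map_smul]
    exact (s.map_le _ (hh m) _ _).2 hwJ
  obtain ⟨W, hW⟩ := exists_tendsto_of_le (hlx.const_smul M)
    (Eventually.of_forall fun m => (map_nonneg (hh m)).2 hw) (Eventually.of_forall hw1)
  have hWX : W ≤ M • X := le_of_tendsto_of_tendsto hW (hlx.const_smul M) (Eventually.of_forall hw1)
  have hW0 : 0 ≤ W := ge_of_tendsto hW (Eventually.of_forall fun m => (map_nonneg (hh m)).2 hw)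
  -- Since L ≥ 1, the inequality x + b ≤ L (w + b) persists when b is replaced by θ b with θ ≥ 1.
  -- Take θ = τ (m + 1), which is at least 1 for large m.
  have hτ : ∀ τ : ℝ, 0 < τ → X + τ • B ≤ L • (W + τ • B) := by
    intro τ hτ
    refine le_of_tendsto_of_tendsto (hlx.add (hlb.const_smul τ))
      ((hW.add (hlb.const_smul τ)).const_smul L) ?_
    obtain ⟨N, hN⟩ := exists_nat_gt τ⁻¹
    filter_upwards [Nat.hyperfilter_le_atTop (eventually_ge_atTop N)] with m hm
    have hm1 : 1 ≤ τ * (m + 1) := by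
      have : τ⁻¹ ≤ m + 1 := hN.le.trans (by have : (N : ℝ) ≤ m := by exact_mod_cast hm
                                            linarith)
      calc (1 : ℝ) = τ * τ⁻¹ := (mul_inv_cancel₀ hτ.ne').symm
        _ ≤ _ := by gcongr
    simp only [← map_smul, ← map_add]
    rw [s.map_le _ (hh m), smul_smul]
    set θ := τ * (m + 1)
    calc x + θ • b = (x + b) + (θ - 1) • b := by module
      _ ≤ L • (w + b) + L • ((θ - 1) • b) := by
        refine add_le_add hxL ?_
        rw [smul_smul]
        refine smul_le_smul_coeff hb0 ?_
        nlinarith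
      _ = _ := by module
  have hXW : X ≤ L • W := by
    have h1 : Tendsto (fun τ : ℝ => X + τ • B) (𝓝[>] 0) (𝓝 X) := by
      have : Continuous fun τ : ℝ => X + τ • B := by fun_prop
      simpa using (this.tendsto 0).mono_left nhdsWithin_le_nhds
    have h2 : Tendsto (fun τ : ℝ => L • (W + τ • B)) (𝓝[>] 0) (𝓝 (L • W)) := by
      have : Continuous fun τ : ℝ => L • (W + τ • B) := by fun_prop
      simpa using (this.tendsto 0).mono_left nhdsWithin_le_nhds
    exact le_of_tendsto_of_tendsto h1 h2 (by filter_upwards [self_mem_nhdsWithin] with τ h using hτ τ h)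
  -- Norm convergence of the translates of w to W becomes order convergence relative to X. The
  -- inequality X ≤ L W is thus already visible, with 2 L in place of L, at a finite stage m, and
  -- can be pulled back.
  obtain ⟨C, hC, hCX⟩ := exists_le_norm_smul hX0
  have h2X : ∀ᶠ m in hyperfilter ℕ, h m x ≤ (2 : ℝ) • X := by
    have : ∀ᶠ m in hyperfilter ℕ, ∀ i, γ m i < 2 := by
      rw [eventually_all]
      exact fun i => (hγ1 i).eventually (gt_mem_nhds (by norm_num))
    filter_upwards [hhx, this] with m h1 h2
    rw [h1, hX, Finset.smul_sum]
    exact Finset.sum_le_sum fun i _ => smul_le_smul_coeff (s.nonneg _ (hu.mem i)) (h2 i).le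
  have hnorm : ∀ᶠ m in hyperfilter ℕ, C * ‖W - h m w‖ < (2 * L)⁻¹ := by
    have : Tendsto (fun m => C * ‖W - h m w‖) (hyperfilter ℕ) (𝓝 (C * ‖W - W‖)) :=
      (hW.const_sub W).norm.const_mul C
    refine this.eventually (gt_mem_nhds ?_)
    simp only [sub_self, norm_zero, mul_zero]
    positivity
  obtain ⟨m, h2, h3⟩ := (h2X.and hnorm).exists
  have h4 : W - h m w ≤ (2 * L)⁻¹ • X := by
    refine (hCX _ ⟨2 * M, ?_, ?_⟩).trans (smul_le_smul_coeff hX0 h3.le)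
    · calc W - h m w ≤ W := sub_le_self _ ((map_nonneg (hh m)).2 hw)
        _ ≤ M • X := hWX
        _ ≤ _ := smul_le_smul_coeff hX0 (by linarith)
    · calc -(W - h m w) ≤ h m w := by rw [neg_sub]; exact sub_le_self _ hW0
        _ ≤ M • h m x := hw1 m
        _ ≤ M • (2 : ℝ) • X := smul_le_smul_vec hM.le h2
        _ = _ := by rw [smul_smul, mul_comm]
  have h5 : X ≤ (2 * L) • h m w := by
    have h6 := smul_le_smul_vec (by positivity : 0 ≤ 2 * L) h4
    rw [smul_smul, mul_inv_cancel₀ (by positivity), one_smul, smul_sub, sub_le_iff_le_add] at h6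
    have h7 : X + X ≤ X + (2 * L) • h m w := by
      calc X + X = (2 : ℝ) • X := (two_smul ℝ X).symm
        _ ≤ (2 : ℝ) • L • W := smul_le_smul_vec (by norm_num) hXW
        _ = (2 * L) • W := by rw [smul_smul]
        _ ≤ _ := h6
    exact le_of_add_le_add_left h7
  refine ⟨2 * (2 * L), by positivity, (s.map_le _ (hh m) _ _).1 ?_⟩
  rw [map_smul, mul_smul]
  exact h2.trans (smul_le_smul_vec (by norm_num) h5)

lemma sum_update {ι : Type*} [Fintype ι] [DecidableEq ι] (v : ι → V) (i : ι) (y : V) :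
    ∑ j, Function.update v i y j = y + (∑ j, v j - v i) := by
  rw [Finset.sum_update_of_mem (Finset.mem_univ i), ← Finset.erase_eq,
    Finset.sum_erase_eq_sub (Finset.mem_univ i)]

lemma le_sum_sub (hv : IsProperSimplex s.P v) {i j : Fin n} (hij : i ≠ j) : v i ≤ ∑ k, v k - v j := by
  rw [← Finset.sum_erase_eq_sub (Finset.mem_univ j)]
  exact Finset.single_le_sum (f := v) (fun k _ => s.nonneg _ (hv.mem k)) (by simp [hij])

/-- The closed face of a vertex of a coarsely maximal simplex contains no point of `P` outside of the
open face. -/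
lemma exists_comparable_of_le_vertex (hn : 3 ≤ n) (hv : IsProperSimplex s.P v)
    (hQ : hull v ∈ s.maximal) (i₀ : Fin n) {w : V} (hw : w ∈ s.P) {M : ℝ} (hM : 0 < M)
    (hwM : w ≤ M • v i₀) : ∃ q ∈ hull v, Comparable w q := by
  by_contra! hcon
  have hw0 : 0 ≤ w := s.nonneg w hw
  have hvi : ∀ i, 0 ≤ v i := fun i => s.nonneg _ (hv.mem i)
  have hcomp : ∑ j, v j - v i₀ = ∑ i ∈ {i₀}ᶜ, v i := by
    rw [sub_eq_iff_eq_add, add_comm, ← Finset.sum_add_sum_compl {i₀} v, Finset.sum_singleton]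
  -- Otherwise w would be comparable to the vertex v i₀ itself by `exists_sum_le_smul`.
  have hwb : w + (∑ j, v j - v i₀) ∉ posInterior V := by
    intro h
    rw [hcomp] at h
    obtain ⟨M', hM', h'⟩ := exists_sum_le_smul hv hQ.1 {i₀} hw0 hM (by simpa using hwM) h
    rw [Finset.sum_singleton] at h'
    exact hcon _ (mem_hull_self v i₀) (Comparable.of_le_le hw0 (hvi i₀) hwM h')
  have hwne : w ≠ 0 := fun h => hcon 0 (zero_mem_hull v) (by rw [h]; exact ⟨1, one_pos, by simp⟩)
  set ε : ℕ → ℝ := fun m => 1 / (m + 1) with hε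
  have hε0 : ∀ m, 0 < ε m := fun m => by positivity
  have hε1 : ∀ m, ε m ≤ 1 := fun m => by
    rw [hε]
    exact (div_le_one (by positivity)).2 (by linarith [(Nat.cast_nonneg m : (0 : ℝ) ≤ m)])
  -- Points of the open face of v i₀ converging to w. Replacing v i₀ by y m keeps the simplex
  -- properly embedded.
  set y : ℕ → V := fun m => w + ε m • v i₀ with hy
  have hyP : ∀ m, y m ∈ s.P := fun m =>
    s.add_mem _ hw _ (s.smul_mem _ (hε0 m).le _ (hv.mem i₀))
  have hyv : ∀ m, y m ≤ (M + 1) • v i₀ := fun m => by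
    rw [add_smul]
    exact add_le_add hwM (smul_le_smul_coeff (hvi i₀) (hε1 m))
  have hfac : ∀ i, i ≠ i₀ → ∀ a : V, a ≤ (M + 1) • v i₀ → a + (∑ j, v j - v i) ∉ posInterior V := by
    intro i hi a ha h
    refine hv.facet i (mem_posInterior_of_le_smul (M := M + 1 + 1) (by linarith) h ?_)
    rw [add_smul (M + 1) 1, one_smul]
    refine add_le_add (ha.trans (smul_le_smul_vec (by linarith) (le_sum_sub hv hi.symm))) le_rfl
  have hS : ∀ m, IsProperSimplex s.P (Function.update v i₀ (y m)) := by
    refine fun m => ⟨fun i => ?_, ?_, fun i => ?_⟩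
    · by_cases h : i = i₀
      · subst h; simpa using hyP m
      · simpa [h] using hv.mem i
    · rw [sum_update]
      refine mem_posInterior_of_le_smul (M := (ε m)⁻¹) (by have := hε0 m; positivity) hv.sum_mem ?_
      have h1 : v i₀ ≤ (ε m)⁻¹ • y m := by
        rw [hy, smul_add, smul_smul, inv_mul_cancel₀ (hε0 m).ne', one_smul]
        exact le_add_of_nonneg_left (smul_nonneg (inv_nonneg.2 (hε0 m).le) hw0)
      have h2 : 0 ≤ ∑ j, v j - v i₀ := by
        rw [hcomp]; exact Finset.sum_nonneg fun i _ => hvi i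
      calc ∑ j, v j = v i₀ + (1 : ℝ) • (∑ j, v j - v i₀) := by rw [one_smul]; abel
        _ ≤ (ε m)⁻¹ • y m + (ε m)⁻¹ • (∑ j, v j - v i₀) :=
          add_le_add h1 (smul_le_smul_coeff h2 ((one_le_inv₀ (hε0 m)).2 (hε1 m)))
        _ = _ := (smul_add _ _ _).symm
    · rw [sum_update]
      by_cases h : i = i₀
      · subst h
        simpa using hv.facet i
      · intro h'
        rw [Function.update_of_ne h] at h'
        refine hfac i h (y m - v i₀) ?_ (by convert h' using 1; abel)
        exact (sub_le_self _ (hvi i₀)).trans (hyv m)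
  obtain ⟨D, hD, hnear⟩ := s.exists_near (ι := Fin n)
  have hex := fun m => hnear (Function.update v i₀ (y m)) (by simpa using hn) (hS m)
  choose Q' hQ' hQ'n using hex
  have hyS : ∀ m, y m ∈ hull (Function.update v i₀ (y m)) := fun m => by
    simpa using mem_hull_self (Function.update v i₀ (y m)) i₀
  have hvS : ∀ m i, i ≠ i₀ → v i ∈ hull (Function.update v i₀ (y m)) := fun m i hi => by
    simpa [hi] using mem_hull_self (Function.update v i₀ (y m)) i
  -- The constant for the vertex i₀ blows up like 1 / ε m, but coarse containment only asks for some
  -- constant for each m.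
  have hle : ∀ m, CoarselyLE (hull v) (Q' m) := fun m => by
    refine s.coarselyLE_of_near (hQ' m) fun i => ?_
    by_cases h : i = i₀
    · subst h
      refine Near.of_comparable (s.smul_mem_of_mem (hQ' m)) (hQ'n m _ (hyS m)) hD ?_
      refine Comparable.of_le_le (a := (ε m)⁻¹) (hvi i) (s.nonneg _ (hyP m)) ?_ (hyv m)
      rw [hy, smul_add, smul_smul, inv_mul_cancel₀ (hε0 m).ne', one_smul]
      exact le_add_of_nonneg_left (smul_nonneg (inv_nonneg.2 (hε0 m).le) hw0)
    · exact ⟨D, hD, hQ'n m _ (hvS m i h)⟩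
  have hge : ∀ m, CoarselyLE (Q' m) (hull v) := fun m => hQ.2 _ (hQ' m) (hle m)
  -- The base points are balanced so that, after translation, w and all ε m • v i converge
  -- separately. In the limit w becomes a vertex of its own beside the image of v i₀.
  set p : ℕ → V := fun m => w + ε m • ∑ j, v j with hp
  have hpS : ∀ m, p m ∈ hull (Function.update v i₀ (y m)) := fun m => by
    have h1 : p m = y m + ε m • ∑ i ∈ {i₀}ᶜ, v i := by
      rw [← hcomp, hp, hy]
      simp only
      module
    rw [h1]
    refine hull_add _ _ (hyS m) _ (hull_smul _ _ (hε0 m).le _ ?_)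
    exact Finset.sum_induction _ (· ∈ hull (Function.update v i₀ (y m)))
      (fun a b ha hb => hull_add _ a ha b hb) (zero_mem_hull _) fun i hi => hvS m i (by simpa using hi)
  have hpP : ∀ m, p m ∈ s.P := fun m => s.hull_subset (hS m) (hpS m)
  have hpi : ∀ m, p m ∈ posInterior V := fun m =>
    posInterior_mono (smul_mem_posInterior (hε0 m) hv.sum_mem) (le_add_of_nonneg_left hw0)
  obtain ⟨Z, hZ, hZi, hcoc⟩ := s.cocompact
  have hex := fun m => hcoc (p m) (hpP m) (hpi m)
  choose h hh hhZ using hex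
  obtain ⟨T, ⟨hT, -⟩, hTeq⟩ := exists_eventually_eq_of_finite (U := hyperfilter ℕ)
    (s.finite_near hZ hZi hD) (f := fun m => h m '' Q' m) (Eventually.of_forall fun m =>
      ⟨s.image_mem _ (hh m) _ (hQ' m), _, hhZ m, near_image (hh m) (hQ'n m _ (hpS m))⟩)
  have hTcl := s.isClosed_of_mem hT
  have hT0 := s.nonneg_of_mem hT
  obtain ⟨z, hzZ, hz⟩ := exists_tendsto_of_mem_compact (U := hyperfilter ℕ) hZ
    (Eventually.of_forall hhZ)
  have hεv : ∀ m i, 0 ≤ ε m • v i := fun m i => smul_nonneg (hε0 m).le (hvi i)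
  obtain ⟨W, hW⟩ := exists_tendsto_of_le (x := fun m => h m w) hz
    (Eventually.of_forall fun m => (map_nonneg (hh m)).2 hw0)
    (Eventually.of_forall fun m => (s.map_le _ (hh m) _ _).2 (le_add_of_nonneg_right
      (smul_nonneg (hε0 m).le (Finset.sum_nonneg fun i _ => hvi i))))
  have hE : ∀ i, ∃ e, Tendsto (fun m => h m (ε m • v i)) (hyperfilter ℕ) (𝓝 e) := fun i =>
    exists_tendsto_of_le hz (Eventually.of_forall fun m => (map_nonneg (hh m)).2 (hεv m i))
    (Eventually.of_forall fun m => (s.map_le _ (hh m) _ _).2 (by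
      simp only [hp, Finset.smul_sum]
      exact (Finset.single_le_sum (f := fun i => ε m • v i) (fun j _ => hεv m j)
        (Finset.mem_univ i)).trans (le_add_of_nonneg_left hw0)))
  choose E hE using hE
  have hsumE : Tendsto (fun m => h m (ε m • ∑ j, v j)) (hyperfilter ℕ) (𝓝 (∑ i, E i)) := by
    refine (tendsto_finsetSum Finset.univ fun i _ => hE i).congr fun m => ?_
    rw [← map_sum, Finset.smul_sum]
  have hzW : z = W + ∑ i, E i := tendsto_nhds_unique hz ((hW.add hsumE).congr fun m => by
    rw [← map_add])
  have hWP : W ∈ s.P := s.isClosed.mem_of_tendsto hW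
    (Eventually.of_forall fun m => (s.map_mem _ (hh m) _).2 hw)
  have hEP : ∀ i, E i ∈ s.P := fun i => s.isClosed.mem_of_tendsto (hE i)
    (Eventually.of_forall fun m => (s.map_mem _ (hh m) _).2 (s.smul_mem _ (hε0 m).le _ (hv.mem i)))
  have hzi : z ∈ posInterior V := hZi hzZ
  -- If this facet were interior, then w ≤ N ε m Σ v j for ultrafilter-many m. Since ε m → 0, this
  -- would force w = 0.
  have hfW : ∑ i, E i ∉ posInterior V := by
    intro hi
    obtain ⟨N, hN, hNi⟩ := exists_le_smul_of_mem_posInterior hi z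
    have h1 : ∀ᶠ m in hyperfilter ℕ, w ≤ (N * ε m) • ∑ j, v j := by
      filter_upwards [((hsumE.const_smul N).sub hz).eventually (isOpen_posInterior.mem_nhds hNi)]
        with m hm
      have h2 := sub_nonneg.1 (nonneg_of_mem_posInterior hm)
      rw [← map_smul, s.map_le _ (hh m), smul_smul] at h2
      exact (le_add_of_nonneg_right (smul_nonneg (hε0 m).le
        (Finset.sum_nonneg fun i _ => hvi i))).trans h2
    have h2 : Tendsto (fun m => (N * ε m) • ∑ j, v j) (hyperfilter ℕ) (𝓝 ((N * 0) • ∑ j, v j)) :=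
      ((tendsto_one_div_add_atTop_nhds_zero_nat.mono_left Nat.hyperfilter_le_atTop).const_mul
        N).smul_const _
    have h3 := ge_of_tendsto h2 h1
    rw [mul_zero, zero_smul] at h3
    exact hwne (le_antisymm h3 hw0)
  have hf0 : z - E i₀ ∉ posInterior V := by
    refine notMem_posInterior_of_tendsto (hz.sub (hE i₀)) (Eventually.of_forall fun m => ?_)
    rw [← map_sub, map_mem_posInterior (hh m)]
    refine fun h' => hwb (posInterior_mono h' ?_)
    rw [hp, hcomp]
    simp only
    rw [add_sub_assoc, ← smul_sub, hcomp]
    gcongr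
    exact (smul_le_smul_coeff (Finset.sum_nonneg fun i _ => hvi i) (hε1 m)).trans (one_smul ℝ _).le
  have hfi : ∀ i, i ≠ i₀ → z - E i ∉ posInterior V := by
    intro i hi
    refine notMem_posInterior_of_tendsto (hz.sub (hE i)) (Eventually.of_forall fun m => ?_)
    rw [← map_sub, map_mem_posInterior (hh m)]
    refine fun h' => hfac i hi w (hwM.trans (smul_le_smul_coeff (hvi i₀) (by linarith)))
      (posInterior_mono h' ?_)
    rw [hp]
    simp only
    rw [add_sub_assoc, ← smul_sub]
    gcongr
    refine (smul_le_smul_coeff ?_ (hε1 m)).trans (one_smul ℝ _).le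
    exact (hvi i₀).trans (le_sum_sub hv hi.symm)
  -- The limit simplex with n + 1 vertices: W together with all E i.
  let Tinf : Option (Fin n) → V := fun o => o.elim W E
  have hTinf : IsProperSimplex s.P Tinf := by
    refine ⟨fun o => ?_, ?_, fun o => ?_⟩
    · cases o with
      | none => exact hWP
      | some i => exact hEP i
    · rw [Fintype.sum_option]
      exact hzW ▸ hzi
    · rw [Fintype.sum_option]
      change W + ∑ i, E i - _ ∉ _
      cases o with
      | none => simpa [Tinf] using hfW
      | some i =>
        rw [← hzW]
        by_cases hi : i = i₀
        · exact hi ▸ hf0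
        · exact hfi i hi
  -- The limit of the modified simplices, with n vertices. It merges W and E i₀ into the limit of
  -- the translates of y m, and it lies in the cone of `Tinf`.
  set Sinf : Fin n → V := Function.update E i₀ (W + E i₀) with hSinf
  have hsumS : ∑ j, Sinf j = z := by
    rw [hSinf, sum_update, hzW]
    abel
  have hSinfP : IsProperSimplex s.P Sinf := by
    refine ⟨fun i => ?_, ?_, fun i => ?_⟩
    · by_cases h : i = i₀
      · subst h; simpa [hSinf] using s.add_mem _ hWP _ (hEP i)
      · simpa [hSinf, h] using hEP i
    · rwa [hsumS]
    · rw [hsumS]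
      by_cases h : i = i₀
      · subst h
        refine fun h' => hfW (posInterior_mono h' ?_)
        rw [hSinf, Function.update_self, hzW, add_sub_add_left_eq_sub]
        exact sub_le_self _ (s.nonneg _ (hEP i))
      · rw [hSinf, Function.update_of_ne h]
        exact hfi i h
  have hnT : ∀ {a : ℕ → V} {e : V}, Tendsto (fun m => h m (a m)) (hyperfilter ℕ) (𝓝 e) →
      (∀ m, a m ∈ hull (Function.update v i₀ (y m))) → Near D T e := fun hlim ha =>
    near_of_tendsto hTcl hT0 hlim (hTeq.mono fun m hm => hm ▸ near_image (hh m) (hQ'n m _ (ha m)))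
  have hST : CoarselyLE (hull Sinf) T := by
    refine s.coarselyLE_of_near hT fun i => ⟨D, hD, ?_⟩
    by_cases hi : i = i₀
    · subst hi
      rw [hSinf, Function.update_self]
      exact hnT (a := y) ((hW.add (hE i)).congr fun m => by rw [← map_add]) hyS
    · rw [hSinf, Function.update_of_ne hi]
      exact hnT (hE i) fun m => hull_smul _ _ (hε0 m).le _ (hvS m i hi)
  obtain ⟨m, hm⟩ := hTeq.exists
  have hmT : CoarselyLE (h m '' hull v) T := hm ▸ coarselyLE_image (hh m) (hle m)
  have hTm : CoarselyLE T (h m '' hull v) := hm ▸ coarselyLE_image (hh m) (hge m)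
  have hmP := map_isProperSimplex (hh m) hv
  have hmax := s.image_mem_maximal (hh m) hQ
  rw [image_hull] at hmT hTm hmax
  obtain ⟨k, -, τ, hτ, rfl⟩ := s.simplicial T hT
  have hcard : ∀ {κ κ' : Type} [Fintype κ] [Fintype κ'] {a : κ → V} {b : κ' → V},
      IsProperSimplex s.P a → IsProperSimplex s.P b → CoarselyLE (hull a) (hull b) →
      Fintype.card κ ≤ Fintype.card κ' := fun ha hb ⟨D, hD, h⟩ =>
    ha.card_le s.nonneg hb hD fun i => h _ (mem_hull_self _ i)
  -- T is coarsely equivalent to a translate of the maximal simplex, so it has n vertices as well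
  -- and the containment of `Sinf` in it reverses.
  have hTS := hSinfP.coarselyLE_of_card_eq s.nonneg hτ hST
    (le_antisymm (hcard hτ hmP hTm) (hcard hmP hτ hmT))
  obtain ⟨D', hD', hnear'⟩ := s.exists_near (ι := Option (Fin n))
  obtain ⟨R, hR, hRn⟩ := hnear' Tinf (by simp; omega) hTinf
  have hTR : CoarselyLE (hull Tinf) R := ⟨D', hD', hRn⟩
  have hsub : hull Sinf ⊆ hull Tinf := by
    refine hull_subset_of_cone (zero_mem_hull _) (hull_add _) (hull_smul _) fun i => ?_
    by_cases hi : i = i₀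
    · subst hi
      rw [hSinf, Function.update_self]
      exact hull_add _ _ (mem_hull_self Tinf none) _ (mem_hull_self Tinf (some i))
    · rw [hSinf, Function.update_of_ne hi]
      exact mem_hull_self Tinf (some i)
  have hSR : CoarselyLE (hull Sinf) R := ⟨D', hD', fun x hx => hRn x (hsub hx)⟩
  -- The translate lies coarsely in T, `Sinf`, `Tinf` and R in turn. By maximality R lies coarsely
  -- in the translate. Then n + 1 vertices fit into n, which is absurd.
  have hRm := hmax.2 R hR ((hmT.trans hTS).trans hSR)
  have := hcard hTinf hmP (hTR.trans hRm)
  simp at this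

end

end ConeSystem

end OrderedCone

/-! ### Joins, Gallai's theorem and points in closed faces -/

namespace OrderedCone

open Filter

namespace ConeSystem

variable {V : Type*} [NormedAddCommGroup V] [NormedSpace ℝ V] [FiniteDimensional ℝ V]
  [PartialOrder V] [IsOrderedAddMonoid V] [IsOrderedModule ℝ V] [OrderClosedTopology V]
  [NormalOrder V]

lemma isCompact_Icc_order (a b : V) : IsCompact (Set.Icc a b) := by
  have : ProperSpace V := FiniteDimensional.proper ℝ V
  obtain ⟨c, hc, hn⟩ := NormalOrder.exists_bound (V := V)
  refine Metric.isCompact_of_isClosed_isBounded isClosed_Icc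
    (isBounded_iff_forall_norm_le.2 ⟨c * ‖b - a‖ + ‖a‖, fun x hx => ?_⟩)
  have := hn (x - a) (b - a) (sub_nonneg.2 hx.1) (sub_le_sub_right hx.2 a)
  calc ‖x‖ = ‖(x - a) + a‖ := by rw [sub_add_cancel]
    _ ≤ _ := (norm_add_le _ _).trans (by gcongr)

variable {s : ConeSystem V} {n : ℕ} {v : Fin n → V}

/-- The join of two points `e`, `a` of a closed face with the opposite face of a simplex is a properly
embedded simplex if the segment from `e` to `a` crosses the open face. -/
lemma isProperSimplex_join (hv : IsProperSimplex s.P v) (hQ : hull v ∈ s.𝒞) {J : Finset (Fin n)}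
    {e a : V} (he : e ∈ s.P) (ha : a ∈ s.P) {M L : ℝ} (hM : 0 < M) (hL : 0 < L)
    (heM : e ≤ M • ∑ i ∈ J, v i) (hnot : ¬ ∃ M' : ℝ, 0 < M' ∧ ∑ i ∈ J, v i ≤ M' • e)
    (haJ : a ≤ ∑ i ∈ J, v i) {i₁ : Fin n} (hi₁ : i₁ ∈ J) (hai : a ≤ ∑ i ∈ J.erase i₁, v i)
    (hea : ∑ i ∈ J, v i ≤ L • (e + a)) :
    IsProperSimplex s.P fun o : Option (Option {i // i ∈ Jᶜ}) =>
      o.elim e fun o' => o'.elim a fun j => v j := by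
  classical
  set x := ∑ i ∈ J, v i with hx
  set b := ∑ i ∈ Jᶜ, v i with hb
  have hv0 : ∀ i, 0 ≤ v i := fun i => s.nonneg _ (hv.mem i)
  have hx0 : 0 ≤ x := Finset.sum_nonneg fun i _ => hv0 i
  have hb0 : 0 ≤ b := Finset.sum_nonneg fun i _ => hv0 i
  have hxb : ∑ i, v i = x + b := (Finset.sum_add_sum_compl J v).symm
  have he0 := s.nonneg e he
  have ha0 := s.nonneg a ha
  have hsum : ∑ o : Option (Option {i // i ∈ Jᶜ}), (o.elim e fun o' => o'.elim a fun j => v j)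
      = e + (a + b) := by
    rw [Fintype.sum_option, Fintype.sum_option]
    simp only [Option.elim]
    rw [hb, Finset.sum_coe_sort Jᶜ v]
  refine ⟨fun o => ?_, ?_, fun o => ?_⟩
  · rcases o with _ | _ | j
    exacts [he, ha, hv.mem _]
  · rw [hsum]
    refine mem_posInterior_of_le_smul (M := L + 1) (by linarith) hv.sum_mem ?_
    rw [hxb]
    calc x + b ≤ L • (e + a) + (1 : ℝ) • b := add_le_add hea (by rw [one_smul])
      _ ≤ (L + 1) • (e + a) + (L + 1) • b := add_le_add
        (smul_le_smul_coeff (add_nonneg he0 ha0) (by linarith))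
        (smul_le_smul_coeff hb0 (by linarith))
      _ = _ := by module
  · rw [hsum]
    -- The three kinds of facets. Without e, the rest lies below the facet opposite to v i₁. Without
    -- a, an interior sum would put e in the open face by `exists_sum_le_smul`. Without v j, the
    -- rest is dominated by the facet of the original simplex opposite to v j.
    rcases o with _ | _ | j
    · simp only [Option.elim]
      rw [add_sub_cancel_left]
      refine fun h => hv.facet i₁ (posInterior_mono h ?_)
      rw [hxb, add_sub_right_comm, ← Finset.sum_erase_eq_sub hi₁]
      exact add_le_add hai le_rfl
    · simp only [Option.elim]
      rw [add_sub_assoc, add_sub_cancel_left]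
      exact fun h => hnot (exists_sum_le_smul hv hQ J he0 hM heM h)
    · simp only [Option.elim]
      refine fun h => hv.facet j.1 (mem_posInterior_of_le_smul (M := M + 1 + 1) (by linarith) h ?_)
      have h1 : 0 ≤ b - v j.1 := by
        rw [hb, ← Finset.sum_erase_eq_sub j.2]
        exact Finset.sum_nonneg fun i _ => hv0 i
      calc e + (a + b) - v j.1 = e + a + (b - v j.1) := by abel
        _ ≤ M • x + (1 : ℝ) • x + (1 : ℝ) • (b - v j.1) :=
          add_le_add (add_le_add heM (by rwa [one_smul])) (by rw [one_smul])
        _ ≤ M • x + (1 : ℝ) • x + (M + 1 + 1) • (b - v j.1) + x :=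
          (add_le_add le_rfl (smul_le_smul_coeff h1 (by linarith))).trans
            (le_add_of_nonneg_right hx0)
        _ = _ := by rw [hxb]; module

/-- By pigeonhole and Gallai's theorem, one member of the family is near `e`, the opposite face, and
the vertices of arbitrarily large balls of a facet of a face. -/
lemma exists_near_homothetic (hv : IsProperSimplex s.P v) (hQ : hull v ∈ s.𝒞)
    {J : Finset (Fin n)} (hJ : J ≠ Finset.univ) {e : V} (he : e ∈ s.P) {M L : ℝ} (hM : 0 < M)
    (hL : 0 < L) (heM : e ≤ M • ∑ i ∈ J, v i)
    (hnot : ¬ ∃ M' : ℝ, 0 < M' ∧ ∑ i ∈ J, v i ≤ M' • e) {i₁ j₁ : Fin n} (hi₁ : i₁ ∈ J)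
    (hj₁ : j₁ ∈ J.erase i₁) (hej : ∑ i ∈ J, v i ≤ L • (e + v j₁)) :
    ∃ D : ℝ, 0 < D ∧ ∃ F : Set (Set V), F.Finite ∧ F ⊆ s.𝒞 ∧ ∀ R : ℕ, ∃ Q ∈ F, ∃ (c : Fin n → ℝ) (θ : ℝ),
      (∀ i, 0 < c i) ∧ 0 < θ ∧ θ ≤ 1 / (R + 1) ∧ Near D Q e ∧ (∀ i ∉ J, Near D Q (v i)) ∧
      ∀ i ∈ J.erase i₁, Near D Q (c i • v i + θ • ∑ j ∈ (J.erase i₁).erase i, c j • v j) := by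
  classical
  have hv0 : ∀ i, 0 ≤ v i := fun i => s.nonneg _ (hv.mem i)
  set x := ∑ i ∈ J, v i with hx
  set b := ∑ i ∈ Jᶜ, v i with hb
  have hx0 : 0 ≤ x := Finset.sum_nonneg fun i _ => hv0 i
  have hb0 : 0 ≤ b := Finset.sum_nonneg fun i _ => hv0 i
  have hxb : ∑ i, v i = x + b := (Finset.sum_add_sum_compl J v).symm
  have he0 := s.nonneg e he
  set J' := J.erase i₁ with hJ'
  -- Logarithmic coordinates on the open facet: lattice points ν give powers of 1/2, normalized by
  -- weight 1 at j₁, so homotheties of ν act on exponents.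
  let τ : (Fin n → ℕ) → Fin n → ℝ := fun ν j => if j = j₁ then 1 else (1 / 2) ^ ν j
  have hτ0 : ∀ ν j, 0 < τ ν j := fun ν j => by simp only [τ]; split_ifs <;> positivity
  have hτ1 : ∀ ν j, τ ν j ≤ 1 := fun ν j => by
    simp only [τ]
    split_ifs
    · exact le_rfl
    · exact pow_le_one₀ (by norm_num) (by norm_num)
  let a : (Fin n → ℕ) → V := fun ν => ∑ j ∈ J', τ ν j • v j
  have haP : ∀ ν, a ν ∈ s.P := fun ν =>
    s.hull_subset hv (sum_mem_hull v J' _ fun j _ => (hτ0 ν j).le)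
  have haJ' : ∀ ν, a ν ≤ ∑ j ∈ J', v j := fun ν => Finset.sum_le_sum fun j _ =>
    (smul_le_smul_coeff (hv0 j) (hτ1 ν j)).trans (one_smul ℝ _).le
  have hJ'x : ∑ j ∈ J', v j ≤ x :=
    Finset.sum_le_sum_of_subset_of_nonneg (Finset.erase_subset _ _) fun i _ _ => hv0 i
  have haj : ∀ ν, v j₁ ≤ a ν := fun ν => by
    have := Finset.single_le_sum (f := fun j => τ ν j • v j)
      (fun j _ => smul_nonneg (hτ0 ν j).le (hv0 j)) hj₁
    exact (le_of_eq (by simp [τ])).trans this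
  obtain ⟨D, hD, hnear⟩ := s.exists_near (ι := Option (Option {i // i ∈ Jᶜ}))
  have hcard : 3 ≤ Fintype.card (Option (Option {i // i ∈ Jᶜ})) := by
    rw [Fintype.card_option, Fintype.card_option, Fintype.card_coe]
    have : 0 < Jᶜ.card := Finset.card_pos.2
      (Finset.nonempty_iff_ne_empty.2 fun h => hJ (Finset.compl_eq_empty_iff _ |>.1 h))
    omega
  have hS := fun ν => isProperSimplex_join hv hQ he (haP ν) hM hL heM hnot ((haJ' ν).trans hJ'x) hi₁
    (haJ' ν) (hej.trans (smul_le_smul_vec hL.le (add_le_add le_rfl (haj ν))))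
  have hex := fun ν => hnear _ hcard (hS ν)
  choose Qc hQc hQn using hex
  -- Every sum e + a ν + b lies in this order interval, which is compact and interior. Only finitely
  -- many members can be near it, which gives finitely many colors.
  have hZi : Set.Icc (e + (v j₁ + b)) (e + (x + b)) ⊆ posInterior V := fun z hz => by
    refine posInterior_mono (mem_posInterior_of_le_smul (M := L + 1) (by linarith) hv.sum_mem ?_) hz.1
    rw [hxb]
    calc x + b ≤ L • (e + v j₁) + (1 : ℝ) • b := add_le_add hej (by rw [one_smul])
      _ ≤ (L + 1) • (e + v j₁) + (L + 1) • b := add_le_add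
        (smul_le_smul_coeff (add_nonneg he0 (hv0 _)) (by linarith))
        (smul_le_smul_coeff hb0 (by linarith))
      _ = _ := by module
  have hfin := s.finite_near (isCompact_Icc_order (e + (v j₁ + b)) (e + (x + b))) hZi hD
  refine ⟨D, hD, _, hfin, fun Q hQ => hQ.1, fun R => ?_⟩
  have hF : ∀ ν, Qc ν ∈ {Q ∈ s.𝒞 | ∃ z ∈ Set.Icc (e + (v j₁ + b)) (e + (x + b)), Near D Q z} := by
    refine fun ν => ⟨hQc ν, e + (a ν + b), ⟨?_, ?_⟩, hQn ν _ ?_⟩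
    · gcongr; exact haj ν
    · gcongr; exact (haJ' ν).trans hJ'x
    · refine hull_add _ _ (mem_hull_self _ none) _ (hull_add _ _ (mem_hull_self _ (some none)) _ ?_)
      rw [hb, ← Finset.sum_coe_sort]
      exact Finset.sum_induction _ (· ∈ hull _) (fun a b ha hb => hull_add _ a ha b hb)
        (zero_mem_hull _) fun j _ => mem_hull_self _ (some (some j))
  have : Finite {Q ∈ s.𝒞 | ∃ z ∈ Set.Icc (e + (v j₁ + b)) (e + (x + b)), Near D Q z} := hfin
  -- The pattern whose homothetic copies are almost the vertices. For i ≠ j₁ the exponent is 0 at i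
  -- and R elsewhere. The exponent at j₁ is invisible, as its weight is fixed at 1, so that vertex
  -- is produced by exponent 2R at all other places.
  let σ : Fin n → Fin n → ℕ := fun i j => if i = j₁ then 2 * R else if j = i then 0 else R
  obtain ⟨α, hα, β, Q, hQβ⟩ := Combinatorics.exists_mono_homothetic_copy
    (Finset.univ.image σ) fun ν => (⟨Qc ν, hF ν⟩ :
      {Q ∈ s.𝒞 | ∃ z ∈ Set.Icc (e + (v j₁ + b)) (e + (x + b)), Near D Q z})
  have hQσ : ∀ i, Qc (α • σ i + β) = Q.1 := fun i =>
    congrArg Subtype.val (hQβ (σ i) (Finset.mem_image_of_mem _ (Finset.mem_univ i)))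
  have hQe : Near D Q.1 e := hQσ j₁ ▸ hQn (α • σ j₁ + β) _ (mem_hull_self _ none)
  have hQa : ∀ i, Near D Q.1 (a (α • σ i + β)) := fun i =>
    hQσ i ▸ hQn (α • σ i + β) _ (mem_hull_self _ (some none))
  have hQv : ∀ i ∉ J, Near D Q.1 (v i) := fun i hi =>
    hQσ j₁ ▸ hQn (α • σ j₁ + β) _ (mem_hull_self _ (some (some (⟨i, Finset.mem_compl.2 hi⟩ :
      {i // i ∈ Jᶜ}))))
  -- With dilation α and translation β, the points with i ≠ j₁ are rescaled by θ = (1/2)^(αR). Then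
  -- all of them have the form c i v i plus θ times the remaining c j v j, with common c.
  refine ⟨Q.1, Q.2, fun j => if j = j₁ then 1 else (1 / 2) ^ (β j + α * R), (1 / 2) ^ (α * R),
    fun j => ?_, by positivity, ?_, hQe, hQv, fun i hi => ?_⟩
  · dsimp only
    split_ifs <;> positivity
  · rw [one_div_pow]
    refine one_div_le_one_div_of_le (by positivity) ?_
    have h1 : R + 1 ≤ 2 ^ (α * R) :=
      (Nat.lt_two_pow_self (n := R)).trans_le (Nat.pow_le_pow_right (by norm_num)
        (Nat.le_mul_of_pos_left R hα))
    exact_mod_cast h1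
  · have hsplit := fun ν => Finset.add_sum_erase J' (fun j => τ ν j • v j) hi
    by_cases hij : i = j₁
    · subst hij
      convert hQa i using 1
      simp only [a]
      rw [← hsplit, Finset.smul_sum]
      congr 1
      · simp [τ]
      · refine Finset.sum_congr rfl fun j hj => ?_
        have hji := Finset.ne_of_mem_erase hj
        simp only [τ, σ, hji, if_false, if_true, Pi.add_apply, Pi.smul_apply, smul_smul, smul_eq_mul]
        rw [← pow_add]
        congr 2
        ring
    · have := (hQa i).smul (s.smul_mem_of_mem Q.2.1) (by positivity : (0 : ℝ) ≤ (1 / 2) ^ (α * R))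
      convert this using 1
      simp only [a]
      rw [← hsplit, smul_add]
      congr 1
      · simp only [τ, σ, hij, if_false, if_true, Pi.add_apply, Pi.smul_apply, smul_smul, smul_eq_mul]
        rw [← pow_add]
        congr 2
        ring
      · congr 1
        refine Finset.sum_congr rfl fun j hj => ?_
        have hji := Finset.ne_of_mem_erase hj
        by_cases hjj : j = j₁
        · simp [τ, hjj]
        · simp only [τ, σ, hji, hij, hjj, if_false, Pi.add_apply, Pi.smul_apply, smul_eq_mul]
          congr 2
          ring

/-- A point `e` of the closed face generated by `J`, but not of the open face, that is joined to a facet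
by a segment crossing the open face, is comparable to a point of the simplex. -/
lemma exists_comparable_of_join (hv : IsProperSimplex s.P v) (hQ : hull v ∈ s.maximal)
    {J : Finset (Fin n)} (hJ : J ≠ Finset.univ) {e : V} (he : e ∈ s.P) {M L : ℝ} (hM : 0 < M)
    (hL : 0 < L) (heM : e ≤ M • ∑ i ∈ J, v i)
    (hnot : ¬ ∃ M' : ℝ, 0 < M' ∧ ∑ i ∈ J, v i ≤ M' • e) {i₁ j₁ : Fin n} (hi₁ : i₁ ∈ J)
    (hj₁ : j₁ ∈ J.erase i₁) (hej : ∑ i ∈ J, v i ≤ L • (e + v j₁)) :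
    ∃ q ∈ hull v, Comparable e q := by
  classical
  have hv0 : ∀ i, 0 ≤ v i := fun i => s.nonneg _ (hv.mem i)
  have he0 := s.nonneg e he
  obtain ⟨D, hD, F, hF, hFs, hex⟩ :=
    exists_near_homothetic hv hQ.1 hJ he hM hL heM hnot hi₁ hj₁ hej
  choose Qs hQs c θ hc hθ hθR hQe hQv hQa using hex
  obtain ⟨Q, hQF, hQeq⟩ := exists_eventually_eq_of_finite (U := hyperfilter ℕ) hF (f := Qs)
    (Eventually.of_forall hQs)
  set J' := J.erase i₁ with hJ'
  -- The weight of v i₁ is chosen so small that δ m v j is at most θ m c m j v j, which vanishes in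
  -- the limit for j in J'. After scaling by δ m, only the i₁-direction of the face survives.
  have hδ : ∀ m, ∃ δ : ℝ, 0 < δ ∧ ∀ j, δ ≤ θ m * c m j := fun m => by
    have : Nonempty (Fin n) := ⟨i₁⟩
    obtain ⟨k, hk⟩ := Finite.exists_min (c m)
    exact ⟨θ m * c m k, mul_pos (hθ m) (hc m k), fun j => mul_le_mul_of_nonneg_left (hk j) (hθ m).le⟩
  choose δ hδ0 hδc using hδ
  obtain ⟨h, u, γ, hh, hu, hQ₁, heq, hγ, hγ1⟩ := s.recurrence hv hQ.1
    (c := fun m i => if i ∈ J' then c m i else if i = i₁ then δ m else 1) (fun m i => by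
      split_ifs
      exacts [hc m i, hδ0 m, one_pos])
  have hu0 : ∀ i, 0 ≤ u i := fun i => s.nonneg _ (hu.mem i)
  have hlim : ∀ i, Tendsto (fun m => h m ((if i ∈ J' then c m i else if i = i₁ then δ m else 1) • v i))
      (hyperfilter ℕ) (𝓝 (u i)) := fun i => by
    have h1 : Tendsto (fun m => γ m i • u i) (hyperfilter ℕ) (𝓝 (u i)) := by
      simpa using (hγ1 i).smul_const (u i)
    exact h1.congr' (hγ.mono fun m hm => (hm i).symm)
  have hlimJ : ∀ i ∈ J', Tendsto (fun m => h m (c m i • v i)) (hyperfilter ℕ) (𝓝 (u i)) :=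
    fun i hi => by simpa [hi] using hlim i
  have hi₁' : i₁ ∉ J' := Finset.notMem_erase _ _
  have hlimi : Tendsto (fun m => h m (δ m • v i₁)) (hyperfilter ℕ) (𝓝 (u i₁)) := by
    simpa [hi₁'] using hlim i₁
  have hlimc : ∀ i ∉ J, Tendsto (fun m => h m (v i)) (hyperfilter ℕ) (𝓝 (u i)) := fun i hi => by
    have h1 : i ∉ J' := fun h => hi (Finset.mem_of_mem_erase h)
    have h2 : i ≠ i₁ := fun h => hi (h ▸ hi₁)
    simpa [h1, h2] using hlim i
  have hθ0 : Tendsto θ (hyperfilter ℕ) (𝓝 0) :=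
    squeeze_zero (fun m => (hθ m).le) hθR
      (tendsto_one_div_add_atTop_nhds_zero_nat.mono_left Nat.hyperfilter_le_atTop)
  have hlimθ : ∀ K ⊆ J', Tendsto (fun m => h m (θ m • ∑ j ∈ K, c m j • v j)) (hyperfilter ℕ)
      (𝓝 0) := fun K hK => by
    have h1 := hθ0.smul (tendsto_finsetSum K fun j hj => hlimJ j (hK hj))
    rw [zero_smul] at h1
    exact h1.congr fun m => by rw [map_smul, map_sum]
  have hlima : ∀ i ∈ J', Tendsto (fun m => h m (c m i • v i + θ m • ∑ j ∈ J'.erase i, c m j • v j))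
      (hyperfilter ℕ) (𝓝 (u i)) := fun i hi => by
    have h1 := (hlimJ i hi).add (hlimθ (J'.erase i) (Finset.erase_subset _ _))
    rw [add_zero] at h1
    exact h1.congr fun m => by rw [map_add]
  have hδx : ∀ m, δ m • ∑ i ∈ J, v i ≤ δ m • v i₁ + θ m • ∑ j ∈ J', c m j • v j := fun m => by
    rw [← Finset.add_sum_erase J v hi₁, smul_add, Finset.smul_sum, Finset.smul_sum]
    refine add_le_add le_rfl (Finset.sum_le_sum fun j _ => ?_)
    rw [smul_smul]
    exact smul_le_smul_coeff (hv0 j) (hδc m j)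
  have hδe : ∀ m, δ m • e ≤ M • (δ m • v i₁ + θ m • ∑ j ∈ J', c m j • v j) := fun m => by
    refine (smul_le_smul_vec (hδ0 m).le heM).trans ?_
    rw [smul_comm]
    exact smul_le_smul_vec hM.le (hδx m)
  have hlimM : Tendsto (fun m => h m (M • (δ m • v i₁ + θ m • ∑ j ∈ J', c m j • v j)))
      (hyperfilter ℕ) (𝓝 (M • u i₁)) := by
    have h1 := (hlimi.add (hlimθ J' le_rfl)).const_smul M
    rw [add_zero] at h1
    exact h1.congr fun m => by rw [← map_add, ← map_smul]
  obtain ⟨E, hE⟩ := exists_tendsto_of_le (x := fun m => h m (δ m • e)) hlimM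
    (Eventually.of_forall fun m => (map_nonneg (hh m)).2 (smul_nonneg (hδ0 m).le he0))
    (Eventually.of_forall fun m => (s.map_le _ (hh m) _ _).2 (hδe m))
  have hE0 : 0 ≤ E := ge_of_tendsto hE
    (Eventually.of_forall fun m => (map_nonneg (hh m)).2 (smul_nonneg (hδ0 m).le he0))
  have hEM : E ≤ M • u i₁ := le_of_tendsto_of_tendsto hE hlimM
    (Eventually.of_forall fun m => (s.map_le _ (hh m) _ _).2 (hδe m))
  -- The part of e along J' disappears, while v i₁ ≤ L (e + v j₁) survives without v j₁. Hence the
  -- limit E of the scaled e takes the role of the missing vertex u i₁.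
  have hLE : u i₁ ≤ L • E := by
    have h1 := (hE.add (hlimθ J' le_rfl)).const_smul L
    rw [add_zero] at h1
    refine le_of_tendsto_of_tendsto hlimi h1 (Eventually.of_forall fun m => ?_)
    simp only [← map_add, ← map_smul]
    rw [s.map_le _ (hh m)]
    have h2 : v i₁ ≤ ∑ i ∈ J, v i := Finset.single_le_sum (f := v) (fun i _ => hv0 i) hi₁
    have h3 : δ m • v j₁ ≤ θ m • ∑ j ∈ J', c m j • v j := by
      refine (smul_le_smul_coeff (hv0 _) (hδc m j₁)).trans ?_
      rw [mul_smul]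
      exact smul_le_smul_vec (hθ m).le (Finset.single_le_sum (f := fun j => c m j • v j)
        (fun j _ => smul_nonneg (hc m j).le (hv0 j)) hj₁)
    calc δ m • v i₁ ≤ δ m • L • (e + v j₁) := smul_le_smul_vec (hδ0 m).le (h2.trans hej)
      _ = L • (δ m • e + δ m • v j₁) := by rw [smul_comm, smul_add]
      _ ≤ _ := smul_le_smul_vec hL.le (add_le_add le_rfl h3)
  set z := ∑ i ∈ J', u i + E + ∑ i ∈ Jᶜ, u i with hz
  have hzi : z ∈ posInterior V := by
    refine mem_posInterior_of_le_smul (M := L + 1) (by linarith) hu.sum_mem ?_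
    rw [← Finset.sum_add_sum_compl J u, ← Finset.add_sum_erase J u hi₁, hz]
    have h1 : ∀ K : Finset (Fin n), ∑ i ∈ K, u i ≤ (L + 1) • ∑ i ∈ K, u i := fun K => by
      refine (one_smul ℝ _).ge.trans (smul_le_smul_coeff (Finset.sum_nonneg fun i _ => hu0 i) ?_)
      linarith
    calc u i₁ + ∑ i ∈ J', u i + ∑ i ∈ Jᶜ, u i
        ≤ (L + 1) • E + (L + 1) • ∑ i ∈ J', u i + (L + 1) • ∑ i ∈ Jᶜ, u i :=
          add_le_add (add_le_add (hLE.trans (smul_le_smul_coeff hE0 (by linarith))) (h1 _)) (h1 _)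
      _ = _ := by module
  obtain ⟨r, hr, hball⟩ := Metric.nhds_basis_closedBall.mem_iff.1 (isOpen_posInterior.mem_nhds hzi)
  have : ProperSpace V := FiniteDimensional.proper ℝ V
  have hQ𝒞 := hFs hQF
  have hQadd : ∀ x ∈ Q, ∀ y ∈ Q, x + y ∈ Q := by
    obtain ⟨k, -, τ, hτ, rfl⟩ := s.simplicial Q hQ𝒞
    exact hull_add τ
  have hQzero : (0 : V) ∈ Q := by
    obtain ⟨k, -, τ, hτ, rfl⟩ := s.simplicial Q hQ𝒞
    exact zero_mem_hull τ
  have hsumnear : ∀ (K : Finset (Fin n)) (f : Fin n → V), (∀ i ∈ K, Near D Q (f i)) →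
      Near D Q (∑ i ∈ K, f i) := fun K f hf =>
    Finset.sum_induction _ (Near D Q) (fun a b ha hb => ha.add hQadd hb)
      ⟨0, hQzero, le_rfl, by simp⟩ hf
  have hlimz : Tendsto (fun m => h m (∑ i ∈ J', (c m i • v i + θ m • ∑ j ∈ J'.erase i, c m j • v j)
      + δ m • e + ∑ i ∈ Jᶜ, v i)) (hyperfilter ℕ) (𝓝 z) := by
    refine (((tendsto_finsetSum J' hlima).add hE).add (tendsto_finsetSum Jᶜ fun i hi =>
      hlimc i (Finset.mem_compl.1 hi))).congr fun m => ?_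
    simp only [map_add, map_sum]
  have hev : ∀ᶠ m in hyperfilter ℕ, h m '' Q ∈ {Q ∈ s.𝒞 | ∃ y ∈ Metric.closedBall z r, Near D Q y} := by
    filter_upwards [hQeq, hlimz.eventually (Metric.closedBall_mem_nhds z hr)] with m h1 h2
    refine ⟨s.image_mem _ (hh m) _ hQ𝒞, _, h2, near_image (hh m) ?_⟩
    refine ((hsumnear _ _ fun i hi => h1 ▸ hQa m i hi).add hQadd ((h1 ▸ hQe m : Near D Q e).smul
      (s.smul_mem_of_mem hQ𝒞) (hδ0 m).le)).add hQadd (hsumnear _ _ fun i hi =>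
        h1 ▸ hQv m i (Finset.mem_compl.1 hi))
  obtain ⟨T, ⟨hT, -⟩, hTeq⟩ := exists_eventually_eq_of_finite
    (s.finite_near (isCompact_closedBall z r) hball hD) hev
  have hTcl := s.isClosed_of_mem hT
  have hT0 := s.nonneg_of_mem hT
  have hnT : ∀ {f : ℕ → V} {y : V}, Tendsto (fun m => h m (f m)) (hyperfilter ℕ) (𝓝 y) →
      (∀ m, Near D (Qs m) (f m)) → Near D T y := fun hlim ha =>
    near_of_tendsto hTcl hT0 hlim (by
      filter_upwards [hQeq, hTeq] with m h1 h2
      exact h2 ▸ near_image (hh m) (h1 ▸ ha m))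
  have hET : Near D T E := hnT hE fun m => (hQe m).smul (s.smul_mem_of_mem (hFs (hQs m))) (hδ0 m).le
  -- All vertices of the limit simplex are near T: those of J' by the Gallai points, u i₁ through E,
  -- and the others directly.
  have huT : CoarselyLE (hull u) T := by
    refine s.coarselyLE_of_near hT fun i => ?_
    by_cases hiJ : i ∈ J'
    · exact ⟨D, hD, hnT (hlima i hiJ) fun m => hQa m i hiJ⟩
    · by_cases hi : i = i₁
      · subst hi
        exact hET.of_comparable (s.smul_mem_of_mem hT) hD
          (Comparable.of_le_le (hu0 _) hE0 hLE hEM)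
      · have hiJ' : i ∉ J := fun h => hiJ (Finset.mem_erase.2 ⟨hi, h⟩)
        exact ⟨D, hD, hnT (hlimc i hiJ') fun m => hQv m i hiJ'⟩
  obtain ⟨m, ⟨h1, h2⟩, h3⟩ := ((heq.and hTeq).and hQeq).exists
  rw [← h1, ← h2] at huT
  -- Pulling back by h m, the maximal simplex lies coarsely in Q. Maximality gives the reverse
  -- containment, and e is near Q.
  obtain ⟨D', hD', hle⟩ := hQ.2 Q hQ𝒞 (coarselyLE_of_image (hh m) huT)
  obtain ⟨q, hq, heq'⟩ := (h3 ▸ hQe m : Near D Q e).comparable (s.nonneg_of_mem hQ𝒞)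
  obtain ⟨q', hq', hqq'⟩ := (hle q hq).comparable (hv.hull_nonneg s.nonneg)
  exact ⟨q', hq', heq'.trans hqq'⟩

/-- A point of `P` in the closed face generated by a boundary point of a coarsely maximal simplex lies
in the open face of a point of the simplex. -/
lemma exists_comparable_of_le (hn : 3 ≤ n) (hv : IsProperSimplex s.P v) (hQ : hull v ∈ s.maximal)
    (J : Finset (Fin n)) (hJ : J ≠ Finset.univ) {w : V} (hw : w ∈ s.P) {M : ℝ} (hM : 0 < M)
    (hwM : w ≤ M • ∑ i ∈ J, v i) : ∃ q ∈ hull v, Comparable w q := by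
  classical
  induction J using Finset.strongInduction generalizing M with
  | H J ih =>
  have hv0 : ∀ i, 0 ≤ v i := fun i => s.nonneg _ (hv.mem i)
  have hw0 := s.nonneg w hw
  by_contra hcon
  have ih' : ∀ K ⊂ J, ∀ M' : ℝ, 0 < M' → ¬ w ≤ M' • ∑ i ∈ K, v i := fun K hK M' hM' h =>
    hcon (ih K hK (fun h' => hJ (Finset.univ_subset_iff.1 (h' ▸ hK.subset))) hM' h)
  have hJ2 : 2 ≤ J.card := by
    by_contra! hlt
    interval_cases hc : J.card
    · rw [Finset.card_eq_zero] at hc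
      subst hc
      have : w = 0 := le_antisymm (by simpa using hwM) hw0
      exact hcon ⟨0, zero_mem_hull v, 1, one_pos, by simp [this]⟩
    · obtain ⟨i₀, rfl⟩ := Finset.card_eq_one.1 hc
      exact hcon (exists_comparable_of_le_vertex hn hv hQ i₀ hw hM (by simpa using hwM))
  set x := ∑ i ∈ J, v i with hx
  have hx0 : 0 ≤ x := Finset.sum_nonneg fun i _ => hv0 i
  have hxh : x ∈ hull v := by simpa using sum_mem_hull v J (fun _ => 1) fun _ _ => zero_le_one
  have hnotw : ¬ ∃ M' : ℝ, 0 < M' ∧ x ≤ M' • w := fun ⟨M', hM', h⟩ =>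
    hcon ⟨x, hxh, Comparable.of_le_le hw0 hx0 hwM h⟩
  -- The sets K of vertices whose addition to w reaches the open face. A smallest one, with one
  -- vertex removed, gives a point e just short of the open face, as required for
  -- `exists_comparable_of_join`.
  let 𝒥 := J.powerset.filter fun K => ∃ L : ℝ, 0 < L ∧ x ≤ L • (w + ∑ i ∈ K, v i)
  obtain ⟨K, hK, hKmin⟩ := Finset.exists_min_image 𝒥 Finset.card ⟨J, by
    simp only [𝒥, Finset.mem_filter, Finset.mem_powerset, subset_refl, true_and]
    exact ⟨1, one_pos, by rw [one_smul]; exact le_add_of_nonneg_left hw0⟩⟩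
  simp only [𝒥, Finset.mem_filter, Finset.mem_powerset] at hK hKmin
  obtain ⟨hKJ, L, hL, hKL⟩ := hK
  obtain ⟨j₁, hj₁⟩ : K.Nonempty := by
    rw [Finset.nonempty_iff_ne_empty]
    rintro rfl
    exact hnotw ⟨L, hL, by simpa using hKL⟩
  set e := w + ∑ i ∈ K.erase j₁, v i with he
  have heP : e ∈ s.P := s.add_mem _ hw _ (s.hull_subset hv
    (by simpa using sum_mem_hull v (K.erase j₁) (fun _ => 1) fun _ _ => zero_le_one))
  have he0 := s.nonneg e heP
  have hwe : w ≤ e := le_add_of_nonneg_right (Finset.sum_nonneg fun i _ => hv0 i)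
  have heM : e ≤ (M + 1) • x := by
    rw [add_smul, one_smul]
    exact add_le_add hwM (Finset.sum_le_sum_of_subset_of_nonneg
      ((Finset.erase_subset _ _).trans hKJ) fun i _ _ => hv0 i)
  have hnote : ¬ ∃ M' : ℝ, 0 < M' ∧ x ≤ M' • e := fun h => by
    have := hKmin (K.erase j₁) ⟨(Finset.erase_subset _ _).trans hKJ, h⟩
    have h2 := Finset.card_erase_lt_of_mem hj₁
    omega
  obtain ⟨i₁, hi₁, hij⟩ : ∃ i ∈ J, i ≠ j₁ := Finset.exists_mem_ne (by omega) j₁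
  obtain ⟨q, ⟨t, ht, rfl⟩, C, hC, hq1, hq2⟩ := exists_comparable_of_join hv hQ hJ heP
    (by linarith : 0 < M + 1) hL heM hnote hi₁ (Finset.mem_erase.2 ⟨hij.symm, hKJ hj₁⟩) (by
      refine hKL.trans (le_of_eq ?_)
      rw [he, add_assoc, Finset.sum_erase_add _ _ hj₁])
  have htJ : ∀ i ∉ J, t i = 0 := fun i hi => by
    refine hv.coeff_eq_zero_of_le s.nonneg ht (C := C * (M + 1)) (by positivity) (hq2.trans ?_) hi
    rw [mul_smul]
    exact smul_le_smul_vec hC.le heM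
  have hqJ : ∑ i, t i • v i = ∑ i ∈ J, t i • v i :=
    (Finset.sum_subset (Finset.subset_univ J) fun i _ hi => by rw [htJ i hi, zero_smul]).symm
  -- If all coefficients on J were positive, e would dominate the sum over J, against minimality. So
  -- e, and with it w ≤ e, lies in the closed face of a proper subset of J, and the induction
  -- hypothesis applies.
  by_cases hall : ∀ i ∈ J, 0 < t i
  · refine hnote ⟨(∑ i ∈ J, (t i)⁻¹ * C) + 1, ?_, ?_⟩
    · exact add_pos_of_nonneg_of_pos (Finset.sum_nonneg fun i hi =>
        mul_nonneg (inv_nonneg.2 (ht i)) hC.le) one_pos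
    · rw [add_smul, Finset.sum_smul, one_smul]
      refine (Finset.sum_le_sum fun i hi => ?_).trans (le_add_of_nonneg_right he0)
      have h1 : t i • v i ≤ C • e := (Finset.single_le_sum (f := fun i => t i • v i)
        (fun j _ => smul_nonneg (ht j) (hv0 j)) (Finset.mem_univ i)).trans hq2
      have h3 := smul_le_smul_vec (inv_nonneg.2 (ht i)) h1
      rwa [smul_smul, inv_mul_cancel₀ (hall i hi).ne', one_smul, smul_smul] at h3
  · push Not at hall
    obtain ⟨i, hi, hti⟩ := hall
    refine ih' (J.erase i) (Finset.erase_ssubset hi) (C * (∑ j, t j + 1)) (by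
      have : 0 ≤ ∑ j, t j := Finset.sum_nonneg fun j _ => ht j
      positivity) ?_
    refine hwe.trans (hq1.trans ?_)
    rw [mul_smul, hqJ, ← Finset.add_sum_erase J _ hi, le_antisymm hti (ht i), zero_smul, zero_add]
    refine smul_le_smul_vec hC.le ?_
    rw [Finset.smul_sum]
    refine Finset.sum_le_sum fun j _ => smul_le_smul_coeff (hv0 j) ?_
    have := Finset.single_le_sum (f := t) (fun j _ => ht j) (Finset.mem_univ j)
    linarith

end ConeSystem

end OrderedCone

/-! ### Uniform constants for the coarsely maximal family -/

namespace OrderedCone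

open Filter

namespace ConeSystem

variable {V : Type*} [NormedAddCommGroup V] [NormedSpace ℝ V] [FiniteDimensional ℝ V]
  [PartialOrder V] [IsOrderedAddMonoid V] [IsOrderedModule ℝ V] [OrderClosedTopology V]
  [NormalOrder V]
variable {s : ConeSystem V} {n : ℕ} {v : Fin n → V}

variable (s) in
/-- The group has finitely many orbits on the family. -/
lemma exists_finite_orbit_representatives : ∃ F : Set (Set V), F.Finite ∧ F ⊆ s.𝒞 ∧
    ∀ Q ∈ s.𝒞, ∃ g ∈ s.𝒢, g '' Q ∈ F := by
  obtain ⟨Z, hZ, hZi, hcoc⟩ := s.cocompact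
  refine ⟨_, s.finite Z hZ hZi, fun Q hQ => hQ.1, fun Q hQ => ?_⟩
  obtain ⟨n, -, v, hv, rfl⟩ := s.simplicial Q hQ
  have h1 : ∑ i, v i ∈ hull v := ⟨fun _ => 1, fun _ => zero_le_one, by simp⟩
  obtain ⟨g, hg, hgZ⟩ := hcoc _ (s.hull_subset hv h1) hv.sum_mem
  exact ⟨g, hg, s.image_mem g hg _ hQ, _, mem_image_of_mem _ h1, hgZ⟩

lemma exists_bound_of_finite {β : Type*} {F : Set β} (hF : F.Finite) {p : ℝ → β → Prop}
    (hp : ∀ b ∈ F, ∃ D : ℝ, p D b) (hmono : ∀ b ∈ F, ∀ D D', D ≤ D' → p D b → p D' b) :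
    ∃ D : ℝ, 0 < D ∧ ∀ b ∈ F, p D b := by
  choose! f hf using hp
  obtain ⟨D, hD⟩ := (hF.image f).bddAbove
  exact ⟨max D 1, by positivity, fun b hb => hmono b hb _ _
    ((hD (mem_image_of_mem f hb)).trans (le_max_left _ _)) (hf b hb)⟩

/-- Linear independence bounds the number of vertices, so among the members coarsely containing Q
one has the most. Any member coarsely above it has the same number, and then containment reverses.
-/
lemma exists_maximal_of_mem {Q : Set V} (hQ : Q ∈ s.𝒞) : ∃ T ∈ s.maximal, CoarselyLE Q T := by
  let S : Set ℕ := {k | ∃ T ∈ s.𝒞, CoarselyLE Q T ∧ ∃ v : Fin k → V, IsProperSimplex s.P v ∧ T = hull v}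
  have hQQ : CoarselyLE Q Q := ⟨1, one_pos, fun p hp => ⟨p, hp, le_rfl, by simp⟩⟩
  have hS : S.Finite := by
    refine (Set.finite_Iic (Module.finrank ℝ V)).subset ?_
    rintro k ⟨T, -, -, v, hv, -⟩
    simpa using (hv.linearIndependent s.nonneg).fintype_card_le_finrank
  have hS0 : S.Nonempty := by
    obtain ⟨k, -, v, hv⟩ := s.simplicial Q hQ
    exact ⟨k, Q, hQ, hQQ, v, hv⟩
  obtain ⟨k, ⟨T, hT, hQT, v, hv, rfl⟩, hk⟩ := Set.exists_max_image S id hS hS0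
  refine ⟨_, ⟨hT, fun R hR hTR => ?_⟩, hQT⟩
  obtain ⟨l, -, u, hu, rfl⟩ := s.simplicial R hR
  have h1 : l ≤ k := hk l ⟨_, hR, hQT.trans hTR, u, hu, rfl⟩
  have h2 : k ≤ l := by
    obtain ⟨D, hD, h⟩ := hTR
    simpa using hv.card_le s.nonneg hu hD fun i => h _ (mem_hull_self v i)
  exact hv.coarselyLE_of_card_eq s.nonneg hu hTR (by simpa using h1.antisymm h2)

variable (s) in
/-- The family of coarsely maximal simplices is coarsely complete. -/
lemma maximal_complete : ∃ D : ℝ, 0 < D ∧ ∀ (n : ℕ) (v : Fin n → V), 3 ≤ n →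
    IsProperSimplex s.P v → ∃ Q ∈ s.maximal, ∀ x ∈ hull v, Near D Q x := by
  obtain ⟨F, hF, hFs, hFo⟩ := s.exists_finite_orbit_representatives
  obtain ⟨D, hD, hDF⟩ := exists_bound_of_finite hF
    (p := fun D Q => ∃ T ∈ s.maximal, ∀ x ∈ Q, Near D T x)
    (fun Q hQ => by
      obtain ⟨T, hT, D, -, h⟩ := exists_maximal_of_mem (hFs hQ)
      exact ⟨D, T, hT, h⟩)
    (fun Q _ D D' hDD' ⟨T, hT, h⟩ => ⟨T, hT, fun x hx =>
      (h x hx).mono (s.nonneg_of_mem hT.1) hDD'⟩)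
  obtain ⟨D', hD', hc⟩ := s.complete
  refine ⟨D' * D, by positivity, fun n v hn hv => ?_⟩
  obtain ⟨Q, hQ, hQn⟩ := hc n v hn hv
  obtain ⟨g, hg, hgQ⟩ := hFo Q hQ
  obtain ⟨T, hT, hQT⟩ := hDF _ hgQ
  have hT' := s.image_mem_maximal (s.symm_mem g hg) hT
  have h1 : ∀ q ∈ Q, Near D (g.symm '' T) q := fun q hq => by
    simpa using near_image (s.symm_mem g hg) (hQT _ (mem_image_of_mem g hq))
  refine ⟨_, hT', ?_⟩
  obtain ⟨k, -, u, hu, hue⟩ := s.simplicial _ hT'.1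
  rw [hue] at h1 ⊢
  exact near_of_mem_hull (zero_mem_hull u) (hull_add u) (hull_smul u) fun i =>
    (hQn i).trans hD'.le h1

/-- In each face of a coarsely maximal simplex, the points of `P` in the corresponding open face are
uniformly near the simplex. -/
lemma exists_near_of_comparable (hn : 3 ≤ n) (hv : IsProperSimplex s.P v)
    (hQ : hull v ∈ s.maximal) {J : Finset (Fin n)} (hJ : J ≠ Finset.univ) :
    ∃ D : ℝ, ∀ y ∈ s.P, Comparable y (∑ i ∈ J, v i) → Near D (hull v) y := by
  classical
  by_contra! hcon
  have hv0 : ∀ i, 0 ≤ v i := fun i => s.nonneg _ (hv.mem i)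
  have hQ0 := hv.hull_nonneg s.nonneg
  -- M is chosen within a factor two of the infimum of admissible constants, so that M is admissible
  -- and M / 2 is not.
  have hex : ∀ m : ℕ, ∃ y ∈ s.P, ∃ M : ℝ, (m : ℝ) + 1 < M ∧ Comparable y (∑ i ∈ J, v i) ∧
      Near M (hull v) y ∧ ¬ Near (M / 2) (hull v) y := by
    intro m
    obtain ⟨y, hy, hyx, hyn⟩ := hcon (m + 1)
    have hlow : ∀ D : ℝ, Near D (hull v) y → (m : ℝ) + 1 < D := fun D hD => by
      by_contra! h
      exact hyn (hD.mono hQ0 h)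
    have hbdd : BddBelow {D : ℝ | Near D (hull v) y} := ⟨m + 1, fun D hD => (hlow D hD).le⟩
    have hne : {D : ℝ | Near D (hull v) y}.Nonempty := by
      have h1 : Near 1 (hull v) (∑ i ∈ J, v i) := ⟨_, by
        simpa using sum_mem_hull v J (fun _ => 1) fun _ _ => zero_le_one, le_rfl, by simp⟩
      obtain ⟨D, -, hD⟩ := h1.of_comparable (hull_smul v) one_pos hyx
      exact ⟨D, hD⟩
    have hinf : (m : ℝ) + 1 ≤ sInf {D : ℝ | Near D (hull v) y} :=
      le_csInf hne fun D hD => (hlow D hD).le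
    have hm : (0 : ℝ) ≤ m := Nat.cast_nonneg m
    obtain ⟨M, hM, hM2⟩ := exists_lt_of_csInf_lt hne
      (show sInf {D : ℝ | Near D (hull v) y} < 2 * sInf {D : ℝ | Near D (hull v) y} by linarith)
    refine ⟨y, hy, M, hlow M hM, hyx, hM, fun h => ?_⟩
    have := csInf_le hbdd h
    linarith
  choose y hy M hM hyx hyM hyM2 using hex
  have hM0 : ∀ m, 0 < M m := fun m => by
    have : (0 : ℝ) ≤ m := Nat.cast_nonneg m
    linarith [hM m]
  choose a ha hay hya using hyM
  choose t ht hat using ha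
  have hcoeff : ∀ m, (∀ i ∉ J, t m i = 0) ∧ ∀ i ∈ J, 0 < t m i := fun m => by
    obtain ⟨K, hK, h1, h2⟩ := hyx m
    refine ⟨fun i hi => hv.coeff_eq_zero_of_le s.nonneg (ht m) hK
      (by rw [← hat]; exact (hay m).trans h1) hi, fun i hi => ?_⟩
    refine hv.coeff_pos_of_le s.nonneg (ht m) (C := K * M m) (mul_pos hK (hM0 m)) ?_ hi
    rw [← hat, mul_smul]
    exact h2.trans (smul_le_smul_vec hK.le (hya m))
  have haJ : ∀ m, a m = ∑ i ∈ J, t m i • v i := fun m => by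
    rw [hat]
    exact (Finset.sum_subset (Finset.subset_univ J) fun i _ hi => by
      rw [(hcoeff m).1 i hi, zero_smul]).symm
  -- Recurrence is applied to the interior points whose J-part is the approximating point a m. The
  -- translates of a m then converge to X.
  obtain ⟨h, u, γ, hh, hu, hQ₁, heq, hγ, hγ1⟩ := s.recurrence hv hQ.1
    (c := fun m i => if i ∈ J then t m i else 1) (fun m i => by
      split_ifs with hi
      exacts [(hcoeff m).2 i hi, one_pos])
  have hu0 : ∀ i, 0 ≤ u i := fun i => s.nonneg _ (hu.mem i)
  set X := ∑ i ∈ J, u i with hX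
  have hX0 : 0 ≤ X := Finset.sum_nonneg fun i _ => hu0 i
  have hXh : X ∈ hull u := by simpa using sum_mem_hull u J (fun _ => 1) fun _ _ => zero_le_one
  have hha : ∀ᶠ m in hyperfilter ℕ, h m (a m) = ∑ i ∈ J, γ m i • u i := by
    filter_upwards [hγ] with m hm
    rw [haJ, map_sum]
    exact Finset.sum_congr rfl fun i hi => by simpa [hi] using hm i
  have hla : Tendsto (fun m => h m (a m)) (hyperfilter ℕ) (𝓝 X) := by
    have : Tendsto (fun m => ∑ i ∈ J, γ m i • u i) (hyperfilter ℕ) (𝓝 X) := by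
      simpa using tendsto_finsetSum J fun i _ => (hγ1 i).smul_const (u i)
    exact this.congr' (hha.mono fun m hm => hm.symm)
  have ha2 : ∀ᶠ m in hyperfilter ℕ, h m (a m) ≤ (2 : ℝ) • X ∧ (1 / 2 : ℝ) • X ≤ h m (a m) := by
    have h1 : ∀ᶠ m in hyperfilter ℕ, ∀ i, γ m i < 2 ∧ 1 / 2 < γ m i := by
      rw [eventually_all]
      exact fun i => ((hγ1 i).eventually (gt_mem_nhds (by norm_num))).and
        ((hγ1 i).eventually (lt_mem_nhds (by norm_num)))
    filter_upwards [hha, h1] with m h1 h2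
    rw [h1, hX, Finset.smul_sum, Finset.smul_sum]
    exact ⟨Finset.sum_le_sum fun i _ => smul_le_smul_coeff (hu0 i) (h2 i).1.le,
      Finset.sum_le_sum fun i _ => smul_le_smul_coeff (hu0 i) (h2 i).2.le⟩
  set z : ℕ → V := fun m => h m ((M m)⁻¹ • y m) with hz
  have hz0 : ∀ m, 0 ≤ z m := fun m => (map_nonneg (hh m)).2
    (smul_nonneg (inv_nonneg.2 (hM0 m).le) (s.nonneg _ (hy m)))
  have hza : ∀ m, z m ≤ h m (a m) := fun m => by
    rw [hz]
    simp only
    rw [s.map_le _ (hh m)]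
    have := smul_le_smul_vec (inv_nonneg.2 (hM0 m).le) (hya m)
    rwa [smul_smul, inv_mul_cancel₀ (hM0 m).ne', one_smul] at this
  have hyz : ∀ m, h m (y m) = M m • z m := fun m => by
    rw [hz]
    simp only
    rw [← map_smul, smul_smul, mul_inv_cancel₀ (hM0 m).ne', one_smul]
  obtain ⟨w, hw⟩ := exists_tendsto_of_le hla (Eventually.of_forall hz0) (Eventually.of_forall hza)
  have hwP : w ∈ s.P := s.isClosed.mem_of_tendsto hw (Eventually.of_forall fun m =>
    (s.map_mem _ (hh m) _).2 (s.smul_mem _ (inv_nonneg.2 (hM0 m).le) _ (hy m)))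
  have hwX : w ≤ X := le_of_tendsto_of_tendsto hw hla (Eventually.of_forall hza)
  have hw0 := s.nonneg w hwP
  have hQm : hull u ∈ s.maximal := by
    obtain ⟨m, hm⟩ := heq.exists
    exact hm ▸ s.image_mem_maximal (hh m) hQ
  -- The limit w of the translates of y m / M m may leave the open face of X. The qualitative
  -- theorem still compares it with a point of the simplex.
  obtain ⟨q', hq', K, hK, hq1, hq2⟩ := exists_comparable_of_le hn hu hQm J hJ hwP one_pos
    (by rwa [one_smul])
  obtain ⟨q, hq, L, hL, hqw, hwq⟩ : ∃ q ∈ hull u, ∃ L : ℝ, 0 < L ∧ q ≤ w ∧ w ≤ L • q := by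
    refine ⟨K⁻¹ • q', hull_smul u _ (inv_nonneg.2 hK.le) _ hq', K * K, by positivity, ?_, ?_⟩
    · have := smul_le_smul_vec (inv_nonneg.2 hK.le) hq2
      rwa [smul_smul, inv_mul_cancel₀ hK.ne', one_smul] at this
    · rwa [smul_smul, mul_assoc, mul_inv_cancel₀ hK.ne', mul_one]
  have hq0 : 0 ≤ q := hu.hull_nonneg s.nonneg q hq
  obtain ⟨C, hC, hCX⟩ := exists_le_norm_smul hX0
  set ε : ℕ → ℝ := fun m => C * ‖z m - w‖ with hε
  have hε0 : ∀ m, 0 ≤ ε m := fun m => by positivity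
  have hεlim : Tendsto ε (hyperfilter ℕ) (𝓝 0) := by
    have := (hw.sub_const w).norm.const_mul C
    simpa using this
  have hMlim : ∀ᶠ m in hyperfilter ℕ, 4 * L ≤ M m := by
    obtain ⟨N, hN⟩ := exists_nat_gt (4 * L)
    filter_upwards [Nat.hyperfilter_le_atTop (eventually_ge_atTop N)] with m hm
    have : (N : ℝ) ≤ m := by exact_mod_cast hm
    linarith [hM m]
  obtain ⟨m, ⟨h1, h2, h3⟩, ⟨⟨h4, h5⟩, h6⟩⟩ := ((hMlim.and
    ((hεlim.eventually (gt_mem_nhds (by norm_num : (0 : ℝ) < 1 / 16))).and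
    (hεlim.eventually (gt_mem_nhds (by positivity : (0 : ℝ) < 1 / (16 * L)))))).and
    (ha2.and heq)).exists
  have hzX : z m ≤ (2 : ℝ) • X := (hza m).trans h4
  have hwX2 : w ≤ (2 : ℝ) • X := hwX.trans ((one_smul ℝ X).ge.trans
    (smul_le_smul_coeff hX0 (by norm_num)))
  have hle1 : z m - w ≤ ε m • X := hCX _ ⟨2, (sub_le_self _ hw0).trans hzX, by
    rw [neg_sub]; exact (sub_le_self _ (hz0 m)).trans hwX2⟩
  have hle2 : w - z m ≤ ε m • X := by
    have := hCX (w - z m) ⟨2, (sub_le_self _ (hz0 m)).trans hwX2, by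
      rw [neg_sub]; exact (sub_le_self _ hw0).trans hzX⟩
    rwa [norm_sub_rev] at this
  refine hyM2 m ?_
  have hnear : Near (M m / 2) (hull u) (h m (y m)) := by
    have hMm := hM0 m
    set lam : ℝ := 2 * L / M m with hlam
    have hlamM : lam * M m = 2 * L := div_mul_cancel₀ _ hMm.ne'
    have hlam0 : 0 < lam := by positivity
    have hlam1 : lam ≤ 1 / 2 := by
      rw [hlam, div_le_iff₀ hMm]
      linarith
    have hLε : 2 * L * ε m ≤ 1 / 8 := by
      have := h3.le
      rw [le_div_iff₀ (by positivity)] at this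
      linarith
    -- The improved approximation. From below, mix the bound X / 2 for the translate of y m with the
    -- bound M (q - ε X), giving the latter weight 2 L / M. From above, M z ≤ M (L q + X / 16),
    -- which is M / 2 times this vector.
    refine ⟨(1 / 8 : ℝ) • X + (2 * L) • q, hull_add u _ (hull_smul u _ (by norm_num) _ hXh) _
      (hull_smul u _ (by positivity) _ hq), ?_, ?_⟩
    · have e1 : (1 / 2 : ℝ) • X ≤ h m (y m) := h5.trans ((s.map_le _ (hh m) _ _).2 (hay m))
      have e2 : M m • (q - ε m • X) ≤ h m (y m) := by
        rw [hyz]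
        refine smul_le_smul_vec hMm.le ?_
        rw [sub_le_iff_le_add] at hle2 ⊢
        rw [add_comm]
        exact hqw.trans hle2
      have e3 : (1 / 4 : ℝ) • X ≤ ((1 - lam) * (1 / 2)) • X :=
        smul_le_smul_coeff hX0 (by linarith)
      have e4 : (2 * L * ε m) • X ≤ (1 / 8 : ℝ) • X := smul_le_smul_coeff hX0 hLε
      calc (1 / 8 : ℝ) • X + (2 * L) • q
          = (1 / 4 : ℝ) • X + (2 * L) • q - (1 / 8 : ℝ) • X := by module
        _ ≤ ((1 - lam) * (1 / 2)) • X + (2 * L) • q - (2 * L * ε m) • X :=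
          sub_le_sub (add_le_add e3 le_rfl) e4
        _ = (1 - lam) • ((1 / 2 : ℝ) • X) + lam • (M m • (q - ε m • X)) := by
          rw [smul_smul lam, hlamM]
          module
        _ ≤ (1 - lam) • h m (y m) + lam • h m (y m) :=
          add_le_add (smul_le_smul_vec (by linarith) e1) (smul_le_smul_vec hlam0.le e2)
        _ = h m (y m) := by module
    · rw [hyz]
      have e1 : z m ≤ L • q + (1 / 16 : ℝ) • X := by
        have := smul_le_smul_coeff hX0 h2.le
        rw [sub_le_iff_le_add] at hle1
        calc z m ≤ ε m • X + w := hle1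
          _ ≤ (1 / 16 : ℝ) • X + L • q := add_le_add this hwq
          _ = _ := add_comm _ _
      calc M m • z m ≤ M m • (L • q + (1 / 16 : ℝ) • X) := smul_le_smul_vec hMm.le e1
        _ = (M m / 2) • ((1 / 8 : ℝ) • X + (2 * L) • q) := by module
  have := near_image (s.symm_mem _ (hh m)) hnear
  rw [← h6] at this
  simpa [image_image] using this

variable (s) in
/-- Points of `P` in the open face of a boundary point of a coarsely maximal simplex are uniformly near
the simplex. -/
lemma maximal_near : ∃ D : ℝ, 0 < D ∧ ∀ Q ∈ s.maximal, ∀ x ∈ Q, x ∉ posInterior V →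
    ∀ y ∈ s.P, Comparable y x → Near D Q y := by
  classical
  obtain ⟨F, hF, hFs, hFo⟩ := s.exists_finite_orbit_representatives
  obtain ⟨D, hD, hDF⟩ := exists_bound_of_finite (hF.subset (inter_subset_left (t := s.maximal)))
    (p := fun D Q => ∀ x ∈ Q, x ∉ posInterior V → ∀ y ∈ s.P, Comparable y x → Near D Q y)
    (fun Q hQ => by
      obtain ⟨n, hn, v, hv, rfl⟩ := s.simplicial Q (hFs hQ.1)
      have hv0 : ∀ i, 0 ≤ v i := fun i => s.nonneg _ (hv.mem i)
      have hQ0 := hv.hull_nonneg s.nonneg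
      obtain ⟨D, -, hDJ⟩ := exists_bound_of_finite
        (Set.toFinite {J : Finset (Fin n) | J ≠ Finset.univ})
        (p := fun D J => ∀ y ∈ s.P, Comparable y (∑ i ∈ J, v i) → Near D (hull v) y)
        (fun J hJ => exists_near_of_comparable hn hv hQ.2 hJ)
        (fun J _ D D' hDD' h y hy hyx => (h y hy hyx).mono hQ0 hDD')
      refine ⟨D, ?_⟩
      rintro _ ⟨t, ht, rfl⟩ hxi y hy hyx
      have hsum : ∑ i, t i • v i = ∑ i ∈ Finset.univ.filter (fun i => 0 < t i), t i • v i := by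
        refine (Finset.sum_subset (Finset.subset_univ _) fun i _ hi => ?_).symm
        have : t i = 0 := le_antisymm (by simpa using hi) (ht i)
        rw [this, zero_smul]
      -- A boundary point x of the simplex is comparable to the sum of the generators in its
      -- support, and this support is proper because x is not interior. There are finitely many
      -- supports, hence one constant.
      refine hDJ (Finset.univ.filter fun i => 0 < t i) (fun hJ => hxi ?_) y hy (hyx.trans ?_)
      · exact hv.mem_posInterior s.nonneg fun i => by
          have := Finset.mem_univ i
          rw [← hJ] at this
          simpa using this
      · refine Comparable.of_le_le (a := ∑ i, t i)
          (b := ∑ i ∈ Finset.univ.filter (fun i => 0 < t i), (t i)⁻¹)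
          (Finset.sum_nonneg fun i _ => smul_nonneg (ht i) (hv0 i))
          (Finset.sum_nonneg fun i _ => hv0 i) ?_ ?_
        · rw [hsum, Finset.smul_sum]
          exact Finset.sum_le_sum fun i _ => smul_le_smul_coeff (hv0 i)
            (Finset.single_le_sum (f := t) (fun j _ => ht j) (Finset.mem_univ i))
        · rw [Finset.sum_smul]
          refine Finset.sum_le_sum fun i hi => ?_
          have hti : 0 < t i := by simpa using hi
          have h1 := Finset.single_le_sum (f := fun i => t i • v i)
            (fun j _ => smul_nonneg (ht j) (hv0 j)) (Finset.mem_univ i)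
          have h3 := smul_le_smul_vec (inv_nonneg.2 hti.le) h1
          rwa [smul_smul, inv_mul_cancel₀ hti.ne', one_smul] at h3)
    (fun Q hQ D D' hDD' h x hx hxi y hy hyx =>
      (h x hx hxi y hy hyx).mono (s.nonneg_of_mem (hFs hQ.1)) hDD')
  refine ⟨D, hD, fun Q hQ x hx hxi y hy hyx => ?_⟩
  obtain ⟨g, hg, hgQ⟩ := hFo Q hQ.1
  have h1 := hDF _ ⟨hgQ, s.image_mem_maximal hg hQ⟩ _ (mem_image_of_mem g hx)
    (fun h => hxi ((map_mem_posInterior hg).1 h)) (g y) ((s.map_mem g hg _).2 hy) (by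
      obtain ⟨M, hM, h1, h2⟩ := hyx
      exact ⟨M, hM, by rw [← map_smul]; exact (s.map_le g hg _ _).2 h1,
        by rw [← map_smul]; exact (s.map_le g hg _ _).2 h2⟩)
  simpa [image_image] using near_image (s.symm_mem g hg) h1

end ConeSystem

end OrderedCone

/-! ### From orders to explicit cones -/

namespace OrderedCone

section NormalCone

variable {V : Type*} [NormedAddCommGroup V] [NormedSpace ℝ V]

/-- A closed convex cone that is normal, in particular pointed. -/
structure IsNormalCone (K : Set V) : Prop where
  isClosed : IsClosed K
  zero_mem : (0 : V) ∈ K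
  add_mem : ∀ u ∈ K, ∀ v ∈ K, u + v ∈ K
  smul_mem : ∀ c : ℝ, 0 ≤ c → ∀ v ∈ K, c • v ∈ K
  exists_bound : ∃ c : ℝ, 0 < c ∧ ∀ u v : V, u ∈ K → v - u ∈ K → ‖u‖ ≤ c * ‖v‖

/-- `Near` for the order with the cone `K` of non-negative vectors. -/
def ConeNear (K : Set V) (D : ℝ) (Q : Set V) (p : V) : Prop := ∃ q ∈ Q, p - q ∈ K ∧ D • q - p ∈ K

/-- `Comparable` for the order with the cone `K` of non-negative vectors. -/
def ConeComparable (K : Set V) (u v : V) : Prop := ∃ M : ℝ, 0 < M ∧ M • v - u ∈ K ∧ M • u - v ∈ K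

/-- `IsProperSimplex` for the order with the cone `K` of non-negative vectors. -/
structure IsConeSimplex (K : Set V) {ι : Type*} [Fintype ι] (P : Set V) (v : ι → V) : Prop where
  mem : ∀ i, v i ∈ P
  sum_mem : ∑ i, v i ∈ interior K
  facet : ∀ i, ∑ j, v j - v i ∉ interior K

/-- `ConeSystem` for the order with the cone `K` of non-negative vectors. -/
structure IsConeSystem (K P : Set V) (𝒞 : Set (Set V)) (𝒢 : Set (V ≃L[ℝ] V)) : Prop where
  subset : P ⊆ K
  isClosed : IsClosed P
  zero_mem : (0 : V) ∈ P
  add_mem : ∀ p ∈ P, ∀ q ∈ P, p + q ∈ P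
  smul_mem : ∀ c : ℝ, 0 ≤ c → ∀ p ∈ P, c • p ∈ P
  map_mem_cone : ∀ g ∈ 𝒢, ∀ v, g v ∈ K ↔ v ∈ K
  map_mem : ∀ g ∈ 𝒢, ∀ v, g v ∈ P ↔ v ∈ P
  image_mem : ∀ g ∈ 𝒢, ∀ Q ∈ 𝒞, g '' Q ∈ 𝒞
  symm_mem : ∀ g ∈ 𝒢, g.symm ∈ 𝒢
  cocompact : ∃ Z : Set V, IsCompact Z ∧ Z ⊆ interior K ∧ ∀ p ∈ P, p ∈ interior K → ∃ g ∈ 𝒢, g p ∈ Z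
  simplicial : ∀ Q ∈ 𝒞, ∃ n : ℕ, 3 ≤ n ∧ ∃ v : Fin n → V, IsConeSimplex K P v ∧ Q = hull v
  finite : ∀ Z : Set V, IsCompact Z → Z ⊆ interior K → {Q ∈ 𝒞 | (Q ∩ Z).Nonempty}.Finite
  complete : ∃ D : ℝ, 0 < D ∧ ∀ (n : ℕ) (v : Fin n → V), 3 ≤ n → IsConeSimplex K P v →
    ∃ Q ∈ 𝒞, ∀ i, ConeNear K D Q (v i)

namespace IsNormalCone

variable {K P : Set V} (hK : IsNormalCone K)

/-- The order whose cone of non-negative vectors is `K`. -/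
@[reducible] def partialOrder : PartialOrder V where
  le u v := v - u ∈ K
  le_refl u := by
    rw [sub_self]
    exact hK.zero_mem
  le_trans u v w huv hvw := by
    have := hK.add_mem _ hvw _ huv
    rwa [sub_add_sub_cancel] at this
  le_antisymm u v huv hvu := by
    obtain ⟨c, -, h⟩ := hK.exists_bound
    have h1 := h (v - u) 0 huv (by rw [zero_sub, neg_sub]; exact hvu)
    rw [norm_zero, mul_zero, norm_le_zero_iff] at h1
    exact (sub_eq_zero.1 h1).symm

lemma isOrderedAddMonoid :
    letI := hK.partialOrder
    IsOrderedAddMonoid V :=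
  letI := hK.partialOrder
  { add_le_add_left := fun u v huv w => by
      change v + w - (u + w) ∈ K
      rw [add_sub_add_right_eq_sub]
      exact huv }

lemma isOrderedModule :
    letI := hK.partialOrder
    IsOrderedModule ℝ V :=
  letI := hK.partialOrder
  { smul_le_smul_of_nonneg_left := fun c hc u v huv => by
      change c • v - c • u ∈ K
      rw [← smul_sub]
      exact hK.smul_mem c hc _ huv
    smul_le_smul_of_nonneg_right := fun u hu a b hab => by
      change b • u - a • u ∈ K
      have h : u - 0 ∈ K := hu
      rw [← sub_smul]
      rw [sub_zero] at h
      exact hK.smul_mem _ (sub_nonneg.2 hab) _ h }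

lemma orderClosedTopology :
    letI := hK.partialOrder
    OrderClosedTopology V :=
  letI := hK.partialOrder
  ⟨by
    change IsClosed ((fun p : V × V => p.2 - p.1) ⁻¹' K)
    exact hK.isClosed.preimage (continuous_snd.sub continuous_fst)⟩

lemma normalOrder :
    letI := hK.partialOrder
    NormalOrder V :=
  letI := hK.partialOrder
  ⟨by
    obtain ⟨c, hc, h⟩ := hK.exists_bound
    refine ⟨c, hc, fun u v hu huv => h u v ?_ huv⟩
    have h1 : u - 0 ∈ K := hu
    rwa [sub_zero] at h1⟩

lemma nonneg_iff (v : V) :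
    letI := hK.partialOrder
    0 ≤ v ↔ v ∈ K := by
  let := hK.partialOrder
  change v - 0 ∈ K ↔ _
  rw [sub_zero]

lemma posInterior_eq :
    letI := hK.partialOrder
    posInterior V = interior K := by
  let := hK.partialOrder
  have : {v : V | 0 ≤ v} = K := by
    ext v
    exact hK.nonneg_iff v
  rw [posInterior, this]

lemma isProperSimplex_iff {ι : Type*} [Fintype ι] {v : ι → V} :
    letI := hK.partialOrder
    IsProperSimplex P v ↔ IsConeSimplex K P v := by
  let := hK.partialOrder
  have h := hK.posInterior_eq
  exact ⟨fun ⟨h1, h2, h3⟩ => ⟨h1, h ▸ h2, h ▸ h3⟩, fun ⟨h1, h2, h3⟩ => ⟨h1, h ▸ h2, h ▸ h3⟩⟩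

lemma sub_mem_of_le (hK : IsNormalCone K) {u v : V} (hv : v ∈ K) {a b : ℝ} (hab : a ≤ b)
    (h : a • v - u ∈ K) : b • v - u ∈ K := by
  have h1 := hK.add_mem _ h _ (hK.smul_mem _ (sub_nonneg.2 hab) _ hv)
  rw [sub_smul] at h1
  convert h1 using 1
  abel

end IsNormalCone

section ConeComparable

variable {K : Set V} {u v w : V}

lemma ConeComparable.symm (h : ConeComparable K u v) : ConeComparable K v u := by
  obtain ⟨M, hM, h1, h2⟩ := h
  exact ⟨M, hM, h2, h1⟩

lemma ConeComparable.of_sub_mem (hK : IsNormalCone K) (hu : u ∈ K) (hv : v ∈ K) {a b : ℝ}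
    (h1 : a • v - u ∈ K) (h2 : b • u - v ∈ K) : ConeComparable K u v :=
  ⟨max 1 (max a b), by positivity, hK.sub_mem_of_le hv (by simp) h1,
    hK.sub_mem_of_le hu (by simp) h2⟩

lemma ConeComparable.refl (hK : IsNormalCone K) (u : V) : ConeComparable K u u :=
  ⟨1, one_pos, by simpa using hK.zero_mem, by simpa using hK.zero_mem⟩

lemma ConeComparable.trans (hK : IsNormalCone K) (h : ConeComparable K u v)
    (h' : ConeComparable K v w) : ConeComparable K u w := by
  obtain ⟨M, hM, h1, h2⟩ := h
  obtain ⟨N, hN, h3, h4⟩ := h'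
  refine ⟨M * N, mul_pos hM hN, ?_, ?_⟩
  · convert hK.add_mem _ (hK.smul_mem M hM.le _ h3) _ h1 using 1
    rw [smul_sub, mul_smul]
    abel
  · convert hK.add_mem _ (hK.smul_mem N hN.le _ h2) _ h4 using 1
    rw [smul_sub, mul_comm, mul_smul]
    abel

lemma ConeComparable.smul (hK : IsNormalCone K) (hu : u ∈ K) (hv : v ∈ K) {c : ℝ} (hc : 0 < c)
    (h : ConeComparable K u v) : ConeComparable K (c • u) v := by
  obtain ⟨M, hM, h1, h2⟩ := h
  refine ConeComparable.of_sub_mem hK (hK.smul_mem c hc.le _ hu) hv (a := c * M) (b := M * c⁻¹)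
    ?_ ?_
  · rw [mul_smul, ← smul_sub]
    exact hK.smul_mem c hc.le _ h1
  · rwa [smul_smul, mul_assoc, inv_mul_cancel₀ hc.ne', mul_one]

end ConeComparable

namespace IsNormalCone

variable [FiniteDimensional ℝ V] {K P : Set V} {𝒞 : Set (Set V)} {𝒢 : Set (V ≃L[ℝ] V)}

/-- A cone system contains an invariant, coarsely complete subsystem whose members are uniformly close
to all points of `P` in the open faces of their boundary points. -/
theorem exists_subsystem (hK : IsNormalCone K) (hs : IsConeSystem K P 𝒞 𝒢) :
    ∃ 𝒞' ⊆ 𝒞, (∀ g ∈ 𝒢, ∀ Q ∈ 𝒞', g '' Q ∈ 𝒞') ∧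
      (∃ D : ℝ, 0 < D ∧ ∀ (n : ℕ) (v : Fin n → V), 3 ≤ n → IsConeSimplex K P v →
        ∃ Q ∈ 𝒞', ∀ x ∈ hull v, ConeNear K D Q x) ∧
      ∃ D : ℝ, 0 < D ∧ ∀ Q ∈ 𝒞', ∀ x ∈ Q, x ∉ interior K → ∀ y ∈ P, ConeComparable K y x →
        ConeNear K D Q y := by
  -- The order is installed only locally: the pointwise order on the coordinate space is a different
  -- one, so the results are stated in terms of membership in K.
  let := hK.partialOrder
  have := hK.isOrderedAddMonoid
  have := hK.isOrderedModule
  have := hK.orderClosedTopology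
  have := hK.normalOrder
  let s : ConeSystem V :=
    { P := P
      𝒞 := 𝒞
      𝒢 := 𝒢
      nonneg := fun p hp => (hK.nonneg_iff p).2 (hs.subset hp)
      isClosed := hs.isClosed
      zero_mem := hs.zero_mem
      add_mem := hs.add_mem
      smul_mem := hs.smul_mem
      map_le := fun g hg u v => by
        change g v - g u ∈ K ↔ v - u ∈ K
        rw [← map_sub]
        exact hs.map_mem_cone g hg _
      map_mem := hs.map_mem
      image_mem := hs.image_mem
      symm_mem := hs.symm_mem
      cocompact := by
        rw [hK.posInterior_eq]
        exact hs.cocompact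
      simplicial := fun Q hQ => by
        obtain ⟨n, hn, v, hv, hQv⟩ := hs.simplicial Q hQ
        exact ⟨n, hn, v, hK.isProperSimplex_iff.2 hv, hQv⟩
      finite := fun Z hZ hZK => hs.finite Z hZ (by rwa [hK.posInterior_eq] at hZK)
      complete := by
        obtain ⟨D, hD, h⟩ := hs.complete
        exact ⟨D, hD, fun n v hn hv => h n v hn (hK.isProperSimplex_iff.1 hv)⟩ }
  refine ⟨s.maximal, fun Q hQ => hQ.1, fun g hg Q hQ => s.image_mem_maximal hg hQ, ?_, ?_⟩
  · obtain ⟨D, hD, h⟩ := s.maximal_complete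
    exact ⟨D, hD, fun n v hn hv => h n v hn (hK.isProperSimplex_iff.2 hv)⟩
  · obtain ⟨D, hD, h⟩ := s.maximal_near
    exact ⟨D, hD, fun Q hQ x hx hxi => h Q hQ x hx (by rwa [hK.posInterior_eq])⟩

lemma exists_norm_smul_sub_mem (hK : IsNormalCone K) {x : V} (hx : x ∈ K) : ∃ C : ℝ, 0 < C ∧
    ∀ y : V, (∃ M : ℝ, M • x - y ∈ K ∧ M • x + y ∈ K) → (C * ‖y‖) • x - y ∈ K := by
  let := hK.partialOrder
  have := hK.isOrderedAddMonoid
  have := hK.isOrderedModule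
  have := hK.orderClosedTopology
  have := hK.normalOrder
  obtain ⟨C, hC, h⟩ := exists_le_norm_smul ((hK.nonneg_iff x).2 hx)
  refine ⟨C, hC, fun y ⟨M, h1, h2⟩ => h y ⟨M, h1, ?_⟩⟩
  change M • x - -y ∈ K
  rwa [sub_neg_eq_add]

lemma exists_smul_sub_mem_interior (hK : IsNormalCone K) {u : V} (hu : u ∈ interior K) (v : V) :
    ∃ M : ℝ, 0 < M ∧ M • u - v ∈ interior K := by
  let := hK.partialOrder
  have := hK.isOrderedAddMonoid
  have := hK.isOrderedModule
  have := hK.orderClosedTopology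
  have := hK.normalOrder
  rw [← hK.posInterior_eq] at hu ⊢
  exact exists_le_smul_of_mem_posInterior hu v

lemma mem_interior_of_sub_mem (hK : IsNormalCone K) {u v : V} (hu : u ∈ interior K)
    (h : v - u ∈ K) : v ∈ interior K := by
  let := hK.partialOrder
  have := hK.isOrderedAddMonoid
  have := hK.isOrderedModule
  have := hK.orderClosedTopology
  rw [← hK.posInterior_eq] at hu ⊢
  exact posInterior_mono hu h

lemma smul_mem_interior (hK : IsNormalCone K) {u : V} (hu : u ∈ interior K) {c : ℝ} (hc : 0 < c) :
    c • u ∈ interior K := by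
  let := hK.partialOrder
  have := hK.isOrderedAddMonoid
  have := hK.isOrderedModule
  have := hK.orderClosedTopology
  rw [← hK.posInterior_eq] at hu ⊢
  exact (smul_mem_posInterior_iff hc).2 hu

lemma coneNear_of_tendsto (hK : IsNormalCone K) {α : Type*} {U : Ultrafilter α} {D : ℝ} {Q : Set V}
    (hQ : IsClosed Q) (hQK : Q ⊆ K) {x : α → V} {a : V} (hx : Filter.Tendsto x U (𝓝 a))
    (h : ∀ᶠ n in U, ConeNear K D Q (x n)) : ConeNear K D Q a := by
  let := hK.partialOrder
  have := hK.isOrderedAddMonoid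
  have := hK.isOrderedModule
  have := hK.orderClosedTopology
  have := hK.normalOrder
  exact near_of_tendsto hQ (fun q hq => (hK.nonneg_iff q).2 (hQK hq)) hx h

section Simplex

variable {ι : Type*} [Fintype ι] {v : ι → V} {t : ι → ℝ}

lemma pos_of_mem_interior (hK : IsNormalCone K) (hP : P ⊆ K) (hv : IsConeSimplex K P v)
    (h : ∑ i, t i • v i ∈ interior K) (i : ι) : 0 < t i := by
  let := hK.partialOrder
  have := hK.isOrderedAddMonoid
  have := hK.isOrderedModule
  have := hK.orderClosedTopology
  have := hK.normalOrder
  refine (hK.isProperSimplex_iff.2 hv).pos_of_mem_posInterior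
    (fun p hp => (hK.nonneg_iff p).2 (hP hp)) ?_ i
  rwa [hK.posInterior_eq]

lemma sum_mem_interior (hK : IsNormalCone K) (hP : P ⊆ K) (hv : IsConeSimplex K P v)
    (ht : ∀ i, 0 < t i) : ∑ i, t i • v i ∈ interior K := by
  let := hK.partialOrder
  have := hK.isOrderedAddMonoid
  have := hK.isOrderedModule
  have := hK.orderClosedTopology
  have := hK.normalOrder
  rw [← hK.posInterior_eq]
  exact (hK.isProperSimplex_iff.2 hv).mem_posInterior
    (fun p hp => (hK.nonneg_iff p).2 (hP hp)) ht

lemma linearIndependent (hK : IsNormalCone K) (hP : P ⊆ K) (hv : IsConeSimplex K P v) :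
    LinearIndependent ℝ v := by
  let := hK.partialOrder
  have := hK.isOrderedAddMonoid
  have := hK.isOrderedModule
  have := hK.orderClosedTopology
  have := hK.normalOrder
  exact (hK.isProperSimplex_iff.2 hv).linearIndependent (fun p hp => (hK.nonneg_iff p).2 (hP hp))

lemma coeff_eq_zero_of_sub_mem (hK : IsNormalCone K) (hP : P ⊆ K) (hv : IsConeSimplex K P v)
    (ht : ∀ i, 0 ≤ t i) {J : Finset ι} {c : ℝ} (hc : 0 < c)
    (h : c • ∑ i ∈ J, v i - ∑ i, t i • v i ∈ K) {i : ι} (hi : i ∉ J) : t i = 0 := by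
  let := hK.partialOrder
  have := hK.isOrderedAddMonoid
  have := hK.isOrderedModule
  have := hK.orderClosedTopology
  have := hK.normalOrder
  exact (hK.isProperSimplex_iff.2 hv).coeff_eq_zero_of_le
    (fun p hp => (hK.nonneg_iff p).2 (hP hp)) ht hc h hi

end Simplex

end IsNormalCone

end NormalCone

end OrderedCone

/-! ### The cone over a properly convex domain -/

namespace ConvexProjective

open OrderedCone Filter

variable {d : ℕ}

section Lifts

variable {v w : Fin d → ℝ} {p q : ProjSpace d} {A : Set (ProjSpace d)}

lemma Lifts.ne_zero (h : Lifts v p) : v ≠ 0 := h.1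

lemma lifts_mk (hv : v ≠ 0) : Lifts v (Projectivization.mk ℝ v hv) := ⟨hv, rfl⟩

lemma exists_lifts (p : ProjSpace d) : ∃ v, Lifts v p := ⟨p.rep, p.rep_nonzero, p.mk_rep⟩

lemma Lifts.eq (h : Lifts v p) (h' : Lifts v q) : p = q := by
  obtain ⟨hv, rfl⟩ := h
  obtain ⟨_, rfl⟩ := h'
  rfl

lemma Lifts.smul (h : Lifts v p) {c : ℝ} (hc : c ≠ 0) : Lifts (c • v) p := by
  obtain ⟨hv, rfl⟩ := h
  refine ⟨smul_ne_zero hc hv, ?_⟩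
  rw [Projectivization.mk_eq_mk_iff']
  exact ⟨c, rfl⟩

lemma Lifts.neg (h : Lifts v p) : Lifts (-v) p := by
  simpa using h.smul (c := -1) (by norm_num)

lemma Lifts.exists_smul_eq (h : Lifts v p) (h' : Lifts w p) : ∃ c : ℝ, c ≠ 0 ∧ w = c • v := by
  obtain ⟨hv, rfl⟩ := h
  obtain ⟨hw, h⟩ := h'
  rw [Projectivization.mk_eq_mk_iff'] at h
  obtain ⟨c, hc⟩ := h
  refine ⟨c, ?_, hc.symm⟩
  rintro rfl
  exact hw (by rw [← hc, zero_smul])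

/-- The set of all nonzero vectors that represent points of `A`. -/
def liftSet (A : Set (ProjSpace d)) : Set (Fin d → ℝ) := {v | ∃ p ∈ A, Lifts v p}

/-- The set of all points that are represented by elements of `U`. -/
def proj (U : Set (Fin d → ℝ)) : Set (ProjSpace d) := {p | ∃ v ∈ U, Lifts v p}

lemma Lifts.mem_liftSet (h : Lifts v p) : v ∈ liftSet A ↔ p ∈ A :=
  ⟨fun ⟨_, hq, h'⟩ => h.eq h' ▸ hq, fun hp => ⟨p, hp, h⟩⟩

lemma isOpen_iff_liftSet : IsOpen A ↔ IsOpen (liftSet A) := by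
  have h1 : liftSet A = Subtype.val ''
      ((fun v : {v : Fin d → ℝ // v ≠ 0} => Projectivization.mk ℝ v.1 v.2) ⁻¹' A) := by
    ext v
    constructor
    · rintro ⟨p, hp, hv, rfl⟩
      exact ⟨⟨v, hv⟩, hp, rfl⟩
    · rintro ⟨v, hv, rfl⟩
      exact ⟨_, hv, lifts_mk v.2⟩
  rw [isOpen_coinduced, h1, ← IsOpenEmbedding.isOpen_iff_image_isOpen]
  exact (isOpen_ne (x := (0 : Fin d → ℝ))).isOpenEmbedding_subtypeVal

lemma isOpen_proj {U : Set (Fin d → ℝ)} (hU : IsOpen U) : IsOpen (proj U) := by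
  have h1 : liftSet (proj U) = ⋃ c : {c : ℝ // c ≠ 0}, (fun v => c.1 • v) ⁻¹' (U \ {0}) := by
    ext v
    simp only [mem_iUnion, mem_preimage]
    constructor
    · rintro ⟨p, ⟨w, hw, hwp⟩, hvp⟩
      obtain ⟨c, hc, rfl⟩ := hvp.exists_smul_eq hwp
      exact ⟨⟨c, hc⟩, hw, hwp.ne_zero⟩
    · rintro ⟨⟨c, hc⟩, hv, hv0⟩
      have := lifts_mk (v := c • v) hv0
      refine ⟨_, ⟨_, hv, this⟩, ?_⟩
      simpa [smul_smul, inv_mul_cancel₀ hc] using this.smul (inv_ne_zero hc)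
  rw [isOpen_iff_liftSet, h1]
  exact isOpen_iUnion fun c => (hU.sdiff isClosed_singleton).preimage (continuous_const_smul _)

/-- Both maps between subsets of projective space and sets of vectors preserve openness, so closures
can be computed upstairs. -/
lemma Lifts.mem_closure_iff (h : Lifts v p) : p ∈ closure A ↔ v ∈ closure (liftSet A) := by
  constructor
  · intro hp
    rw [_root_.mem_closure_iff] at hp ⊢
    intro N hN hv
    obtain ⟨q, ⟨w, hw, hwq⟩, hq⟩ := hp (proj N) (isOpen_proj hN) ⟨v, hv, h⟩
    exact ⟨w, hw, q, hq, hwq⟩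
  · intro hv
    rw [_root_.mem_closure_iff] at hv ⊢
    intro O hO hp
    obtain ⟨w, ⟨q, hq, hwq⟩, hw⟩ := hv (liftSet O) (isOpen_iff_liftSet.1 hO) ⟨p, hp, h⟩
    exact ⟨q, hq, hwq.mem_liftSet.1 hw⟩

end Lifts

/-- `K` is a closed normal cone that projects onto the closure of `Ω`, its interior projects onto
`Ω`, and `f` is positive on it. -/
structure IsConeOver (Ω : Set (ProjSpace d)) (K : Set (Fin d → ℝ))
    (f : (Fin d → ℝ) →ₗ[ℝ] ℝ) : Prop where
  cone : IsNormalCone K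
  pos : ∀ v ∈ K, v ≠ 0 → 0 < f v
  mem_iff : ∀ v p, Lifts v p → (p ∈ Ω ↔ v ∈ interior K ∨ -v ∈ interior K)
  mem_closure_iff : ∀ v p, Lifts v p → (p ∈ closure Ω ↔ v ∈ K ∨ -v ∈ K)
  nonempty : (interior K).Nonempty
  zero_notMem : (0 : Fin d → ℝ) ∉ interior K
  norm_le : ∃ R : ℝ, ∀ v ∈ K, ‖v‖ ≤ R * f v

/-- The cone of positive representatives over a convex subset of a chart. -/
def posLift (f : (Fin d → ℝ) →ₗ[ℝ] ℝ) (C : Set (ProjSpace d)) : Set (Fin d → ℝ) :=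
  {v | 0 < f v ∧ v ∈ liftSet C}

section PosLift

variable {f : (Fin d → ℝ) →ₗ[ℝ] ℝ} {C : Set (ProjSpace d)}

lemma smul_mem_posLift {v : Fin d → ℝ} (hv : v ∈ posLift f C) {c : ℝ} (hc : 0 < c) :
    c • v ∈ posLift f C := by
  obtain ⟨h1, p, hp, h2⟩ := hv
  exact ⟨by simpa using mul_pos hc h1, p, hp, h2.smul hc.ne'⟩

lemma inv_smul_mem_chartImage {v : Fin d → ℝ} (hv : v ∈ posLift f C) :
    (f v)⁻¹ • v ∈ chartImage f C := by
  obtain ⟨h1, p, hp, h2⟩ := hv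
  exact ⟨by simp [inv_mul_cancel₀ h1.ne'], p, hp, h2.smul (inv_ne_zero h1.ne')⟩

/-- After division by f v + f w, the sum is the convex combination of the normalized vectors with
weights proportional to f v and f w. -/
lemma add_mem_posLift (hC : Convex ℝ (chartImage f C)) {v w : Fin d → ℝ} (hv : v ∈ posLift f C)
    (hw : w ∈ posLift f C) : v + w ∈ posLift f C := by
  have h := hC (inv_smul_mem_chartImage hv) (inv_smul_mem_chartImage hw)
    (div_nonneg hv.1.le (add_pos hv.1 hw.1).le) (div_nonneg hw.1.le (add_pos hv.1 hw.1).le)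
    (by rw [← add_div, div_self (add_pos hv.1 hw.1).ne'])
  obtain ⟨-, p, hp, h⟩ := h
  have h1 := h.smul (add_pos hv.1 hw.1).ne'
  have hv0 := hv.1.ne'
  have hw0 := hw.1.ne'
  have hvw := (add_pos hv.1 hw.1).ne'
  refine ⟨by simpa using add_pos hv.1 hw.1, p, hp, ?_⟩
  convert h1 using 1
  rw [smul_add, smul_smul, smul_smul, smul_smul, smul_smul]
  have e1 : (f v + f w) * (f v / (f v + f w)) * (f v)⁻¹ = 1 := by field_simp
  have e2 : (f v + f w) * (f w / (f v + f w)) * (f w)⁻¹ = 1 := by field_simp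
  rw [e1, e2, one_smul, one_smul]

lemma convex_posLift (hC : Convex ℝ (chartImage f C)) : Convex ℝ (posLift f C) := by
  rw [convex_iff_forall_pos]
  intro v hv w hw a b ha hb _
  exact add_mem_posLift hC (smul_mem_posLift hv ha) (smul_mem_posLift hw hb)

lemma liftSet_eq_union (hf : InChart f C) : liftSet C = posLift f C ∪ -posLift f C := by
  ext v
  constructor
  · rintro ⟨p, hp, h⟩
    rcases (hf p hp v h).lt_or_gt with h1 | h1
    · exact Or.inr ⟨by simpa using h1, p, hp, h.neg⟩
    · exact Or.inl ⟨h1, p, hp, h⟩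
  · rintro (⟨-, h⟩ | ⟨-, p, hp, h⟩)
    · exact h
    · exact ⟨p, hp, by simpa using h.neg⟩

lemma zero_mem_closure_of_smul_mem {V : Type*} [NormedAddCommGroup V] [NormedSpace ℝ V] {A : Set V}
    (hA : A.Nonempty) (h : ∀ v ∈ A, ∀ c : ℝ, 0 < c → c • v ∈ A) : (0 : V) ∈ closure A := by
  obtain ⟨v, hv⟩ := hA
  have h1 : Tendsto (fun c : ℝ => c • v) (𝓝[>] 0) (𝓝 ((0 : ℝ) • v)) :=
    ((continuous_id.smul continuous_const).tendsto' 0 _ rfl).mono_left nhdsWithin_le_nhds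
  rw [zero_smul] at h1
  exact mem_closure_of_tendsto h1 (by
    filter_upwards [self_mem_nhdsWithin] with c hc
    exact h v hv c hc)

lemma smul_mem_closure_of_smul_mem {V : Type*} [NormedAddCommGroup V] [NormedSpace ℝ V] {A : Set V}
    (hA : A.Nonempty) (h : ∀ v ∈ A, ∀ c : ℝ, 0 < c → c • v ∈ A) (c : ℝ) (hc : 0 ≤ c) (v : V)
    (hv : v ∈ closure A) : c • v ∈ closure A := by
  rcases hc.eq_or_lt with rfl | hc
  · rw [zero_smul]
    exact zero_mem_closure_of_smul_mem hA h
  · exact map_mem_closure (continuous_const_smul c) hv fun w hw => h w hw c hc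

lemma add_mem_closure_of_add_mem {V : Type*} [NormedAddCommGroup V] {A : Set V}
    (h : ∀ v ∈ A, ∀ w ∈ A, v + w ∈ A) (v : V) (hv : v ∈ closure A) (w : V) (hw : w ∈ closure A) :
    v + w ∈ closure A :=
  map_mem_closure₂ continuous_add hv hw h

end PosLift

/-- K is the closure of the positive lift. Boundedness in the chart gives ‖v‖ ≤ R f v on K, whence
normality. An open convex set is the interior of its closure, so the interior of K gives back Ω. -/
theorem exists_isConeOver {Ω : Set (ProjSpace d)} (h : IsProperlyConvexDomain Ω) :
    ∃ K f, IsConeOver Ω K f := by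
  obtain ⟨⟨p₀, hp₀⟩, hopen, f, -, hf, hconv, hbdd⟩ := h
  obtain ⟨v₀, hv₀⟩ : (posLift f Ω).Nonempty := by
    obtain ⟨v, hv⟩ := exists_lifts p₀
    have : v ∈ liftSet Ω := ⟨p₀, hp₀, hv⟩
    rw [liftSet_eq_union hf] at this
    rcases this with h | h
    exacts [⟨v, h⟩, ⟨-v, h⟩]
  have hfc : Continuous f := f.continuous_of_finiteDimensional
  have hop : IsOpen (posLift f Ω) :=
    (isOpen_lt continuous_const hfc).inter (isOpen_iff_liftSet.1 hopen)
  have hint : interior (closure (posLift f Ω)) = posLift f Ω := by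
    rw [(convex_posLift hconv).interior_closure_eq_interior_of_nonempty_interior
      (by rw [hop.interior_eq]; exact ⟨v₀, hv₀⟩), hop.interior_eq]
  have hsm : ∀ v ∈ posLift f Ω, ∀ c : ℝ, 0 < c → c • v ∈ posLift f Ω :=
    fun v hv c hc => smul_mem_posLift hv hc
  obtain ⟨R, hR, hRb⟩ := hbdd.exists_pos_norm_le
  have hnorm : ∀ v ∈ closure (posLift f Ω), ‖v‖ ≤ R * f v := by
    refine fun v hv => closure_minimal (t := {v | ‖v‖ ≤ R * f v}) (fun v hv => ?_)
      (isClosed_le continuous_norm (continuous_const.mul hfc)) hv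
    have h1 := hRb _ (inv_smul_mem_chartImage hv)
    rw [norm_smul, norm_inv, Real.norm_of_nonneg hv.1.le, inv_mul_le_iff₀ hv.1] at h1
    change ‖v‖ ≤ R * f v
    linarith
  have hf0 : ∀ v ∈ closure (posLift f Ω), 0 ≤ f v := fun v hv =>
    (mul_nonneg_iff_of_pos_left hR).1 ((norm_nonneg v).trans (hnorm v hv))
  let F : (Fin d → ℝ) →L[ℝ] ℝ := LinearMap.toContinuousLinearMap f
  refine ⟨closure (posLift f Ω), f, ⟨isClosed_closure, zero_mem_closure_of_smul_mem ⟨v₀, hv₀⟩ hsm,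
    add_mem_closure_of_add_mem fun v hv w hw => add_mem_posLift hconv hv hw,
    smul_mem_closure_of_smul_mem ⟨v₀, hv₀⟩ hsm, R * ‖F‖ + 1, by positivity, ?_⟩, ?_, ?_, ?_, ?_, ?_, R, hnorm⟩
  · intro u v hu hvu
    have h1 : f u ≤ f v := by
      have := hf0 _ hvu
      rw [map_sub] at this
      linarith
    have h2 : f v ≤ ‖F‖ * ‖v‖ := (le_abs_self _).trans (F.le_opNorm v)
    calc ‖u‖ ≤ R * f u := hnorm u hu
      _ ≤ R * (‖F‖ * ‖v‖) := by gcongr; exact h1.trans h2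
      _ ≤ (R * ‖F‖ + 1) * ‖v‖ := by nlinarith [norm_nonneg v]
  · intro v hv hv0
    have := hnorm v hv
    have := norm_pos_iff.2 hv0
    exact (mul_pos_iff_of_pos_left hR).1 (by linarith)
  · intro v p hvp
    rw [hint, ← hvp.mem_liftSet, liftSet_eq_union hf]
    rfl
  · intro v p hvp
    rw [hvp.mem_closure_iff, liftSet_eq_union hf, closure_union, ← neg_closure]
    rfl
  · rw [hint]
    exact ⟨v₀, hv₀⟩
  · rw [hint]
    exact fun h0 => h0.1.ne' (map_zero f)

end ConvexProjective

/-! ### Open faces as comparability classes -/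

namespace ConvexProjective

open OrderedCone Filter

variable {d : ℕ}

section Lifts

variable {v w : Fin d → ℝ} {p q : ProjSpace d} {A : Set (ProjSpace d)}

lemma Lifts.submodule_eq (h : Lifts v p) : p.submodule = Submodule.span ℝ {v} := by
  obtain ⟨hv, rfl⟩ := h
  rw [Projectivization.submodule_mk]

lemma Lifts.linearIndependent (h : Lifts v p) (h' : Lifts w q) (hpq : p ≠ q) :
    LinearIndependent ℝ ![v, w] := by
  rw [LinearIndependent.pair_iff]
  intro a b hab
  by_cases ha : a = 0
  · subst ha
    rw [zero_smul, zero_add, smul_eq_zero] at hab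
    exact ⟨rfl, hab.resolve_right h'.ne_zero⟩
  · exfalso
    have h1 : v = (-(a⁻¹ * b)) • w := by
      have := congrArg (fun x => a⁻¹ • x) hab
      simp only [smul_add, smul_smul, inv_mul_cancel₀ ha, one_smul, smul_zero] at this
      rw [neg_smul]
      exact eq_neg_of_add_eq_zero_left this
    have hb : -(a⁻¹ * b) ≠ 0 := by
      rintro hb
      rw [hb, zero_smul] at h1
      exact h.ne_zero h1
    exact hpq (h.eq (h1 ▸ h'.smul hb))

lemma linearIndependent_pair_ne_zero (h : LinearIndependent ℝ ![v, w]) {a b : ℝ} (ha : a ≠ 0) :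
    a • v + b • w ≠ 0 := fun h0 => ha (LinearIndependent.pair_iff.1 h a b h0).1

/-- If `Q` is a convex cone over a subset of the closure of `A` that contains `M X - Y` and
`M Y - X` for some `M > 1`, then `[Y]` lies in the open face of `[X]`. -/
lemma mem_openFace_of_sub_mem {Q : Set (Fin d → ℝ)} (hadd : ∀ u ∈ Q, ∀ v ∈ Q, u + v ∈ Q)
    (hsmul : ∀ c : ℝ, 0 ≤ c → ∀ v ∈ Q, c • v ∈ Q)
    (hQ : ∀ v ∈ Q, ∀ p, Lifts v p → p ∈ closure A) (h : Lifts v p) (h' : Lifts w q) {M : ℝ}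
    (hM : 1 < M) (h1 : M • v - w ∈ Q) (h2 : M • w - v ∈ Q) : q ∈ openFace A p := by
  by_cases hpq : p = q
  · exact Or.inl hpq.symm
  have hli := h.linearIndependent h' hpq
  have hM2 : 0 < M ^ 2 - 1 := by nlinarith
  have hw : w ∈ Q := by
    have := hsmul (M ^ 2 - 1)⁻¹ (inv_pos.2 hM2).le _ (hadd _ h1 _ (hsmul M (by linarith) _ h2))
    convert this using 1
    rw [eq_inv_smul_iff₀ hM2.ne']
    module
  refine Or.inr ⟨hQ w hw q h', M • v - w, M • w - v, ?_, ?_, ?_, ?_⟩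
  · rw [LinearIndependent.pair_iff] at hli ⊢
    intro a b hab
    obtain ⟨e1, e2⟩ := hli (a * M - b) (b * M - a) (by rw [← hab]; module)
    have ha : a * (M ^ 2 - 1) = 0 := by linear_combination M * e1 + e2
    have ha' : a = 0 := (mul_eq_zero.1 ha).resolve_right hM2.ne'
    subst ha'
    exact ⟨rfl, by linarith⟩
  · rintro r ⟨s, hs, hr⟩
    exact hQ _ (hadd _ h1 _ (hsmul s hs.le _ h2)) r hr
  · refine ⟨M⁻¹, by positivity, ?_⟩
    have hM0 : M ≠ 0 := by positivity
    have e : M • v - w + M⁻¹ • (M • w - v) = (M - M⁻¹) • v := by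
      rw [smul_sub, smul_smul, inv_mul_cancel₀ hM0]
      module
    rw [e]
    refine h.smul (sub_pos.2 ?_).ne'
    exact (inv_lt_one_of_one_lt₀ hM).trans hM
  · refine ⟨M, by positivity, ?_⟩
    have e : M • v - w + M • (M • w - v) = (M ^ 2 - 1) • w := by module
    rw [e]
    exact h'.smul hM2.ne'

end Lifts

/-- The open face of the point represented by `X`, in terms of the cone `K`. -/
def coneFace (K : Set (Fin d → ℝ)) (X : Fin d → ℝ) : Set (ProjSpace d) :=
  {p | ∃ Y ∈ K, Lifts Y p ∧ ConeComparable K Y X}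

namespace IsConeOver

variable {Ω : Set (ProjSpace d)} {K : Set (Fin d → ℝ)} {f : (Fin d → ℝ) →ₗ[ℝ] ℝ}
  (h : IsConeOver Ω K f) {p q x y : ProjSpace d} {X Y Z : Fin d → ℝ}

include h

lemma nonneg {v : Fin d → ℝ} (hv : v ∈ K) : 0 ≤ f v := by
  by_cases h0 : v = 0
  · rw [h0, map_zero]
  · exact (h.pos v hv h0).le

lemma eq_zero_of_neg_mem (hX : X ∈ K) (hX' : -X ∈ K) : X = 0 := by
  by_contra h0
  have h1 := h.pos X hX h0
  have h2 := h.nonneg hX'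
  rw [map_neg] at h2
  linarith

lemma pos_of_smul_mem (hX : X ∈ K) (hX0 : X ≠ 0) {c : ℝ} (hc : c • X ∈ K) (hc0 : c ≠ 0) : 0 < c := by
  have h1 := h.pos X hX hX0
  have h2 := h.pos _ hc (smul_ne_zero hc0 hX0)
  rw [map_smul, smul_eq_mul] at h2
  exact (mul_pos_iff_of_pos_right h1).1 h2

lemma nonneg_of_smul_mem (hX : X ∈ K) (hX0 : X ≠ 0) {c : ℝ} (hc : c • X ∈ K) : 0 ≤ c := by
  by_cases hc0 : c = 0
  · exact hc0.ge
  · exact (h.pos_of_smul_mem hX hX0 hc hc0).le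

lemma exists_lift_interior (hp : p ∈ Ω) : ∃ v ∈ interior K, Lifts v p := by
  obtain ⟨v, hv⟩ := exists_lifts p
  rcases (h.mem_iff v p hv).1 hp with h1 | h1
  exacts [⟨v, h1, hv⟩, ⟨-v, h1, hv.neg⟩]

lemma exists_lift_cone (hp : p ∈ closure Ω) : ∃ v ∈ K, Lifts v p := by
  obtain ⟨v, hv⟩ := exists_lifts p
  rcases (h.mem_closure_iff v p hv).1 hp with h1 | h1
  exacts [⟨v, h1, hv⟩, ⟨-v, h1, hv.neg⟩]

lemma mem_iff_of_mem (hX : X ∈ K) (hXp : Lifts X p) : p ∈ Ω ↔ X ∈ interior K := by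
  rw [h.mem_iff X p hXp]
  refine or_iff_left fun h1 => hXp.ne_zero (h.eq_zero_of_neg_mem hX (interior_subset h1))

lemma exists_pos_smul_eq (hX : X ∈ K) (hY : Y ∈ K) (hXp : Lifts X p) (hYp : Lifts Y p) :
    ∃ c : ℝ, 0 < c ∧ Y = c • X := by
  obtain ⟨c, hc, rfl⟩ := hXp.exists_smul_eq hYp
  exact ⟨c, h.pos_of_smul_mem hX hXp.ne_zero hY hc, rfl⟩

lemma comparable_iff_mem_interior (hX : X ∈ interior K) :
    ConeComparable K Y X ↔ Y ∈ interior K := by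
  constructor
  · rintro ⟨M, hM, h1, h2⟩
    have h3 := h.cone.smul_mem_interior (h.cone.mem_interior_of_sub_mem hX h2) (inv_pos.2 hM)
    rwa [smul_smul, inv_mul_cancel₀ hM.ne', one_smul] at h3
  · intro hY
    obtain ⟨M, hM, h1⟩ := h.cone.exists_smul_sub_mem_interior hX Y
    obtain ⟨N, hN, h2⟩ := h.cone.exists_smul_sub_mem_interior hY X
    exact ConeComparable.of_sub_mem h.cone (interior_subset hY) (interior_subset hX)
      (interior_subset h1) (interior_subset h2)

lemma eq_coneFace (hX : X ∈ interior K) : Ω = coneFace K X := by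
  ext p
  constructor
  · intro hp
    obtain ⟨v, hv, hvp⟩ := h.exists_lift_interior hp
    exact ⟨v, interior_subset hv, hvp, (h.comparable_iff_mem_interior hX).2 hv⟩
  · rintro ⟨v, hv, hvp, hvX⟩
    exact (h.mem_iff v p hvp).2 (Or.inl ((h.comparable_iff_mem_interior hX).1 hvX))

omit h in
lemma coneFace_congr (hK : IsNormalCone K) (hXY : ConeComparable K X Y) :
    coneFace K X = coneFace K Y := by
  ext p
  exact ⟨fun ⟨Z, hZ, hZp, hZX⟩ => ⟨Z, hZ, hZp, hZX.trans hK hXY⟩,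
    fun ⟨Z, hZ, hZp, hZX⟩ => ⟨Z, hZ, hZp, hZX.trans hK hXY.symm⟩⟩

/-- The lifts v + r w of a segment in the closure never vanish under f, so they have one sign. The
limits r → 0 and r → ∞ put both end vectors in K up to a common sign, and positive combinations of
two vectors of K are comparable. Conversely, for M large the vectors M X - Y and M Y - X are end
points of a suitable segment. -/
lemma openFace_eq (hX : X ∈ K) (hXx : Lifts X x) : openFace Ω x = coneFace K X := by
  ext y
  constructor
  · rintro (rfl | ⟨hy, v, w, hvw, hseg, ⟨s, hs, hxs⟩, t, ht, hyt⟩)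
    · exact ⟨X, hX, hXx, ConeComparable.refl h.cone X⟩
    have hne : ∀ r : ℝ, v + r • w ≠ 0 := fun r => by
      simpa using linearIndependent_pair_ne_zero hvw (one_ne_zero) (b := r)
    have hpm : ∀ r : ℝ, 0 < r → v + r • w ∈ K ∨ -(v + r • w) ∈ K := fun r hr =>
      (h.mem_closure_iff _ _ (lifts_mk (hne r))).1 (hseg ⟨r, hr, lifts_mk (hne r)⟩)
    have hf0 : ∀ r : ℝ, 0 < r → f (v + r • w) ≠ 0 := fun r hr => by
      rcases hpm r hr with h1 | h1
      · exact (h.pos _ h1 (hne r)).ne'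
      · have := h.pos _ h1 (neg_ne_zero.2 (hne r))
        rw [map_neg] at this
        exact (neg_pos.1 this).ne
    have key : ∀ v w : Fin d → ℝ, (∀ r : ℝ, 0 < r → v + r • w ∈ K) → v ∈ K ∧ w ∈ K := by
      intro v w hr
      constructor
      · have h1 : Tendsto (fun r : ℝ => v + r • w) (𝓝[>] 0) (𝓝 (v + (0 : ℝ) • w)) :=
          ((continuous_const.add (continuous_id.smul continuous_const)).tendsto' 0 _ rfl).mono_left
            nhdsWithin_le_nhds
        rw [zero_smul, add_zero] at h1
        exact h.cone.isClosed.mem_of_tendsto h1 (by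
          filter_upwards [self_mem_nhdsWithin] with r hr0
          exact hr r hr0)
      · have h1 : Tendsto (fun r : ℝ => r • v + w) (𝓝[>] 0) (𝓝 ((0 : ℝ) • v + w)) :=
          (((continuous_id.smul continuous_const).add continuous_const).tendsto' 0 _ rfl).mono_left
            nhdsWithin_le_nhds
        rw [zero_smul, zero_add] at h1
        refine h.cone.isClosed.mem_of_tendsto h1 ?_
        filter_upwards [self_mem_nhdsWithin] with r hr0
        have hr0 : (0 : ℝ) < r := hr0
        have := h.cone.smul_mem r hr0.le _ (hr r⁻¹ (inv_pos.2 hr0))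
        rwa [smul_add, smul_smul, mul_inv_cancel₀ hr0.ne', one_smul] at this
    have fin : ∀ v w : Fin d → ℝ, (∀ r : ℝ, 0 < r → v + r • w ∈ K) → Lifts (v + s • w) x →
        Lifts (v + t • w) y → y ∈ coneFace K X := by
      intro v w hr hx hy
      obtain ⟨hv, hw⟩ := key v w hr
      obtain ⟨c, hc, hcX⟩ := h.exists_pos_smul_eq hX (hr s hs) hXx hx
      have main : ∀ a b : ℝ, 0 < a → 0 < b →
          (1 + b / a) • (v + a • w) - (v + b • w) ∈ K := fun a b ha hb => by
        have e : (1 + b / a) • (v + a • w) - (v + b • w) = (b / a) • v + a • w := by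
          have : b / a * a = b := div_mul_cancel₀ b ha.ne'
          rw [add_smul, one_smul, smul_add, smul_smul, this]
          abel
        rw [e]
        exact h.cone.add_mem _ (h.cone.smul_mem _ (by positivity) _ hv) _
          (h.cone.smul_mem _ ha.le _ hw)
      have h3 := ConeComparable.of_sub_mem h.cone (hr t ht) (hr s hs) (main s t hs ht) (main t s ht hs)
      refine ⟨_, hr t ht, hy, h3.trans h.cone ?_⟩
      rw [hcX]
      exact (ConeComparable.refl h.cone X).smul h.cone hX hX hc
    have hcont : ContinuousOn (fun r : ℝ => f (v + r • w)) (Ioi 0) :=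
      (f.continuous_of_finiteDimensional.comp
        (continuous_const.add (continuous_id.smul continuous_const))).continuousOn
    have hsign : (∀ r : ℝ, 0 < r → 0 < f (v + r • w)) ∨ ∀ r : ℝ, 0 < r → f (v + r • w) < 0 := by
      by_contra! hc
      obtain ⟨⟨a, ha, ha'⟩, b, hb, hb'⟩ := hc
      obtain ⟨r, hr, hr'⟩ := isPreconnected_Ioi.intermediate_value (a := a) (b := b) ha hb hcont
        ⟨ha', hb'⟩
      exact hf0 r hr hr'
    rcases hsign with hsign | hsign
    · refine fin v w (fun r hr => (hpm r hr).resolve_right fun h1 => ?_) hxs hyt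
      have h2 := h.nonneg h1
      rw [map_neg] at h2
      linarith [hsign r hr]
    · refine fin (-v) (-w) (fun r hr => ?_) ?_ ?_
      · have h2 := (hpm r hr).resolve_left fun h1 => absurd (h.nonneg h1) (by linarith [hsign r hr])
        rwa [neg_add, ← smul_neg] at h2
      · convert hxs.neg using 1
        module
      · convert hyt.neg using 1
        module
  · rintro ⟨Y, hY, hYy, M, hM, h1, h2⟩
    refine mem_openFace_of_sub_mem (M := M + 1) h.cone.add_mem h.cone.smul_mem
      (fun v hv p hvp => (h.mem_closure_iff v p hvp).2 (Or.inl hv)) hXx hYy (by linarith)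
      (h.cone.sub_mem_of_le hX (by linarith) h1) (h.cone.sub_mem_of_le hY (by linarith) h2)

end IsConeOver

end ConvexProjective

/-! ### The Hilbert metric in terms of the order -/

namespace ConvexProjective

open OrderedCone Filter

variable {d : ℕ}

/-- The subspace of all vectors that are bounded by multiples of `X`. -/
def orderSpan {K : Set (Fin d → ℝ)} (hK : IsNormalCone K) (X : Fin d → ℝ) :
    Submodule ℝ (Fin d → ℝ) where
  carrier := {y | ∃ M : ℝ, M • X - y ∈ K ∧ M • X + y ∈ K}
  zero_mem' := ⟨0, by simpa using hK.zero_mem, by simpa using hK.zero_mem⟩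
  add_mem' := by
    rintro a b ⟨M, h1, h2⟩ ⟨N, h3, h4⟩
    refine ⟨M + N, ?_, ?_⟩
    · convert hK.add_mem _ h1 _ h3 using 1
      module
    · convert hK.add_mem _ h2 _ h4 using 1
      module
  smul_mem' := by
    rintro c a ⟨M, h1, h2⟩
    rcases le_total 0 c with hc | hc
    · refine ⟨c * M, ?_, ?_⟩
      · convert hK.smul_mem c hc _ h1 using 1
        module
      · convert hK.smul_mem c hc _ h2 using 1
        module
    · refine ⟨-c * M, ?_, ?_⟩
      · convert hK.smul_mem (-c) (neg_nonneg.2 hc) _ h2 using 1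
        module
      · convert hK.smul_mem (-c) (neg_nonneg.2 hc) _ h1 using 1
        module

namespace IsConeOver

variable {Ω : Set (ProjSpace d)} {K : Set (Fin d → ℝ)} {f : (Fin d → ℝ) →ₗ[ℝ] ℝ}
  (h : IsConeOver Ω K f) {p q x y : ProjSpace d} {X Y Z : Fin d → ℝ}

include h

lemma mem_orderSpan (hY : Y ∈ K) (hX : X ∈ K) (hYX : ConeComparable K Y X) :
    Y ∈ orderSpan h.cone X := by
  obtain ⟨M, hM, h1, -⟩ := hYX
  exact ⟨M, h1, h.cone.add_mem _ (h.cone.smul_mem M hM.le _ hX) _ hY⟩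

lemma linSpan_coneFace_le (hX : X ∈ K) : linSpan (coneFace K X) ≤ orderSpan h.cone X := by
  refine iSup₂_le fun p hp => ?_
  obtain ⟨Y, hY, hYp, hYX⟩ := hp
  rw [hYp.submodule_eq, Submodule.span_singleton_le_iff_mem]
  exact h.mem_orderSpan hY hX hYX

lemma coneFace_subset_relInterior (hX : X ∈ K) : coneFace K X ⊆ relInterior (coneFace K X) := by
  intro p hp
  refine ⟨hp, ?_⟩
  obtain ⟨Y, hY, hYp, hYX⟩ := hp
  have hYX' := hYX
  obtain ⟨N, hN, hYN, hXN⟩ := hYX'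
  obtain ⟨C, hC, hCX⟩ := h.cone.exists_norm_smul_sub_mem hX
  -- Within the order span of X, this radius gives ±(Z - Y) ≤ X / (2N) ≤ Y / 2, hence Y / 2 ≤ Z ≤ 3Y
  -- / 2.
  refine ⟨proj (Metric.ball Y (1 / (2 * N * C))), isOpen_proj Metric.isOpen_ball,
    ⟨Y, Metric.mem_ball_self (by positivity), hYp⟩, ?_⟩
  rintro q ⟨Z, hZ, hZq⟩ hq
  have hZW : Z ∈ orderSpan h.cone X := by
    have := hq.trans (h.linSpan_coneFace_le hX)
    rwa [hZq.submodule_eq, Submodule.span_singleton_le_iff_mem] at this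
  have hZY : Z - Y ∈ orderSpan h.cone X := sub_mem hZW (h.mem_orderSpan hY hX hYX)
  rw [mem_ball_iff_norm] at hZ
  have hle : C * ‖Z - Y‖ ≤ 1 / (2 * N) := by
    rw [lt_div_iff₀ (by positivity)] at hZ
    rw [le_div_iff₀ (by positivity)]
    linarith
  have h1 : (1 / (2 * N)) • X - (Z - Y) ∈ K := h.cone.sub_mem_of_le hX hle (hCX _ hZY)
  have h2 : (1 / (2 * N)) • X + (Z - Y) ∈ K := by
    have := hCX _ (neg_mem hZY)
    rw [norm_neg] at this
    have := h.cone.sub_mem_of_le hX hle this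
    rwa [sub_neg_eq_add] at this
  have h3 : (1 / 2 : ℝ) • Y - (1 / (2 * N)) • X ∈ K := by
    have := h.cone.smul_mem (1 / (2 * N)) (by positivity) _ hXN
    rw [smul_sub, smul_smul] at this
    have e : 1 / (2 * N) * N = 1 / 2 := by field_simp
    rwa [e] at this
  have h4 : Z - (1 / 2 : ℝ) • Y ∈ K := by
    convert h.cone.add_mem _ h2 _ h3 using 1
    module
  have hZK : Z ∈ K := by
    convert h.cone.add_mem _ h4 _ (h.cone.smul_mem (1 / 2) (by norm_num) _ hY) using 1
    module
  refine ⟨Z, hZK, hZq, ConeComparable.trans h.cone ?_ hYX⟩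
  refine ConeComparable.of_sub_mem h.cone hZK hY (a := 3 / 2) (b := 2) ?_ ?_
  · convert h.cone.add_mem _ h1 _ h3 using 1
    module
  · convert h.cone.smul_mem 2 (by norm_num) _ h4 using 1
    module

lemma disjoint_bdry_coneFace (hX : X ∈ K) : Disjoint (bdry (coneFace K X)) (coneFace K X) :=
  disjoint_left.2 fun _ hp hp' => hp.2 (h.coneFace_subset_relInterior hX hp')

/-- Solving for the end points expresses a and b by the vectors t l Y - s m Z and m Z - l Y. If t /
s exceeded β / α, one of these would be comparable to Z, so a or b would lie in the face. -/
lemma crossRatio_le {F : Set (ProjSpace d)} (hF : F = coneFace K X) (hY : Y ∈ K)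
    (hZ : Z ∈ K) (hZX : ConeComparable K Z X) (hYp : Lifts Y p) (hZq : Lifts Z q) {α β : ℝ}
    (hα : 0 < α) (h1 : Y - α • Z ∈ K) (h2 : β • Z - Y ∈ K) {a b : ProjSpace d} (ha : a ∉ F)
    (hb : b ∉ F) {c : ℝ} (hc : HasCrossRatio a p q b c) : 0 < c ∧ 1 ≤ c ∧ c ≤ β / α := by
  obtain ⟨v, w, s, t, hvw, hs, hst, hva, hp, hq, hwb, rfl⟩ := hc
  have ht : 0 < t := hs.trans hst
  refine ⟨div_pos ht hs, (one_le_div hs).2 hst.le, ?_⟩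
  have hYZ : ConeComparable K Y Z := by
    refine ConeComparable.of_sub_mem h.cone hY hZ h2 (b := α⁻¹) ?_
    have := h.cone.smul_mem α⁻¹ (inv_pos.2 hα).le _ h1
    rwa [smul_sub, smul_smul, inv_mul_cancel₀ hα.ne', one_smul] at this
  rw [hF, coneFace_congr h.cone (hZX.symm)] at ha hb
  -- normalise the sign of the first coefficient
  have main : ∀ v w : Fin d → ℝ, LinearIndependent ℝ ![v, w] → Lifts v a → Lifts w b → ∀ l m : ℝ,
      0 < l → m ≠ 0 → v + s • w = l • Y → v + t • w = m • Z → t / s ≤ β / α := by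
    intro v w hvw hva hwb l m hl hm hlY hmZ
    have ev : (t - s) • v = (t * l) • Y - (s * m) • Z := by
      rw [mul_smul, mul_smul, ← hlY, ← hmZ]
      module
    have ew : (t - s) • w = m • Z - l • Y := by
      rw [← hlY, ← hmZ]
      module
    have hts : 0 < t - s := sub_pos.2 hst
    have hva' : Lifts ((t * l) • Y - (s * m) • Z) a := ev ▸ hva.smul hts.ne'
    have hwb' : Lifts (m • Z - l • Y) b := ew ▸ hwb.smul hts.ne'
    have hm0 : 0 < m := by
      rcases lt_or_gt_of_ne hm with hm | hm
      · exfalso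
        refine ha ⟨_, ?_, hva', ?_⟩
        · rw [sub_eq_add_neg, ← neg_smul]
          exact h.cone.add_mem _ (h.cone.smul_mem _ (by positivity) _ hY) _
            (h.cone.smul_mem _ (by nlinarith) _ hZ)
        · obtain ⟨M, hM, g1, g2⟩ := hYZ
          have hsm : 0 < -(s * m) := by nlinarith
          refine ConeComparable.of_sub_mem h.cone (a := t * l * M - s * m) (b := (-(s * m))⁻¹) ?_ hZ
            ?_ ?_
          · rw [sub_eq_add_neg, ← neg_smul]
            exact h.cone.add_mem _ (h.cone.smul_mem _ (by positivity) _ hY) _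
              (h.cone.smul_mem _ hsm.le _ hZ)
          · convert h.cone.smul_mem (t * l) (by positivity) _ g1 using 1
            module
          · convert h.cone.smul_mem ((-(s * m))⁻¹ * (t * l)) (by positivity) _ hY using 1
            rw [smul_sub, smul_smul, smul_smul, sub_sub, sub_eq_iff_eq_add]
            have : (-(s * m))⁻¹ * (s * m) = -1 := by
              rw [inv_neg, neg_mul, inv_mul_cancel₀ (by nlinarith)]
            rw [this]
            module
      · exact hm
    by_contra! hlt
    rw [div_lt_div_iff₀ hα hs] at hlt
    -- either `v` or `w` represents a point of the face
    by_cases hcase : s * m < t * l * α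
    · refine ha ⟨_, ?_, hva', ?_⟩
      · convert h.cone.add_mem _ (h.cone.smul_mem (t * l) (by positivity) _ h1) _
          (h.cone.smul_mem (t * l * α - s * m) (by linarith) _ hZ) using 1
        module
      · refine ConeComparable.of_sub_mem h.cone (a := t * l * β) (b := (t * l * α - s * m)⁻¹) ?_ hZ
          ?_ ?_
        · convert h.cone.add_mem _ (h.cone.smul_mem (t * l) (by positivity) _ h1) _
            (h.cone.smul_mem (t * l * α - s * m) (by linarith) _ hZ) using 1
          module
        · convert h.cone.add_mem _ (h.cone.smul_mem (t * l) (by positivity) _ h2) _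
            (h.cone.smul_mem (s * m) (by positivity) _ hZ) using 1
          module
        · have e0 : 0 < t * l * α - s * m := by linarith
          have e1 := h.cone.smul_mem ((t * l * α - s * m)⁻¹ * (t * l)) (by positivity) _ h1
          convert e1 using 1
          have e2 : (t * l * α - s * m)⁻¹ * (t * l * α - s * m) = 1 := inv_mul_cancel₀ e0.ne'
          calc _ = ((t * l * α - s * m)⁻¹ * (t * l)) • Y
                - ((t * l * α - s * m)⁻¹ * (s * m) + 1) • Z := by module
            _ = _ := by
                rw [← e2]
                module
    · have hcase' : l * β < m := by
        by_contra! hle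
        have e1 : t * l * α ≤ s * (l * β) := (not_lt.1 hcase).trans (by gcongr)
        nlinarith
      have hwK : m • Z - l • Y ∈ K := by
        convert h.cone.add_mem _ (h.cone.smul_mem l hl.le _ h2) _
          (h.cone.smul_mem (m - l * β) (by linarith) _ hZ) using 1
        module
      refine hb ⟨_, hwK, hwb', ?_⟩
      refine ConeComparable.of_sub_mem h.cone (a := m) (b := (m - l * β)⁻¹) hwK hZ ?_ ?_
      · convert h.cone.smul_mem l hl.le _ hY using 1
        module
      · have e0 : 0 < m - l * β := by linarith
        have e1 := h.cone.smul_mem ((m - l * β)⁻¹ * l) (by positivity) _ h2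
        convert e1 using 1
        have e2 : (m - l * β)⁻¹ * (m - l * β) = 1 := inv_mul_cancel₀ e0.ne'
        calc _ = ((m - l * β)⁻¹ * m - 1) • Z - ((m - l * β)⁻¹ * l) • Y := by module
          _ = _ := by
              rw [← e2]
              module
  obtain ⟨l, hl, hlY⟩ := hYp.exists_smul_eq hp
  obtain ⟨m, hm, hmZ⟩ := hZq.exists_smul_eq hq
  rcases lt_or_gt_of_ne hl with hl' | hl'
  · refine main (-v) (-w) ?_ hva.neg hwb.neg (-l) (-m) (by linarith) (neg_ne_zero.2 hm) ?_ ?_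
    · rw [LinearIndependent.pair_iff] at hvw ⊢
      intro a b hab
      obtain ⟨e1, e2⟩ := hvw (-a) (-b) (by rw [← hab]; module)
      exact ⟨neg_eq_zero.1 e1, neg_eq_zero.1 e2⟩
    · rw [neg_smul, ← hlY]
      module
    · rw [neg_smul, ← hmZ]
      module
  · exact main v w hvw hva hwb l m hl' hm hlY hmZ

lemma log_crossRatio_mem_upperBounds {F : Set (ProjSpace d)} (hX : X ∈ K) (hF : F = coneFace K X)
    (hY : Y ∈ K) (hZ : Z ∈ K) (hZX : ConeComparable K Z X) (hYp : Lifts Y p) (hZq : Lifts Z q)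
    {α β : ℝ} (hα : 0 < α) (h1 : Y - α • Z ∈ K) (h2 : β • Z - Y ∈ K) :
    (1 / 2) * Real.log (β / α) ∈ upperBounds {r | ∃ a ∈ bdry F, ∃ b ∈ bdry F, ∃ c,
      HasCrossRatio a p q b c ∧ r = (1 / 2) * Real.log c} := by
  rintro r ⟨a, ha, b, hb, c, hc, rfl⟩
  have hdis : ∀ a ∈ bdry F, a ∉ F := fun a ha => by
    rw [hF] at ha ⊢
    exact disjoint_left.1 (h.disjoint_bdry_coneFace hX) ha
  obtain ⟨g1, -, g2⟩ := h.crossRatio_le hF hY hZ hZX hYp hZq hα h1 h2 (hdis a ha) (hdis b hb) hc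
  have := Real.log_le_log g1 g2
  linarith

lemma le_of_sub_mem (hZ : Z ∈ K) (hZ0 : Z ≠ 0) {α β : ℝ} (h1 : Y - α • Z ∈ K)
    (h2 : β • Z - Y ∈ K) : α ≤ β := by
  have := h.cone.add_mem _ h1 _ h2
  rw [sub_add_sub_comm, add_comm Y, add_sub_add_right_eq_sub, ← sub_smul] at this
  exact sub_nonneg.1 (h.nonneg_of_smul_mem hZ hZ0 this)

/-- An order estimate bounds every admissible cross ratio. Non-negativity of the bound also covers
coincident points, where the supremum is over the empty set and equals 0. -/
lemma hilbertDist_le {F : Set (ProjSpace d)} (hX : X ∈ K) (hF : F = coneFace K X)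
    (hY : Y ∈ K) (hZ : Z ∈ K) (hZX : ConeComparable K Z X) (hYp : Lifts Y p) (hZq : Lifts Z q)
    {α β : ℝ} (hα : 0 < α) (h1 : Y - α • Z ∈ K) (h2 : β • Z - Y ∈ K) :
    hilbertDist F p q ≤ (1 / 2) * Real.log (β / α) := by
  refine Real.sSup_le (h.log_crossRatio_mem_upperBounds hX hF hY hZ hZX hYp hZq hα h1 h2) ?_
  have := Real.log_nonneg ((one_le_div hα).2 (h.le_of_sub_mem hZ hZq.ne_zero h1 h2))
  linarith

omit h in
lemma hilbertDist_nonneg (F : Set (ProjSpace d)) (p q : ProjSpace d) : 0 ≤ hilbertDist F p q := by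
  refine Real.sSup_nonneg ?_
  rintro r ⟨a, ha, b, hb, c, ⟨v, w, s, t, -, hs, hst, -, -, -, -, rfl⟩, rfl⟩
  have := Real.log_nonneg ((one_le_div hs).2 hst.le)
  linarith

lemma mem_bdry (hX : X ∈ K) (hX' : X ∉ interior K) (hXp : Lifts X p) : p ∈ bdry Ω :=
  ⟨(h.mem_closure_iff X p hXp).2 (Or.inl hX),
    fun hp => hX' ((h.mem_iff_of_mem hX hXp).1 hp.1)⟩

/-- The extremal coefficients for the order between two interior points compute the Hilbert
distance. -/
lemma exists_le_hilbertDist (hY : Y ∈ interior K) (hZ : Z ∈ interior K) (hYp : Lifts Y p)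
    (hZq : Lifts Z q) : ∃ α β : ℝ, 0 < α ∧ α ≤ β ∧ Y - α • Z ∈ K ∧ β • Z - Y ∈ K ∧
      (1 / 2) * Real.log (β / α) ≤ hilbertDist Ω p q := by
  have hYK := interior_subset hY
  have hZK := interior_subset hZ
  obtain ⟨M, hM, h1⟩ := h.cone.exists_smul_sub_mem_interior hY Z
  obtain ⟨N, hN, h2⟩ := h.cone.exists_smul_sub_mem_interior hZ Y
  have h2' : N • Z - Y ∈ K := interior_subset h2
  have hM' : Y - M⁻¹ • Z ∈ K := by
    have := h.cone.smul_mem M⁻¹ (inv_pos.2 hM).le _ (interior_subset h1)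
    rwa [smul_sub, smul_smul, inv_mul_cancel₀ hM.ne', one_smul] at this
  -- the largest and the smallest coefficient
  let A : Set ℝ := {a | Y - a • Z ∈ K}
  let B : Set ℝ := {b | b • Z - Y ∈ K}
  have hA : IsClosed A :=
    h.cone.isClosed.preimage (continuous_const.sub (continuous_id.smul continuous_const))
  have hB : IsClosed B :=
    h.cone.isClosed.preimage ((continuous_id.smul continuous_const).sub continuous_const)
  have hAB : ∀ a ∈ A, ∀ b ∈ B, a ≤ b := fun a ha b hb => h.le_of_sub_mem hZK hZq.ne_zero ha hb
  have hAb : BddAbove A := ⟨N, fun a ha => hAB a ha N h2'⟩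
  have hBb : BddBelow B := ⟨M⁻¹, fun b hb => hAB _ hM' b hb⟩
  have hα := hA.csSup_mem ⟨_, hM'⟩ hAb
  have hβ := hB.csInf_mem ⟨_, h2'⟩ hBb
  have hα0 : 0 < sSup A := (inv_pos.2 hM).trans_le (le_csSup hAb hM')
  set α := sSup A with hαdef
  set β := sInf B with hβdef
  have hαβ := hAB α hα β hβ
  have hα1 : Y - α • Z ∈ K := hα
  have hβ1 : β • Z - Y ∈ K := hβ
  -- Extremality of α and β places the two end vectors on the boundary of K.
  have hαi : Y - α • Z ∉ interior K := fun hi => by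
    obtain ⟨R, hR, h3⟩ := h.cone.exists_smul_sub_mem_interior hi Z
    have : α + R⁻¹ ∈ A := by
      have := h.cone.smul_mem R⁻¹ (inv_pos.2 hR).le _ (interior_subset h3)
      rw [smul_sub, smul_smul, inv_mul_cancel₀ hR.ne', one_smul] at this
      change Y - (α + R⁻¹) • Z ∈ K
      rwa [add_smul, ← sub_sub]
    have := le_csSup hAb this
    have := inv_pos.2 hR
    linarith
  have hβi : β • Z - Y ∉ interior K := fun hi => by
    obtain ⟨R, hR, h3⟩ := h.cone.exists_smul_sub_mem_interior hi Z
    have : β - R⁻¹ ∈ B := by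
      have := h.cone.smul_mem R⁻¹ (inv_pos.2 hR).le _ (interior_subset h3)
      rw [smul_sub, smul_smul, inv_mul_cancel₀ hR.ne', one_smul] at this
      change (β - R⁻¹) • Z - Y ∈ K
      convert this using 1
      module
    have := csInf_le hBb this
    have := inv_pos.2 hR
    linarith
  refine ⟨α, β, hα0, hαβ, hα, hβ, ?_⟩
  rcases hαβ.eq_or_lt with heq | hlt
  · rw [← heq, div_self hα0.ne', Real.log_one, mul_zero]
    exact hilbertDist_nonneg _ _ _
  have hβ0 : 0 < β := hα0.trans hlt
  have hne : ∀ c : ℝ, Y ≠ c • Z := fun c hc => by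
    rw [hc, ← sub_smul] at hαi
    rw [hc, ← sub_smul] at hβi
    have e1 : c - α ≤ 0 := by
      by_contra! hpos
      exact hαi (h.cone.smul_mem_interior hZ hpos)
    have e2 : β - c ≤ 0 := by
      by_contra! hpos
      exact hβi (h.cone.smul_mem_interior hZ hpos)
    linarith
  have hv0 : Y - α • Z ≠ 0 := fun h0 => hne α (sub_eq_zero.1 h0)
  have hw0 : β • Z - Y ≠ 0 := fun h0 => hne β (sub_eq_zero.1 h0).symm
  -- With these end vectors, p and q have parameters α / β and 1 on the segment, so the cross ratio
  -- is β / α.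
  refine le_csSup ⟨_, h.log_crossRatio_mem_upperBounds hYK (h.eq_coneFace hY) hYK hZK
    ((h.comparable_iff_mem_interior hY).2 hZ) hYp hZq hα0 hα hβ⟩
    ⟨_, h.mem_bdry hα hαi (lifts_mk hv0), _, h.mem_bdry hβ hβi (lifts_mk hw0), β / α,
      ⟨Y - α • Z, β • Z - Y, α / β, 1, ?_, by positivity, (div_lt_one hβ0).2 hlt, lifts_mk hv0, ?_, ?_,
        lifts_mk hw0, by rw [one_div_div]⟩, rfl⟩
  · rw [LinearIndependent.pair_iff]
    intro a b hab
    have e : (a - b) • Y = (a * α - b * β) • Z := by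
      rw [← sub_eq_zero, ← hab]
      module
    by_cases hab' : a - b = 0
    · have hb : b = a := (sub_eq_zero.1 hab').symm
      subst hb
      rw [hab', zero_smul, ← mul_sub] at e
      have e3 := (smul_eq_zero.1 e.symm).resolve_right hZq.ne_zero
      have e4 := (mul_eq_zero.1 e3).resolve_right (sub_ne_zero.2 hlt.ne)
      exact ⟨e4, e4⟩
    · exfalso
      refine hne ((a - b)⁻¹ * (a * α - b * β)) ?_
      rw [mul_smul, ← e, smul_smul, inv_mul_cancel₀ hab', one_smul]
  · have e : Y - α • Z + (α / β) • (β • Z - Y) = (1 - α / β) • Y := by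
      rw [smul_sub, smul_smul, div_mul_cancel₀ _ hβ0.ne']
      module
    rw [e]
    exact hYp.smul (sub_pos.2 ((div_lt_one hβ0).2 hlt)).ne'
  · have e : Y - α • Z + (1 : ℝ) • (β • Z - Y) = (β - α) • Z := by module
    rw [e]
    exact hZq.smul (sub_pos.2 hlt).ne'

end IsConeOver

end ConvexProjective

/-! ### Linear lifts of the group and the cone over the core -/

namespace ConvexProjective

open OrderedCone Filter

variable {d : ℕ}

/-- The cone over `C` inside the interior of `K`. -/
def coneOver (K : Set (Fin d → ℝ)) (C : Set (ProjSpace d)) : Set (Fin d → ℝ) :=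
  {v | v ∈ interior K ∧ ∃ p ∈ C, Lifts v p}

/-- The linear equivalences that preserve the interior of `K` and represent elements of `Λ`. -/
def linearLifts (K : Set (Fin d → ℝ)) (Λ : Subgroup PGL(Fin d, ℝ)) :
    Set ((Fin d → ℝ) ≃L[ℝ] (Fin d → ℝ)) :=
  {e | (∀ v, e v ∈ interior K ↔ v ∈ interior K) ∧
    ∃ g ∈ Λ, ∀ v p, Lifts v p → Lifts (e v) (g • p)}

lemma exists_linearEquiv (g : PGL(Fin d, ℝ)) : ∃ e : (Fin d → ℝ) ≃L[ℝ] (Fin d → ℝ),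
    ∀ v p, Lifts v p → Lifts (e v) (g • p) := by
  obtain ⟨A, rfl⟩ := Matrix.ProjGenLinGroup.mk_surjective g
  refine ⟨(DistribMulAction.toLinearEquiv ℝ (Fin d → ℝ) A).toContinuousLinearEquiv, ?_⟩
  rintro v p ⟨hv, rfl⟩
  rw [Matrix.ProjGenLinGroup.mk_smul, Projectivization.smul_mk]
  exact ⟨_, rfl⟩

/-- Multiplication by a nonzero scalar. -/
def scaling {c : ℝ} (hc : c ≠ 0) : (Fin d → ℝ) ≃L[ℝ] (Fin d → ℝ) :=
  (LinearEquiv.smulOfNeZero ℝ (Fin d → ℝ) c hc).toContinuousLinearEquiv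

lemma scaling_apply {c : ℝ} (hc : c ≠ 0) (v : Fin d → ℝ) : scaling hc v = c • v := rfl

namespace IsConeOver

variable {Ω C : Set (ProjSpace d)} {K : Set (Fin d → ℝ)} {f : (Fin d → ℝ) →ₗ[ℝ] ℝ}
  (h : IsConeOver Ω K f) {p q x y : ProjSpace d} {X Y Z : Fin d → ℝ} {Λ : Subgroup PGL(Fin d, ℝ)}

include h

lemma ne_zero (hX : X ∈ interior K) : X ≠ 0 := fun h0 => h.zero_notMem (h0 ▸ hX)

lemma mem_domain (hX : X ∈ interior K) (hXp : Lifts X p) : p ∈ Ω := (h.mem_iff X p hXp).2 (Or.inl hX)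

lemma convex : Convex ℝ K := by
  intro u hu v hv a b ha hb _
  exact h.cone.add_mem _ (h.cone.smul_mem a ha _ hu) _ (h.cone.smul_mem b hb _ hv)

lemma closure_interior : closure (interior K) = K := by
  rw [h.convex.closure_interior_eq_closure_of_nonempty_interior h.nonempty,
    h.cone.isClosed.closure_eq]

lemma add_mem_interior (hX : X ∈ interior K) (hY : Y ∈ K) : X + Y ∈ interior K :=
  h.cone.mem_interior_of_sub_mem hX (by rwa [add_sub_cancel_left])

/-- A matrix of g maps the interior of K into itself or its negative at each point. By connectedness
of the interior the sign is constant, and -1 corrects it. -/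
lemma exists_linearLift (g : PGL(Fin d, ℝ)) (hg : g • Ω = Ω) :
    ∃ e : (Fin d → ℝ) ≃L[ℝ] (Fin d → ℝ), (∀ v, e v ∈ interior K ↔ v ∈ interior K) ∧
      ∀ v p, Lifts v p → Lifts (e v) (g • p) := by
  obtain ⟨e, he⟩ := exists_linearEquiv g
  have hpm : ∀ v ∈ interior K, e v ∈ interior K ∨ -e v ∈ interior K := fun v hv => by
    have h1 := lifts_mk (h.ne_zero hv)
    refine (h.mem_iff _ _ (he _ _ h1)).1 ?_
    exact hg.subset (smul_mem_smul_set (h.mem_domain hv h1))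
  have fin : ∀ e : (Fin d → ℝ) ≃L[ℝ] (Fin d → ℝ), (∀ v p, Lifts v p → Lifts (e v) (g • p)) →
      (∀ v ∈ interior K, e v ∈ interior K) → ∀ v, e v ∈ interior K ↔ v ∈ interior K := by
    intro e he hv v
    refine ⟨fun h1 => ?_, hv v⟩
    have hv0 : v ≠ 0 := by
      rintro rfl
      rw [map_zero] at h1
      exact h.zero_notMem h1
    have h2 := lifts_mk hv0
    have h3 := h.mem_domain h1 (he _ _ h2)
    rw [← hg, smul_mem_smul_set_iff] at h3
    refine ((h.mem_iff _ _ h2).1 h3).resolve_right fun h4 => hv0 ?_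
    have h5 := hv _ h4
    rw [map_neg] at h5
    have := h.eq_zero_of_neg_mem (interior_subset h1) (interior_subset h5)
    exact e.map_eq_zero_iff.1 this
  have hf0 : ∀ v ∈ interior K, f (e v) ≠ 0 := fun v hv => by
    rcases hpm v hv with h1 | h1
    · exact (h.pos _ (interior_subset h1) (h.ne_zero h1)).ne'
    · have := h.pos _ (interior_subset h1) (h.ne_zero h1)
      rw [map_neg] at this
      exact (neg_pos.1 this).ne
  have hsign : (∀ v ∈ interior K, 0 < f (e v)) ∨ ∀ v ∈ interior K, f (e v) < 0 := by
    by_contra! hc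
    obtain ⟨⟨a, ha, ha'⟩, b, hb, hb'⟩ := hc
    obtain ⟨r, hr, hr'⟩ := h.convex.interior.isPreconnected.intermediate_value (f := fun v => f (e v))
      ha hb (f.continuous_of_finiteDimensional.comp e.continuous).continuousOn ⟨ha', hb'⟩
    exact hf0 r hr hr'
  rcases hsign with hsign | hsign
  · refine ⟨e, fin e he fun v hv => (hpm v hv).resolve_right fun h1 => ?_, he⟩
    have h2 := h.nonneg (interior_subset h1)
    rw [map_neg] at h2
    linarith [hsign v hv]
  · have hn : (-1 : ℝ) ≠ 0 := by norm_num
    have hap : ∀ v, e.trans (scaling hn) v = -e v := fun v => by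
      rw [ContinuousLinearEquiv.trans_apply, scaling_apply, neg_one_smul]
    have he' : ∀ v p, Lifts v p → Lifts (e.trans (scaling hn) v) (g • p) := fun v p hvp => by
      rw [hap]
      exact (he v p hvp).neg
    refine ⟨e.trans (scaling hn), fin _ he' fun v hv => ?_, he'⟩
    rw [hap]
    exact (hpm v hv).resolve_left fun h1 => absurd (h.nonneg (interior_subset h1))
      (by linarith [hsign v hv])

lemma smul_mem_linearLifts {e : (Fin d → ℝ) ≃L[ℝ] (Fin d → ℝ)} (he : e ∈ linearLifts K Λ) {c : ℝ}
    (hc : 0 < c) : e.trans (scaling hc.ne') ∈ linearLifts K Λ := by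
  obtain ⟨h1, g, hg, h2⟩ := he
  refine ⟨fun v => ?_, g, hg, fun v p hvp => ?_⟩
  · rw [ContinuousLinearEquiv.trans_apply, scaling_apply, ← h1 v]
    refine ⟨fun h3 => ?_, fun h3 => h.cone.smul_mem_interior h3 hc⟩
    have := h.cone.smul_mem_interior h3 (inv_pos.2 hc)
    rwa [smul_smul, inv_mul_cancel₀ hc.ne', one_smul] at this
  · exact (h2 v p hvp).smul hc.ne'

omit h in
lemma symm_mem_linearLifts {e : (Fin d → ℝ) ≃L[ℝ] (Fin d → ℝ)} (he : e ∈ linearLifts K Λ) :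
    e.symm ∈ linearLifts K Λ := by
  obtain ⟨h1, g, hg, h2⟩ := he
  refine ⟨fun v => ?_, g⁻¹, inv_mem hg, fun v p hvp => ?_⟩
  · rw [← h1, e.apply_symm_apply]
  · have h0 : e.symm v ≠ 0 := fun h0 => hvp.ne_zero (e.symm.map_eq_zero_iff.1 h0)
    have h3 := lifts_mk h0
    have h4 := h2 _ _ h3
    rw [e.apply_symm_apply] at h4
    rw [hvp.eq h4, inv_smul_smul]
    exact h3

lemma map_mem_iff_of_mem_linearLifts {e : (Fin d → ℝ) ≃L[ℝ] (Fin d → ℝ)}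
    (he : e ∈ linearLifts K Λ) (v : Fin d → ℝ) : e v ∈ K ↔ v ∈ K := by
  have h1 : e ⁻¹' interior K = interior K := by
    ext v
    exact he.1 v
  have h2 := e.toHomeomorph.preimage_closure (interior K)
  change e ⁻¹' _ = closure (e ⁻¹' _) at h2
  rw [h1, h.closure_interior] at h2
  exact Set.ext_iff.1 h2 v

section CoreCone

lemma smul_mem_coneOver (hX : X ∈ coneOver K C) {c : ℝ} (hc : 0 < c) : c • X ∈ coneOver K C := by
  obtain ⟨h1, p, hp, h2⟩ := hX
  exact ⟨h.cone.smul_mem_interior h1 hc, p, hp, h2.smul hc.ne'⟩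

lemma liftSet_eq (hC : C ⊆ Ω) : liftSet C = coneOver K C ∪ -coneOver K C := by
  ext v
  constructor
  · rintro ⟨p, hp, hv⟩
    rcases (h.mem_iff v p hv).1 (hC hp) with h1 | h1
    · exact Or.inl ⟨h1, p, hp, hv⟩
    · exact Or.inr ⟨h1, p, hp, hv.neg⟩
  · rintro (⟨-, p, hp, hv⟩ | ⟨-, p, hp, hv⟩)
    · exact ⟨p, hp, hv⟩
    · exact ⟨p, hp, by simpa using hv.neg⟩

/-- Convexity of C is given in a chart φ unrelated to f. But φ has constant sign on the lifts: if it
were positive at X and negative at Y, the combination f(Y) X - f(X) Y would represent a point of C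
although f vanishes there. -/
lemma add_mem_coneOver (hC : C ⊆ Ω) (hconv : IsConvex C) (hX : X ∈ coneOver K C)
    (hY : Y ∈ coneOver K C) : X + Y ∈ coneOver K C := by
  obtain ⟨φ, -, hφ, hconv⟩ := hconv
  refine ⟨h.add_mem_interior hX.1 (interior_subset hY.1), ?_⟩
  have hφX : φ X ≠ 0 := by
    obtain ⟨-, p, hp, hXp⟩ := hX
    exact hφ p hp X hXp
  have hφY : φ Y ≠ 0 := by
    obtain ⟨-, p, hp, hYp⟩ := hY
    exact hφ p hp Y hYp
  have neg_mem : ∀ {Z}, Z ∈ coneOver K C → φ Z < 0 → -Z ∈ posLift φ C := fun hZ hZ' => by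
    obtain ⟨-, p, hp, hZp⟩ := hZ
    exact ⟨by simpa using hZ', p, hp, hZp.neg⟩
  have pos_mem : ∀ {Z}, Z ∈ coneOver K C → 0 < φ Z → Z ∈ posLift φ C := fun hZ hZ' => ⟨hZ', hZ.2⟩
  have mixed : ∀ {X Y}, X ∈ coneOver K C → Y ∈ coneOver K C → 0 < φ X → φ Y < 0 → False := by
    intro X Y hX hY hX' hY'
    have h1 := pos_mem hX hX'
    have h2 := neg_mem hY hY'
    have hfX := h.pos X (interior_subset hX.1) (h.ne_zero hX.1)
    have hfY := h.pos Y (interior_subset hY.1) (h.ne_zero hY.1)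
    have h3 := add_mem_posLift hconv (smul_mem_posLift h1 hfY) (smul_mem_posLift h2 hfX)
    obtain ⟨-, p, hp, hZp⟩ := h3
    have h0 : f (f Y • X + f X • -Y) = 0 := by
      simp
      ring
    rcases (h.mem_iff _ p hZp).1 (hC hp) with h4 | h4
    · exact (h.pos _ (interior_subset h4) (h.ne_zero h4)).ne' h0
    · have := h.pos _ (interior_subset h4) (h.ne_zero h4)
      rw [map_neg, h0, neg_zero] at this
      exact lt_irrefl _ this
  rcases lt_or_gt_of_ne hφX with hX' | hX' <;> rcases lt_or_gt_of_ne hφY with hY' | hY'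
  · obtain ⟨-, p, hp, hZ⟩ := add_mem_posLift hconv (neg_mem hX hX') (neg_mem hY hY')
    refine ⟨p, hp, ?_⟩
    convert hZ.neg using 1
    abel
  · exact (mixed hY hX hY' hX').elim
  · exact (mixed hX hY hX' hY').elim
  · exact (add_mem_posLift hconv (pos_mem hX hX') (pos_mem hY hY')).2

lemma closure_coneOver_subset : closure (coneOver K C) ⊆ K :=
  closure_minimal (fun _ hv => interior_subset hv.1) h.cone.isClosed

lemma mem_closure_coneOver (hC : C ⊆ Ω) (hX : X ∈ K) (hXp : Lifts X p) (hp : p ∈ closure C) :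
    X ∈ closure (coneOver K C) := by
  rw [hXp.mem_closure_iff, h.liftSet_eq hC, closure_union, ← neg_closure] at hp
  refine hp.resolve_right fun h1 => hXp.ne_zero (h.eq_zero_of_neg_mem hX ?_)
  exact h.closure_coneOver_subset h1

omit h in
lemma mem_closure_of_mem_closure_coneOver (hX : X ∈ closure (coneOver K C)) (hXp : Lifts X p) :
    p ∈ closure C :=
  hXp.mem_closure_iff.2 (closure_mono (fun _ hv => hv.2) hX)

lemma mem_coneOver_of_mem_closure (hC : ∃ Z, IsClosed Z ∧ C = Z ∩ Ω)
    (hX : X ∈ closure (coneOver K C)) (hX' : X ∈ interior K) : X ∈ coneOver K C := by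
  have hXp := lifts_mk (h.ne_zero hX')
  refine ⟨hX', _, ?_, hXp⟩
  have h1 := mem_closure_of_mem_closure_coneOver hX hXp
  obtain ⟨Z, hZ, rfl⟩ := hC
  exact ⟨closure_minimal inter_subset_left hZ h1, h.mem_domain hX' hXp⟩

omit h in
lemma map_mem_coneOver_iff (hinv : ∀ g ∈ Λ, g • C = C) {e : (Fin d → ℝ) ≃L[ℝ] (Fin d → ℝ)}
    (he : e ∈ linearLifts K Λ) (v : Fin d → ℝ) : e v ∈ coneOver K C ↔ v ∈ coneOver K C := by
  have key : ∀ e ∈ linearLifts K Λ, ∀ v, v ∈ coneOver K C → e v ∈ coneOver K C := by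
    rintro e ⟨h1, g, hg, h2⟩ v ⟨hv, p, hp, hvp⟩
    refine ⟨(h1 v).2 hv, g • p, ?_, h2 _ _ hvp⟩
    rw [← hinv g hg]
    exact smul_mem_smul_set hp
  refine ⟨fun hv => ?_, key e he v⟩
  simpa using key _ (symm_mem_linearLifts he) _ hv

omit h in
lemma map_mem_closure_coneOver_iff (hinv : ∀ g ∈ Λ, g • C = C)
    {e : (Fin d → ℝ) ≃L[ℝ] (Fin d → ℝ)} (he : e ∈ linearLifts K Λ) (v : Fin d → ℝ) :
    e v ∈ closure (coneOver K C) ↔ v ∈ closure (coneOver K C) := by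
  have h1 : e ⁻¹' coneOver K C = coneOver K C := by
    ext v
    exact map_mem_coneOver_iff hinv he v
  have h2 := e.toHomeomorph.preimage_closure (coneOver K C)
  change e ⁻¹' _ = closure (e ⁻¹' _) at h2
  rw [h1] at h2
  exact Set.ext_iff.1 h2 v

/-- Compact subsets of `Ω` are covered by compact sets of representatives. -/
lemma exists_compact_lift {A : Set (ProjSpace d)} (hA : IsCompact A) (hAΩ : A ⊆ Ω) :
    ∃ Z ⊆ interior K, IsCompact Z ∧ A ⊆ proj Z := by
  have : ∀ p ∈ A, ∃ Z ⊆ interior K, IsCompact Z ∧ proj Z ∈ 𝓝[A] p := by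
    intro p hp
    obtain ⟨v, hv, hvp⟩ := h.exists_lift_interior (hAΩ hp)
    obtain ⟨Z, hZ, hvZ, hZK⟩ := exists_compact_subset isOpen_interior hv
    refine ⟨Z, hZK, hZ, mem_nhdsWithin_of_mem_nhds ?_⟩
    refine mem_of_superset ((isOpen_proj isOpen_interior).mem_nhds ⟨v, hvZ, hvp⟩) ?_
    rintro q ⟨w, hw, hwq⟩
    exact ⟨w, interior_subset hw, hwq⟩
  refine hA.induction_on (p := fun A => ∃ Z ⊆ interior K, IsCompact Z ∧ A ⊆ proj Z)
    ⟨∅, empty_subset _, isCompact_empty, empty_subset _⟩ ?_ ?_ ?_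
  · rintro s t hst ⟨Z, h1, h2, h3⟩
    exact ⟨Z, h1, h2, hst.trans h3⟩
  · rintro s t ⟨Z, h1, h2, h3⟩ ⟨W, h4, h5, h6⟩
    refine ⟨Z ∪ W, union_subset h1 h4, h2.union h5, ?_⟩
    rintro p (hp | hp)
    · obtain ⟨v, hv, hvp⟩ := h3 hp
      exact ⟨v, Or.inl hv, hvp⟩
    · obtain ⟨v, hv, hvp⟩ := h6 hp
      exact ⟨v, Or.inr hv, hvp⟩
  · intro p hp
    obtain ⟨Z, h1, h2, h3⟩ := this p hp
    exact ⟨proj Z, h3, Z, h1, h2, subset_rfl⟩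

/-- A group element brings the projective point into the compact set, and a positive scalar then
moves its lift onto the chosen representative. This is why all positive multiples are kept in
`linearLifts`. -/
lemma exists_compact_fundamental (hC : C ⊆ Ω) (haut : ∀ g ∈ Λ, g • Ω = Ω)
    (hco : ∃ A ⊆ C, IsCompact A ∧ ⋃ g ∈ Λ, g • A = C) :
    ∃ Z : Set (Fin d → ℝ), IsCompact Z ∧ Z ⊆ interior K ∧
      ∀ v ∈ coneOver K C, ∃ e ∈ linearLifts K Λ, e v ∈ Z := by
  obtain ⟨A, hAC, hA, hAΛ⟩ := hco
  obtain ⟨Z, hZK, hZ, hAZ⟩ := h.exists_compact_lift hA (hAC.trans hC)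
  refine ⟨Z, hZ, hZK, fun v ⟨hv, p, hp, hvp⟩ => ?_⟩
  rw [← hAΛ, mem_iUnion₂] at hp
  obtain ⟨g, hg, q, hq, rfl⟩ := hp
  obtain ⟨z, hz, hzq⟩ := hAZ hq
  obtain ⟨e, he1, he2⟩ := h.exists_linearLift g⁻¹ (haut _ (inv_mem hg))
  have he : e ∈ linearLifts K Λ := ⟨he1, g⁻¹, inv_mem hg, he2⟩
  have h1 : Lifts (e v) q := by simpa using he2 _ _ hvp
  obtain ⟨c, hc, rfl⟩ := h.exists_pos_smul_eq (interior_subset ((he1 v).2 hv))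
    (interior_subset (hZK hz)) h1 hzq
  exact ⟨_, h.smul_mem_linearLifts he hc, hz⟩

end CoreCone

end IsConeOver

end ConvexProjective

/-! ### Properly embedded simplices as simplicial cones -/

namespace ConvexProjective

open OrderedCone Filter

variable {d : ℕ}

/-- The set of points of `Ω` that are represented by elements of `Q`. -/
def coneTrace (K Q : Set (Fin d → ℝ)) : Set (ProjSpace d) := proj (Q ∩ interior K)

/-- The open simplex spanned by a family of vectors. -/
def openSimplex {ι : Type*} [Fintype ι] (v : ι → Fin d → ℝ) : Set (ProjSpace d) :=
  {p | ∃ t : ι → ℝ, (∀ i, 0 < t i) ∧ Lifts (∑ i, t i • v i) p}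

lemma openSimplex_neg {ι : Type*} [Fintype ι] (v : ι → Fin d → ℝ) :
    openSimplex (fun i => -v i) = openSimplex v := by
  ext p
  simp only [openSimplex, smul_neg, Finset.sum_neg_distrib]
  exact ⟨fun ⟨t, ht, hp⟩ => ⟨t, ht, by simpa using hp.neg⟩, fun ⟨t, ht, hp⟩ => ⟨t, ht, hp.neg⟩⟩

lemma sum_smul_eq_zero_of_linearIndependent {ι : Type*} [Fintype ι] {v : ι → Fin d → ℝ}
    (hv : LinearIndependent ℝ v) {t s : ι → ℝ} (h : ∑ i, t i • v i = ∑ i, s i • v i) (i : ι) :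
    t i = s i := by
  have := Fintype.linearIndependent_iff.1 hv (fun i => t i - s i)
    (by simp [sub_smul, Finset.sum_sub_distrib, h]) i
  exact sub_eq_zero.1 this

namespace IsConeOver

variable {Ω C S : Set (ProjSpace d)} {K P : Set (Fin d → ℝ)} {f : (Fin d → ℝ) →ₗ[ℝ] ℝ}
  (h : IsConeOver Ω K f) {p q x y : ProjSpace d} {X Y Z : Fin d → ℝ}
  {ι : Type*} [Fintype ι] {v : ι → Fin d → ℝ}

include h

lemma coneTrace_hull (hP : P ⊆ K) (hv : IsConeSimplex K P v) :
    coneTrace K (hull v) = openSimplex v := by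
  ext p
  constructor
  · rintro ⟨_, ⟨⟨t, -, rfl⟩, hi⟩, hp⟩
    exact ⟨t, h.cone.pos_of_mem_interior hP hv hi, hp⟩
  · rintro ⟨t, ht, hp⟩
    exact ⟨_, ⟨⟨t, fun i => (ht i).le, rfl⟩, h.cone.sum_mem_interior hP hv ht⟩, hp⟩

lemma exists_sign (hSΩ : openSimplex v ⊆ Ω) (hv : LinearIndependent ℝ v) [Nonempty ι] :
    (∀ t : ι → ℝ, (∀ i, 0 < t i) → ∑ i, t i • v i ∈ interior K) ∨
      ∀ t : ι → ℝ, (∀ i, 0 < t i) → ∑ i, t i • -v i ∈ interior K := by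
  have hne : ∀ t : ι → ℝ, (∀ i, 0 < t i) → ∑ i, t i • v i ≠ 0 := fun t ht h0 =>
    (ht (Classical.arbitrary ι)).ne' (Fintype.linearIndependent_iff.1 hv t h0 _)
  have hpm : ∀ t : ι → ℝ, (∀ i, 0 < t i) →
      ∑ i, t i • v i ∈ interior K ∨ -∑ i, t i • v i ∈ interior K := fun t ht =>
    (h.mem_iff _ _ (lifts_mk (hne t ht))).1 (hSΩ ⟨t, ht, lifts_mk (hne t ht)⟩)
  have hf0 : ∀ t : ι → ℝ, (∀ i, 0 < t i) → f (∑ i, t i • v i) ≠ 0 := fun t ht => by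
    rcases hpm t ht with h1 | h1
    · exact (h.pos _ (interior_subset h1) (h.ne_zero h1)).ne'
    · have := h.pos _ (interior_subset h1) (h.ne_zero h1)
      rw [map_neg] at this
      exact (neg_pos.1 this).ne
  have hsign : (∀ t : ι → ℝ, (∀ i, 0 < t i) → 0 < f (∑ i, t i • v i)) ∨
      ∀ t : ι → ℝ, (∀ i, 0 < t i) → f (∑ i, t i • v i) < 0 := by
    by_contra! hc
    obtain ⟨⟨a, ha, ha'⟩, b, hb, hb'⟩ := hc
    have hconv : Convex ℝ {t : ι → ℝ | ∀ i, 0 < t i} := by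
      intro a ha b hb s r hs hr hsr i
      have := (convex_Ioi (0 : ℝ)) (ha i) (hb i) hs hr hsr
      exact this
    have hcont : Continuous fun t : ι → ℝ => f (∑ i, t i • v i) :=
      f.continuous_of_finiteDimensional.comp
        (continuous_finsetSum _ fun i _ => (continuous_apply i).smul continuous_const)
    obtain ⟨r, hr, hr'⟩ := hconv.isPreconnected.intermediate_value
      (f := fun t : ι → ℝ => f (∑ i, t i • v i)) (a := a) (b := b) ha hb hcont.continuousOn ⟨ha', hb'⟩
    exact hf0 r hr hr'
  rcases hsign with hsign | hsign
  · refine Or.inl fun t ht => (hpm t ht).resolve_right fun h1 => ?_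
    have h2 := h.nonneg (interior_subset h1)
    rw [map_neg] at h2
    linarith [hsign t ht]
  · refine Or.inr fun t ht => ?_
    simp only [smul_neg, Finset.sum_neg_distrib]
    exact (hpm t ht).resolve_left fun h1 => absurd (h.nonneg (interior_subset h1))
      (by linarith [hsign t ht])

/-- An interior point of a facet would lie in C and in the closure of the simplex, hence in the
simplex by properness. Its coefficient at the omitted vertex would be zero and positive at once. -/
lemma isConeSimplex_of_openSimplex (hC : ∃ Z, IsClosed Z ∧ C = Z ∩ Ω) (hSC : openSimplex v ⊆ C)
    (hcl : closure (openSimplex v) ∩ C ⊆ openSimplex v) (hv : LinearIndependent ℝ v)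
    (hpos : ∀ t : ι → ℝ, (∀ i, 0 < t i) → ∑ i, t i • v i ∈ interior K) :
    IsConeSimplex K (closure (coneOver K C)) v := by
  classical
  have hmem : ∀ t : ι → ℝ, (∀ i, 0 < t i) → ∑ i, t i • v i ∈ coneOver K C := fun t ht => by
    have h1 := hpos t ht
    have h2 := lifts_mk (h.ne_zero h1)
    exact ⟨h1, _, hSC ⟨t, ht, h2⟩, h2⟩
  -- combinations with non-negative coefficients are limits
  have hlim : ∀ t : ι → ℝ, (∀ i, 0 ≤ t i) → ∀ A : Set (Fin d → ℝ),
      (∀ t : ι → ℝ, (∀ i, 0 < t i) → ∑ i, t i • v i ∈ A) → ∑ i, t i • v i ∈ closure A := by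
    intro t ht A hA
    have h1 : Tendsto (fun r : ℝ => ∑ i, (t i + r) • v i) (𝓝[>] 0)
        (𝓝 (∑ i, (t i + (0 : ℝ)) • v i)) :=
      ((continuous_finsetSum _ fun i _ =>
        (continuous_const.add continuous_id).smul continuous_const).tendsto' 0 _ rfl).mono_left
          nhdsWithin_le_nhds
    simp only [add_zero] at h1
    refine mem_closure_of_tendsto h1 ?_
    filter_upwards [self_mem_nhdsWithin] with r hr
    exact hA _ fun i => add_pos_of_nonneg_of_pos (ht i) hr
  refine ⟨fun i => ?_, ?_, fun i hi => ?_⟩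
  · have := hlim (Pi.single i 1) (fun j => by by_cases hj : j = i <;> simp [hj]) _ hmem
    simpa [Pi.single_apply, ite_smul] using this
  · simpa using hpos (fun _ => 1) fun _ => one_pos
  · have e : ∑ j, v j - v i = ∑ j, (if j = i then (0 : ℝ) else 1) • v j := by
      simp only [ite_smul, zero_smul, one_smul]
      rw [sub_eq_iff_eq_add, ← Finset.sum_erase_add _ _ (Finset.mem_univ i)]
      congr 1
      rw [← Finset.sum_erase_add _ _ (Finset.mem_univ i), if_pos rfl, add_zero]
      exact Finset.sum_congr rfl fun j hj => (if_neg (Finset.ne_of_mem_erase hj)).symm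
    rw [e] at hi
    have h0 : ∀ j, (0 : ℝ) ≤ if j = i then 0 else 1 := fun j => by split_ifs <;> norm_num
    have hX := lifts_mk (h.ne_zero hi)
    have h1 := h.mem_coneOver_of_mem_closure hC (hlim _ h0 _ hmem) hi
    obtain ⟨-, p, hp, hXp⟩ := h1
    have h2 : p ∈ closure (openSimplex v) := hXp.mem_closure_iff.2 (hlim _ h0 _ fun t ht =>
      ⟨_, ⟨t, ht, lifts_mk (h.ne_zero (hpos t ht))⟩, lifts_mk (h.ne_zero (hpos t ht))⟩)
    obtain ⟨t, ht, htp⟩ := hcl ⟨h2, hp⟩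
    obtain ⟨c, hc, h3⟩ := hXp.exists_smul_eq htp
    rw [Finset.smul_sum] at h3
    simp only [smul_smul] at h3
    have h4 := sum_smul_eq_zero_of_linearIndependent hv h3 i
    rw [if_pos rfl, mul_zero] at h4
    exact (ht i).ne' h4

lemma exists_isConeSimplex (hCΩ : C ⊆ Ω) (hC : ∃ Z, IsClosed Z ∧ C = Z ∩ Ω)
    (hS : IsProperlyEmbeddedSimplex C S) : ∃ n, 3 ≤ n ∧ ∃ v : Fin n → Fin d → ℝ,
      IsConeSimplex K (closure (coneOver K C)) v ∧ S = coneTrace K (hull v) := by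
  obtain ⟨⟨k, hk, v, hv, hSv⟩, hSC, hprop⟩ := hS
  change S = openSimplex v at hSv
  -- A proper map is closed, so S is closed in C.
  have hcl : closure S ∩ C ⊆ S := by
    obtain ⟨Z, hZ, hZS⟩ := isClosed_induced_iff.1 hprop.isClosedMap.isClosed_range
    rw [range_inclusion] at hZS
    rintro p ⟨hp, hpC⟩
    have hSZ : S ⊆ Z := fun q hq => by
      have : (⟨q, hSC hq⟩ : C) ∈ {x : C | (x : ProjSpace d) ∈ S} := hq
      rw [← hZS] at this
      exact this
    have : (⟨p, hpC⟩ : C) ∈ Subtype.val ⁻¹' Z := closure_minimal hSZ hZ hp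
    rw [hZS] at this
    exact this
  have fin : ∀ v : Fin (k + 1) → Fin d → ℝ, LinearIndependent ℝ v → S = openSimplex v →
      (∀ t : Fin (k + 1) → ℝ, (∀ i, 0 < t i) → ∑ i, t i • v i ∈ interior K) →
      ∃ n, 3 ≤ n ∧ ∃ v : Fin n → Fin d → ℝ,
      IsConeSimplex K (closure (coneOver K C)) v ∧ S = coneTrace K (hull v) := by
    intro v hv hSv hpos
    have h1 := h.isConeSimplex_of_openSimplex hC (hSv ▸ hSC) (hSv ▸ hcl) hv hpos
    exact ⟨k + 1, by omega, v, h1, by rw [h.coneTrace_hull h.closure_coneOver_subset h1, hSv]⟩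
  rcases h.exists_sign (hSv ▸ hSC.trans hCΩ) hv with h1 | h1
  · exact fin v hv hSv h1
  · refine fin (fun i => -v i) ?_ (by rw [openSimplex_neg, hSv]) h1
    have := hv.map' (LinearEquiv.neg ℝ (M := Fin d → ℝ)).toLinearMap (LinearEquiv.ker _)
    exact this

/-- Representatives in `K` of points in the closure of an open simplex lie in its hull. -/
lemma mem_hull_of_mem_closure (hP : P ⊆ K) (hv : IsConeSimplex K P v) (hvP : hull v ⊆ P)
    (hX : X ∈ K) (hXp : Lifts X p) (hp : p ∈ closure (coneTrace K (hull v))) : X ∈ hull v := by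
  have hcl := OrderedCone.isClosed_hull (h.cone.linearIndependent hP hv)
  have h1 : liftSet (coneTrace K (hull v)) ⊆ hull v ∪ -hull v := by
    rintro Y ⟨q, ⟨Z, ⟨hZ, hZ'⟩, hZq⟩, hYq⟩
    obtain ⟨c, hc, rfl⟩ := hZq.exists_smul_eq hYq
    rcases lt_or_gt_of_ne hc with hc | hc
    · right
      have := hull_smul v (-c) (by linarith) _ hZ
      rwa [neg_smul] at this
    · exact Or.inl (hull_smul v c hc.le _ hZ)
  have h2 := closure_minimal h1 (hcl.union hcl.neg) (hXp.mem_closure_iff.1 hp)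
  exact h2.resolve_right fun h3 => hXp.ne_zero (h.eq_zero_of_neg_mem hX (hP (hvP h3)))

lemma mem_closure_coneTrace (hP : P ⊆ K) (hv : IsConeSimplex K P v)
    (hX : X ∈ hull v) (hXp : Lifts X p) : p ∈ closure (coneTrace K (hull v)) := by
  have hvK : hull v ⊆ K := hull_subset_of_cone h.cone.zero_mem h.cone.add_mem h.cone.smul_mem
    fun i => hP (hv.mem i)
  have h1 : Tendsto (fun r : ℝ => X + r • ∑ i, v i) (𝓝[>] 0) (𝓝 (X + (0 : ℝ) • ∑ i, v i)) :=
    ((continuous_const.add (continuous_id.smul continuous_const)).tendsto' 0 _ rfl).mono_left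
      nhdsWithin_le_nhds
  rw [zero_smul, add_zero] at h1
  refine hXp.mem_closure_iff.2 (mem_closure_of_tendsto h1 ?_)
  filter_upwards [self_mem_nhdsWithin] with r hr
  have h2 : X + r • ∑ i, v i ∈ interior K := by
    rw [add_comm]
    exact h.add_mem_interior (h.cone.smul_mem_interior hv.sum_mem hr) (hvK hX)
  have h3 := lifts_mk (h.ne_zero h2)
  refine ⟨_, ⟨_, ⟨hull_add v _ hX _ ?_, h2⟩, h3⟩, h3⟩
  exact hull_smul v r (le_of_lt hr) _ (by simpa using sum_mem_hull v Finset.univ (fun _ => 1) (by simp))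

lemma isProperlyEmbeddedSimplex (hC : ∃ Z, IsClosed Z ∧ C = Z ∩ Ω) {n : ℕ} (hn : 3 ≤ n)
    {v : Fin n → Fin d → ℝ} (hv : IsConeSimplex K (closure (coneOver K C)) v)
    (hvP : hull v ⊆ closure (coneOver K C)) :
    IsProperlyEmbeddedSimplex C (coneTrace K (hull v)) := by
  have hP := h.closure_coneOver_subset (C := C)
  have hsub : coneTrace K (hull v) ⊆ C := by
    rintro p ⟨X, ⟨hX, hX'⟩, hXp⟩
    obtain ⟨-, q, hq, hXq⟩ := h.mem_coneOver_of_mem_closure hC (hvP hX) hX'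
    exact hXp.eq hXq ▸ hq
  have hCΩ : C ⊆ Ω := by
    obtain ⟨Z, -, rfl⟩ := hC
    exact inter_subset_right
  refine ⟨?_, hsub, ?_⟩
  · obtain ⟨k, rfl⟩ : ∃ k, n = k + 1 := ⟨n - 1, by omega⟩
    exact ⟨k, by omega, v, h.cone.linearIndependent hP hv, h.coneTrace_hull hP hv⟩
  · refine (IsClosedEmbedding.inclusion hsub ?_).isProperMap
    refine isClosed_induced_iff.2 ⟨closure (coneTrace K (hull v)), isClosed_closure, ?_⟩
    ext ⟨p, hp⟩
    refine ⟨fun hp' => ?_, fun hp' => subset_closure hp'⟩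
    obtain ⟨X, hX, hXp⟩ := h.exists_lift_interior (hCΩ hp)
    exact ⟨X, ⟨h.mem_hull_of_mem_closure hP hv hvP (interior_subset hX) hXp hp', hX⟩, hXp⟩

lemma coneTrace_subset_relInterior (hP : P ⊆ K) (hv : IsConeSimplex K P v) :
    coneTrace K (hull v) ⊆ relInterior (coneTrace K (hull v)) := by
  intro p hp
  refine ⟨hp, ?_⟩
  have hli := h.cone.linearIndependent hP hv
  rw [h.coneTrace_hull hP hv] at hp ⊢
  obtain ⟨t, ht, htp⟩ := hp
  obtain ⟨φ, hφ⟩ := (Fintype.linearCombination ℝ v).exists_leftInverse_of_injective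
    (LinearMap.ker_eq_bot.2 hli.fintypeLinearCombination_injective)
  have hφ' : ∀ t : ι → ℝ, φ (∑ i, t i • v i) = t := fun t => by
    rw [← Fintype.linearCombination_apply]
    exact LinearMap.congr_fun hφ t
  have hU : IsOpen {w : Fin d → ℝ | ∀ i, 0 < φ w i} := by
    simp only [Set.ofPred_forall]
    exact isOpen_iInter_of_finite fun i => isOpen_lt continuous_const
      ((continuous_apply i).comp φ.continuous_of_finiteDimensional)
  refine ⟨_, isOpen_proj hU, ⟨_, fun i => ?_, htp⟩, ?_⟩
  · rw [hφ']
    exact ht i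
  · rintro q ⟨w, hw, hwq⟩ hq
    have hspan : linSpan (openSimplex v) ≤ LinearMap.range (Fintype.linearCombination ℝ v) := by
      refine iSup₂_le ?_
      rintro r ⟨s, hs, hsr⟩
      rw [hsr.submodule_eq, Submodule.span_singleton_le_iff_mem]
      exact ⟨s, Fintype.linearCombination_apply ℝ v s⟩
    have h1 := hq.trans hspan
    rw [hwq.submodule_eq, Submodule.span_singleton_le_iff_mem] at h1
    obtain ⟨s, rfl⟩ := h1
    rw [Fintype.linearCombination_apply] at hw hwq
    refine ⟨s, fun i => ?_, hwq⟩
    have := hw i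
    rwa [hφ'] at this

lemma notMem_interior_of_mem_bdry (hP : P ⊆ K) (hv : IsConeSimplex K P v) (hX : X ∈ hull v)
    (hXp : Lifts X p) (hp : p ∈ bdry (coneTrace K (hull v))) : X ∉ interior K :=
  fun hX' => hp.2 (h.coneTrace_subset_relInterior hP hv ⟨X, ⟨hX, hX'⟩, hXp⟩)

lemma hull_subset_of_coneTrace_eq (hP : P ⊆ K) (hv : IsConeSimplex K P v) {κ : Type*} [Fintype κ]
    {u : κ → Fin d → ℝ} (hu : IsConeSimplex K P u)
    (huv : coneTrace K (hull v) ⊆ coneTrace K (hull u)) : hull v ⊆ hull u := by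
  intro X hX
  have hvK : hull v ⊆ K := hull_subset_of_cone h.cone.zero_mem h.cone.add_mem h.cone.smul_mem
    fun i => hP (hv.mem i)
  have huK : hull u ⊆ K := hull_subset_of_cone h.cone.zero_mem h.cone.add_mem h.cone.smul_mem
    fun i => hP (hu.mem i)
  by_cases hX0 : X = 0
  · rw [hX0]
    exact zero_mem_hull u
  have hXp := lifts_mk hX0
  exact h.mem_hull_of_mem_closure (P := K) subset_rfl
    ⟨fun i => hP (hu.mem i), hu.sum_mem, hu.facet⟩ huK (hvK hX) hXp
    (closure_mono huv (h.mem_closure_coneTrace hP hv hX hXp))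

section Neighborhoods

variable {Q : Set (Fin d → ℝ)} {D r : ℝ}

/-- Distance less than D gives β / α ≤ exp (2D) for the best constants between X and Y, and dividing
X by β makes the lower constant 1. -/
lemma coneNear_of_mem_hilbertNhd (hQ : Q ⊆ K) (hQs : ∀ c : ℝ, 0 ≤ c → ∀ v ∈ Q, c • v ∈ Q)
    (hY : Y ∈ interior K) (hYp : Lifts Y p) (hp : p ∈ hilbertNhd Ω (coneTrace K Q) D) :
    ConeNear K (Real.exp (2 * D)) Q Y := by
  obtain ⟨x, ⟨X, ⟨hX, hX'⟩, hXx⟩, -, hd⟩ := mem_iUnion₂.1 hp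
  obtain ⟨α, β, hα, hαβ, h1, h2, h3⟩ := h.exists_le_hilbertDist hX' hY hXx hYp
  have hβ : 0 < β := hα.trans_le hαβ
  refine ⟨β⁻¹ • X, hQs _ (inv_pos.2 hβ).le _ hX, ?_, ?_⟩
  · have := h.cone.smul_mem β⁻¹ (inv_pos.2 hβ).le _ h2
    rwa [smul_sub, smul_smul, inv_mul_cancel₀ hβ.ne', one_smul] at this
  · have h4 : β / α ≤ Real.exp (2 * D) := by
      rw [← Real.log_le_iff_le_exp (by positivity)]
      linarith
    rw [smul_smul]
    refine h.cone.sub_mem_of_le (hQ hX) (a := α⁻¹) ?_ ?_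
    · have := mul_le_mul_of_nonneg_right h4 (inv_pos.2 hβ).le
      refine le_trans (le_of_eq ?_) this
      field_simp
    · have := h.cone.smul_mem α⁻¹ (inv_pos.2 hα).le _ h1
      rwa [smul_sub, smul_smul, inv_mul_cancel₀ hα.ne', one_smul] at this

lemma mem_hilbertNhd_of_coneNear (hQ : Q ⊆ K) (hD : 0 < D) (hr : (1 / 2) * Real.log D < r)
    (hY : Y ∈ interior K) (hYp : Lifts Y p) (hYQ : ConeNear K D Q Y) :
    p ∈ hilbertNhd Ω (coneTrace K Q) r := by
  obtain ⟨q, hq, h1, h2⟩ := hYQ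
  have hq' : q ∈ interior K := by
    have := h.cone.smul_mem_interior (h.cone.mem_interior_of_sub_mem hY h2) (inv_pos.2 hD)
    rwa [smul_smul, inv_mul_cancel₀ hD.ne', one_smul] at this
  have hqx := lifts_mk (h.ne_zero hq')
  refine mem_iUnion₂.2 ⟨_, ⟨q, ⟨hq, hq'⟩, hqx⟩, h.mem_domain hY hYp, ?_⟩
  have h3 := h.hilbertDist_le (hQ hq) (h.eq_coneFace hq') (hQ hq) (interior_subset hY)
    ((h.comparable_iff_mem_interior hq').2 hY) hqx hYp (inv_pos.2 hD) (β := 1) ?_ ?_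
  · rw [one_div D⁻¹, inv_inv] at h3
    linarith
  · have := h.cone.smul_mem D⁻¹ (inv_pos.2 hD).le _ h2
    rwa [smul_sub, smul_smul, inv_mul_cancel₀ hD.ne', one_smul] at this
  · rwa [one_smul]

end Neighborhoods

end IsConeOver

end ConvexProjective

/-! ### Isolated families are locally finite -/

namespace ConvexProjective

open OrderedCone Filter

variable {d : ℕ}

section Isolated

variable {Ω : Set (ProjSpace d)} {𝒮 𝒮' : Set (Set (ProjSpace d))}

lemma IsIsolated.exists_nhd (hS : IsIsolated Ω 𝒮) (A : ClosedIn Ω) {x : ProjSpace d} (hx : x ∈ Ω) :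
    ∃ r > (0 : ℝ), ∃ ε > (0 : ℝ), ∀ B ∈ localHausdorffNhd Ω A x r ε, B.1 ∈ 𝒮 → B = A := by
  let := localHausdorffTopology Ω
  by_cases hA : A.1 ∈ 𝒮
  · obtain ⟨U, hU, hUA⟩ := isDiscrete_iff_forall_mem_exists_isOpen.1 hS.2 A hA
    have hAU : A ∈ U := (hUA.symm.subset rfl : A ∈ U ∩ _).1
    obtain ⟨r, hr, ε, hε, h⟩ := hU A hAU x hx
    exact ⟨r, hr, ε, hε, fun B hB hBS => hUA.subset ⟨h hB, hBS⟩⟩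
  · obtain ⟨r, hr, ε, hε, h⟩ := hS.1.isOpen_compl A hA x hx
    exact ⟨r, hr, ε, hε, fun B hB hBS => (h hB hBS).elim⟩

/-- Each closed set, in the family or not, has a neighborhood containing no other member. This
property passes to subfamilies and implies closedness as well as discreteness. -/
lemma IsIsolated.mono (hS : IsIsolated Ω 𝒮) (h : 𝒮' ⊆ 𝒮) : IsIsolated Ω 𝒮' := by
  let := localHausdorffTopology Ω
  refine ⟨⟨fun A hA x hx => ?_⟩, hS.2.mono fun A hA => h hA⟩
  obtain ⟨r, hr, ε, hε, h1⟩ := hS.exists_nhd A hx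
  refine ⟨r, hr, ε, hε, fun B hB hBS => hA ?_⟩
  rw [← h1 B hB (h hBS)]
  exact hBS

end Isolated

namespace IsConeOver

variable {Ω C S : Set (ProjSpace d)} {K P : Set (Fin d → ℝ)} {f : (Fin d → ℝ) →ₗ[ℝ] ℝ}
  (h : IsConeOver Ω K f) {p q x y : ProjSpace d} {X Y Z : Fin d → ℝ}
  {ι : Type*} [Fintype ι] {v u w : ι → Fin d → ℝ}

include h

lemma isConeSimplex_smul (hP : P ⊆ K) (hPs : ∀ c : ℝ, 0 ≤ c → ∀ v ∈ P, c • v ∈ P)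
    (hv : IsConeSimplex K P v) {c : ι → ℝ} (hc : ∀ i, 0 < c i) :
    IsConeSimplex K P fun i => c i • v i := by
  classical
  refine ⟨fun i => hPs _ (hc i).le _ (hv.mem i), h.cone.sum_mem_interior hP hv hc, fun i hi => ?_⟩
  have e : ∑ j, c j • v j - c i • v i = ∑ j, (if j = i then 0 else c j) • v j := by
    rw [sub_eq_iff_eq_add, ← Finset.sum_erase_add _ _ (Finset.mem_univ i)]
    congr 1
    rw [← Finset.sum_erase_add _ _ (Finset.mem_univ i), if_pos rfl, zero_smul, add_zero]
    exact Finset.sum_congr rfl fun j hj => by rw [if_neg (Finset.ne_of_mem_erase hj)]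
  rw [e] at hi
  have := h.cone.pos_of_mem_interior hP hv hi i
  rw [if_pos rfl] at this
  exact lt_irrefl _ this

/-- Evaluating f on X - α Y bounds α by f X, and the radius bounds β / α. So β is bounded over the
whole ball. -/
lemma exists_le_of_mem_hilbertBall (hX : X ∈ interior K) (hXx : Lifts X x) (r : ℝ) :
    ∃ δ : ℝ, 0 < δ ∧ ∀ y ∈ hilbertBall Ω x r, ∀ Y ∈ interior K, Lifts Y y → f Y = 1 →
      Y - δ • X ∈ K := by
  have hfX := h.pos X (interior_subset hX) hXx.ne_zero
  refine ⟨(Real.exp (2 * r) * f X)⁻¹, by positivity, fun y hy Y hY hYy hfY => ?_⟩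
  obtain ⟨α, β, hα, hαβ, h1, h2, h3⟩ := h.exists_le_hilbertDist hX hY hXx hYy
  have hβ : 0 < β := hα.trans_le hαβ
  have h4 : β / α ≤ Real.exp (2 * r) := by
    rw [← Real.log_le_iff_le_exp (by positivity)]
    linarith [hy.2]
  have h5 : α ≤ f X := by
    have := h.nonneg h1
    rw [map_sub, map_smul, hfY, smul_eq_mul, mul_one] at this
    linarith
  have h6 : β ≤ Real.exp (2 * r) * f X := by
    rw [div_le_iff₀ hα] at h4
    exact h4.trans (by gcongr)
  have h7 := h.cone.smul_mem β⁻¹ (inv_pos.2 hβ).le _ h2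
  rw [smul_sub, smul_smul, inv_mul_cancel₀ hβ.ne', one_smul] at h7
  have h8 := h.cone.add_mem _ h7 _ (h.cone.smul_mem (β⁻¹ - (Real.exp (2 * r) * f X)⁻¹)
    (sub_nonneg.2 (inv_anti₀ hβ h6)) _ (interior_subset hX))
  convert h8 using 1
  module

lemma exists_norm_smul_sub_mem_of_interior (hX : X ∈ interior K) : ∃ c : ℝ, 0 < c ∧
    ∀ y : Fin d → ℝ, (c * ‖y‖) • X - y ∈ K := by
  obtain ⟨c, hc, h1⟩ := h.cone.exists_norm_smul_sub_mem (interior_subset hX)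
  refine ⟨c, hc, fun y => h1 y ?_⟩
  obtain ⟨M, hM, h2⟩ := h.cone.exists_smul_sub_mem_interior hX y
  obtain ⟨N, hN, h3⟩ := h.cone.exists_smul_sub_mem_interior hX (-y)
  refine ⟨max M N, h.cone.sub_mem_of_le (interior_subset hX) (le_max_left _ _)
    (interior_subset h2), ?_⟩
  have := h.cone.sub_mem_of_le (interior_subset hX) (le_max_right M N) (interior_subset h3)
  rwa [sub_neg_eq_add] at this

/-- Simplices with close normalised vertices are close in the ball of radius `r` about `x`. -/
lemma exists_vertex_modulus (hx : x ∈ Ω) (r : ℝ) {ε : ℝ} (hε : 0 < ε) : ∃ η : ℝ, 0 < η ∧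
    ∀ u w : ι → Fin d → ℝ, (∀ i, f (u i) = 1) → (∀ i, w i ∈ K) → (∀ i, ‖u i - w i‖ ≤ η) →
      coneTrace K (hull u) ∩ hilbertBall Ω x r ⊆ hilbertNhd Ω (coneTrace K (hull w)) ε := by
  obtain ⟨X, hX, hXx⟩ := h.exists_lift_interior hx
  obtain ⟨δ, hδ, hball⟩ := h.exists_le_of_mem_hilbertBall hX hXx r
  obtain ⟨c, hc, hunit⟩ := h.exists_norm_smul_sub_mem_of_interior hX
  have hD1 : 1 < Real.exp ε := Real.one_lt_exp_iff.2 hε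
  set D := Real.exp ε with hD
  have hD0 : 0 < D := Real.exp_pos _
  -- Chosen so that (1 + θ) / (1 - θ) = D = exp ε: order bounds (1 - θ) Y ≤ Y' ≤ (1 + θ) Y then give
  -- distance at most ε / 2.
  set θ := (D - 1) / (D + 1) with hθ
  have hθ0 : 0 < θ := div_pos (by linarith) (by linarith)
  have hθ1 : 0 < 1 - θ := by
    rw [hθ, sub_pos, div_lt_one (by linarith)]
    linarith
  refine ⟨θ * δ / c, by positivity, fun u w hu hw huw p ⟨⟨Z, ⟨hZ, hZi⟩, hZp⟩, hp⟩ => ?_⟩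
  have hfZ := h.pos Z (interior_subset hZi) hZp.ne_zero
  obtain ⟨Y, hYdef⟩ : ∃ Y, Y = (f Z)⁻¹ • Z := ⟨_, rfl⟩
  have hYi : Y ∈ interior K := hYdef ▸ h.cone.smul_mem_interior hZi (inv_pos.2 hfZ)
  have hYK := interior_subset hYi
  have hYp : Lifts Y p := hYdef ▸ hZp.smul (inv_ne_zero hfZ.ne')
  have hfY : f Y = 1 := by
    rw [hYdef, map_smul, smul_eq_mul, inv_mul_cancel₀ hfZ.ne']
  have hYu : Y ∈ hull u := hYdef ▸ hull_smul u _ (inv_pos.2 hfZ).le _ hZ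
  have hYδ := hball p hp Y hYi hYp hfY
  obtain ⟨t, ht, hYt⟩ := hYu
  have hsum : ∑ i, t i = 1 := by
    rw [← hfY, hYt, map_sum]
    simp [hu]
  obtain ⟨Y', hY'⟩ : ∃ Y', Y' = ∑ i, t i • w i := ⟨_, rfl⟩
  have hnorm : ‖Y - Y'‖ ≤ θ * δ / c := by
    rw [hYt, hY', ← Finset.sum_sub_distrib]
    calc ‖∑ i, (t i • u i - t i • w i)‖ ≤ ∑ i, ‖t i • u i - t i • w i‖ := norm_sum_le _ _
      _ ≤ ∑ i, t i * (θ * δ / c) := by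
          refine Finset.sum_le_sum fun i _ => ?_
          rw [← smul_sub, norm_smul, Real.norm_of_nonneg (ht i)]
          exact mul_le_mul_of_nonneg_left (huw i) (ht i)
      _ = θ * δ / c := by rw [← Finset.sum_mul, hsum, one_mul]
  have hcη : c * ‖Y - Y'‖ ≤ θ * δ := by
    rw [le_div_iff₀ hc] at hnorm
    linarith
  have hθY : θ • Y - (θ * δ) • X ∈ K := by
    have := h.cone.smul_mem θ hθ0.le _ hYδ
    rwa [smul_sub, smul_smul] at this
  have h1 : θ • Y - (Y - Y') ∈ K := by
    have := h.cone.add_mem _ hθY _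
      (h.cone.sub_mem_of_le (interior_subset hX) hcη (hunit (Y - Y')))
    rwa [sub_add_sub_cancel] at this
  have h2 : θ • Y - (Y' - Y) ∈ K := by
    rw [norm_sub_rev] at hcη
    have := h.cone.add_mem _ hθY _
      (h.cone.sub_mem_of_le (interior_subset hX) hcη (hunit (Y' - Y)))
    rwa [sub_add_sub_cancel] at this
  have hwK : hull w ⊆ K := hull_subset_of_cone h.cone.zero_mem h.cone.add_mem h.cone.smul_mem hw
  have hθp : 0 < 1 + θ := by linarith
  refine h.mem_hilbertNhd_of_coneNear hwK hD0 (by rw [hD, Real.log_exp]; linarith) hYi hYp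
    ⟨(1 + θ)⁻¹ • Y', hull_smul w _ (inv_pos.2 hθp).le _ ⟨t, ht, hY'⟩, ?_, ?_⟩
  · have := h.cone.smul_mem (1 + θ)⁻¹ (inv_pos.2 hθp).le _ h2
    have e : Y - (1 + θ)⁻¹ • Y' = (1 + θ)⁻¹ • ((1 + θ) • Y - Y') := by
      rw [smul_sub, smul_smul, inv_mul_cancel₀ hθp.ne', one_smul]
    rw [e]
    convert this using 2
    module
  · have := h.cone.smul_mem (1 - θ)⁻¹ (inv_pos.2 hθ1).le _ h1
    have e : D • (1 + θ)⁻¹ • Y' - Y = (1 - θ)⁻¹ • (Y' - (1 - θ) • Y) := by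
      rw [smul_sub, smul_smul, smul_smul, inv_mul_cancel₀ hθ1.ne', one_smul]
      congr 2
      rw [← div_eq_mul_inv, div_eq_iff hθp.ne', inv_mul_eq_div, eq_div_iff hθ1.ne', hθ]
      field_simp
      ring
    rw [e]
    convert this using 2
    module

lemma closedIn_coneTrace (hP : P ⊆ K) (hv : IsConeSimplex K P v) :
    (coneTrace K (hull v)).Nonempty ∧ coneTrace K (hull v) ⊆ Ω ∧
      ∃ A, IsClosed A ∧ coneTrace K (hull v) = A ∩ Ω := by
  have hsub : coneTrace K (hull v) ⊆ Ω := by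
    rintro p ⟨X, hX, hXp⟩
    exact h.mem_domain hX.2 hXp
  have hvK : hull v ⊆ K := hull_subset_of_cone h.cone.zero_mem h.cone.add_mem h.cone.smul_mem
    fun i => hP (hv.mem i)
  refine ⟨⟨_, ∑ i, v i, ⟨?_, hv.sum_mem⟩, lifts_mk (h.ne_zero hv.sum_mem)⟩, hsub,
    closure (coneTrace K (hull v)), isClosed_closure, ?_⟩
  · simpa using sum_mem_hull v Finset.univ (fun _ => 1) (by simp)
  · refine Subset.antisymm (subset_inter subset_closure hsub) ?_
    rintro p ⟨hp, hpΩ⟩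
    obtain ⟨X, hX, hXp⟩ := h.exists_lift_interior hpΩ
    exact ⟨X, ⟨h.mem_hull_of_mem_closure (P := K) subset_rfl
      ⟨fun i => hP (hv.mem i), hv.sum_mem, hv.facet⟩ hvK (interior_subset hX) hXp hp, hX⟩, hXp⟩

/-- An isolated family of simplices with a fixed number of vertices is locally finite. -/
lemma finite_of_isIsolated {𝒮 : Set (Set (ProjSpace d))} (hS : IsIsolated Ω 𝒮) (hP : P ⊆ K)
    (hPs : ∀ c : ℝ, 0 ≤ c → ∀ v ∈ P, c • v ∈ P) (hPc : IsClosed P) {Z : Set (Fin d → ℝ)}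
    (hZ : IsCompact Z) (hZK : Z ⊆ interior K) :
    {Q | (∃ v : ι → Fin d → ℝ, IsConeSimplex K P v ∧ Q = hull v) ∧ coneTrace K Q ∈ 𝒮 ∧
      (Q ∩ Z).Nonempty}.Finite := by
  by_contra hinf
  have hinf : Set.Infinite _ := hinf
  -- Infinitely many distinct members meeting Z, with vertices normalized by f = 1, have an
  -- ultralimit. The limit is again a simplex, as it has a point in Z, and isolation makes the
  -- members eventually equal to it.
  let Qe := hinf.natEmbedding
  have hex : ∀ m : ℕ, ∃ u : ι → Fin d → ℝ, IsConeSimplex K P u ∧ (∀ i, f (u i) = 1) ∧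
      (Qe m).1 = hull u := fun m => by
    obtain ⟨⟨v, hv, hQ⟩, -, -⟩ := (Qe m).2
    have hli := h.cone.linearIndependent hP hv
    have hf : ∀ i, 0 < f (v i) := fun i => h.pos _ (hP (hv.mem i)) (hli.ne_zero i)
    refine ⟨fun i => (f (v i))⁻¹ • v i, h.isConeSimplex_smul hP hPs hv fun i => inv_pos.2 (hf i),
      fun i => ?_, ?_⟩
    · rw [map_smul, smul_eq_mul, inv_mul_cancel₀ (hf i).ne']
    · rw [hQ, hull_smul_pos v _ fun i => inv_pos.2 (hf i)]
  choose u hu hfu hQu using hex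
  have hmeet : ∀ m : ℕ, ∃ t : ι → ℝ, (∀ i, 0 ≤ t i) ∧ ∑ i, t i • u m i ∈ Z := fun m => by
    obtain ⟨q, hq, hqZ⟩ := (Qe m).2.2.2
    rw [hQu] at hq
    obtain ⟨t, ht, rfl⟩ := hq
    exact ⟨t, ht, hqZ⟩
  choose t ht htZ using hmeet
  let U := hyperfilter ℕ
  obtain ⟨q, hqZ, hq⟩ := exists_tendsto_of_mem_compact hZ (U := U) (Eventually.of_forall htZ)
  obtain ⟨R, hR⟩ := h.norm_le
  have hw : ∀ i, ∃ a, Tendsto (fun m => u m i) U (𝓝 a) := fun i =>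
    exists_tendsto_of_bounded (R := R) (Eventually.of_forall fun m => by
      have := hR _ (hP ((hu m).mem i))
      rwa [hfu, mul_one] at this)
  choose w hw using hw
  have hfcont : Continuous f := f.continuous_of_finiteDimensional
  have hτ : ∀ i, ∃ a, Tendsto (fun m => t m i) U (𝓝 a) := fun i => by
    have hfq := (hfcont.tendsto q).comp hq
    refine exists_tendsto_of_bounded (R := f q + 1) ?_
    filter_upwards [hfq.eventually (gt_mem_nhds (lt_add_one (f q)))] with m hm
    have e : f (∑ i, t m i • u m i) = ∑ i, t m i := by simp [hfu]
    rw [Function.comp_apply, e] at hm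
    rw [Real.norm_of_nonneg (ht m i)]
    exact (Finset.single_le_sum (f := t m) (fun j _ => ht m j) (Finset.mem_univ i)).trans hm.le
  choose τ hτ using hτ
  have hwP : ∀ i, w i ∈ P := fun i =>
    hPc.mem_of_tendsto (hw i) (Eventually.of_forall fun m => (hu m).mem i)
  have hqτ : q = ∑ i, τ i • w i :=
    tendsto_nhds_unique hq (tendsto_finsetSum _ fun i _ => (hτ i).smul (hw i))
  have hτ0 : ∀ i, 0 ≤ τ i := fun i =>
    ge_of_tendsto (hτ i) (Eventually.of_forall fun m => ht m i)
  have hwS : IsConeSimplex K P w := by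
    refine ⟨hwP, ?_, fun i hi => ?_⟩
    -- The limit point q is interior and dominated by 1 + Σ τ i times the sum of the limit vertices.
    · have hM : 0 < 1 + ∑ i, τ i := add_pos_of_pos_of_nonneg one_pos (Finset.sum_nonneg fun i _ => hτ0 i)
      have h1 : (1 + ∑ i, τ i) • ∑ i, w i - q ∈ K := by
        rw [hqτ, Finset.smul_sum, ← Finset.sum_sub_distrib]
        refine Finset.sum_induction _ (· ∈ K) (fun a b ha hb => h.cone.add_mem a ha b hb)
          h.cone.zero_mem fun i _ => ?_
        rw [← sub_smul]
        refine h.cone.smul_mem _ ?_ _ (hP (hwP i))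
        have := Finset.single_le_sum (f := τ) (fun j _ => hτ0 j) (Finset.mem_univ i)
        linarith
      have h2 := h.cone.smul_mem_interior (h.cone.mem_interior_of_sub_mem (hZK hqZ) h1)
        (inv_pos.2 hM)
      rwa [smul_smul, inv_mul_cancel₀ hM.ne', one_smul] at h2
    · have h1 : Tendsto (fun m => ∑ j, u m j - u m i) U (𝓝 (∑ j, w j - w i)) :=
        (tendsto_finsetSum _ fun j _ => hw j).sub (hw i)
      obtain ⟨m, hm⟩ := (h1.eventually (isOpen_interior.mem_nhds hi)).exists
      exact (hu m).facet i hm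
  have hqx := lifts_mk (h.ne_zero (hZK hqZ))
  have hxΩ := h.mem_domain (hZK hqZ) hqx
  let A : ClosedIn Ω := ⟨_, h.closedIn_coneTrace hP hwS⟩
  let B : ℕ → ClosedIn Ω := fun m => ⟨_, h.closedIn_coneTrace hP (hu m)⟩
  obtain ⟨r, hr, ε, hε, hAB⟩ := hS.exists_nhd A hxΩ
  obtain ⟨η, hη, hmod⟩ := h.exists_vertex_modulus (ι := ι) hxΩ r hε
  have hfw : ∀ i, f (w i) = 1 := fun i =>
    tendsto_nhds_unique ((hfcont.tendsto _).comp (hw i)) (by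
      simp only [Function.comp_def, hfu]
      exact tendsto_const_nhds)
  have hev : ∀ᶠ m in U, ∀ i, ‖u m i - w i‖ ≤ η := by
    rw [eventually_all]
    intro i
    have h1 := ((hw i).sub_const (w i)).norm
    rw [sub_self, norm_zero] at h1
    filter_upwards [h1.eventually (gt_mem_nhds hη)] with m hm
    exact hm.le
  have hQw : ∀ᶠ m in U, (Qe m).1 = hull w := by
    filter_upwards [hev] with m hm
    have h1 : B m = A := by
      refine hAB (B m) ⟨?_, ?_⟩ ?_
      · exact hmod w (u m) hfw (fun i => hP ((hu m).mem i))
          (fun i => by rw [norm_sub_rev]; exact hm i)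
      · exact hmod (u m) w (hfu m) (fun i => hP (hwP i)) hm
      · change coneTrace K (hull (u m)) ∈ 𝒮
        rw [← hQu]
        exact (Qe m).2.2.1
    have h2 : coneTrace K (hull (u m)) = coneTrace K (hull w) := congrArg Subtype.val h1
    rw [hQu]
    exact Subset.antisymm (h.hull_subset_of_coneTrace_eq hP (hu m) hwS h2.subset)
      (h.hull_subset_of_coneTrace_eq hP hwS (hu m) h2.symm.subset)
  have hsub : {m | (Qe m).1 = hull w}.Subsingleton := fun a ha b hb =>
    Qe.injective (Subtype.ext (ha.trans hb.symm))
  exact notMem_hyperfilter_of_finite hsub.finite hQw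

end IsConeOver

end ConvexProjective

/-! ### Passage back to the projective statement -/

namespace ConvexProjective

open OrderedCone Filter

variable {d : ℕ}

lemma openFace_mono {A B : Set (ProjSpace d)} (hAB : closure A ⊆ closure B) (x : ProjSpace d) :
    openFace A x ⊆ openFace B x := by
  rintro y (hy | ⟨hy, v, w, hvw, hseg, hxy⟩)
  · exact Or.inl hy
  · exact Or.inr ⟨hAB hy, v, w, hvw, hseg.trans hAB, hxy⟩

lemma openFace_subset_closure {A : Set (ProjSpace d)} {x : ProjSpace d} (hx : x ∈ closure A) :
    openFace A x ⊆ closure A := by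
  rintro y (hy | hy)
  · rwa [mem_singleton_iff.1 hy]
  · exact hy.1

/-- The cones over the members of `𝒮`. -/
def simplexCones (K P : Set (Fin d → ℝ)) (𝒮 : Set (Set (ProjSpace d))) : Set (Set (Fin d → ℝ)) :=
  {Q | (∃ n : ℕ, 3 ≤ n ∧ ∃ v : Fin n → Fin d → ℝ, IsConeSimplex K P v ∧ Q = hull v) ∧
    coneTrace K Q ∈ 𝒮}

lemma coneTrace_image {K : Set (Fin d → ℝ)} {g : PGL(Fin d, ℝ)}
    {e : (Fin d → ℝ) ≃L[ℝ] (Fin d → ℝ)} (h1 : ∀ v, e v ∈ interior K ↔ v ∈ interior K)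
    (h2 : ∀ v p, Lifts v p → Lifts (e v) (g • p)) (Q : Set (Fin d → ℝ)) :
    coneTrace K (e '' Q) = g • coneTrace K Q := by
  ext p
  constructor
  · rintro ⟨_, ⟨⟨X, hX, rfl⟩, hX'⟩, hp⟩
    have h3 : X ≠ 0 := fun h0 => hp.ne_zero (by rw [h0, map_zero])
    have h4 := lifts_mk h3
    rw [hp.eq (h2 _ _ h4)]
    exact smul_mem_smul_set ⟨X, ⟨hX, (h1 X).1 hX'⟩, h4⟩
  · rintro ⟨q, ⟨X, ⟨hX, hX'⟩, hq⟩, rfl⟩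
    exact ⟨e X, ⟨mem_image_of_mem e hX, (h1 X).2 hX'⟩, h2 _ _ hq⟩

lemma isConeSimplex_map {K P : Set (Fin d → ℝ)} {e : (Fin d → ℝ) ≃L[ℝ] (Fin d → ℝ)}
    (heK : ∀ v, e v ∈ interior K ↔ v ∈ interior K) (heP : ∀ v, e v ∈ P ↔ v ∈ P)
    {ι : Type*} [Fintype ι] {v : ι → Fin d → ℝ} (hv : IsConeSimplex K P v) :
    IsConeSimplex K P fun i => e (v i) := by
  refine ⟨fun i => (heP _).2 (hv.mem i), ?_, fun i => ?_⟩
  · rw [← map_sum, heK]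
    exact hv.sum_mem
  · rw [← map_sum, ← map_sub, heK]
    exact hv.facet i

namespace IsConeOver

variable {Ω C : Set (ProjSpace d)} {K P : Set (Fin d → ℝ)} {f : (Fin d → ℝ) →ₗ[ℝ] ℝ}
  (h : IsConeOver Ω K f) {X Y : Fin d → ℝ} {Λ : Subgroup PGL(Fin d, ℝ)}
  {𝒮 : Set (Set (ProjSpace d))}

include h

lemma isConeSystem (hΛ : IsNaiveConvexCocompactTriple Ω C Λ) (hiso : IsIsolated Ω 𝒮)
    (hS : ∀ S ∈ 𝒮, IsProperlyEmbeddedSimplex C S) (hcc : IsCoarselyComplete Ω C 𝒮)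
    (hinv : IsInvariantFamily Λ 𝒮) :
    IsConeSystem K (closure (coneOver K C)) (simplexCones K (closure (coneOver K C)) 𝒮)
      (linearLifts K Λ) := by
  have hPK := h.closure_coneOver_subset (C := C)
  have hne : (coneOver K C).Nonempty := by
    obtain ⟨p, hp⟩ := hΛ.nonempty
    obtain ⟨v, hv, hvp⟩ := h.exists_lift_interior (hΛ.subset hp)
    exact ⟨v, hv, p, hp, hvp⟩
  have hPs := smul_mem_closure_of_smul_mem hne fun v hv c hc => h.smul_mem_coneOver hv hc
  have hP0 := zero_mem_closure_of_smul_mem hne fun v hv c hc => h.smul_mem_coneOver hv hc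
  have hPa := add_mem_closure_of_add_mem fun v hv w hw =>
    h.add_mem_coneOver hΛ.subset hΛ.convex hv hw
  refine ⟨hPK, isClosed_closure, hP0, hPa, hPs,
    fun e he v => h.map_mem_iff_of_mem_linearLifts he v,
    fun e he v => map_mem_closure_coneOver_iff hΛ.invariant he v, ?_,
    fun e he => symm_mem_linearLifts he, ?_, fun Q hQ => hQ.1, ?_, ?_⟩
  · rintro e he Q ⟨⟨n, hn, v, hv, rfl⟩, hQ⟩
    obtain ⟨g, hg, hge⟩ := he.2
    refine ⟨⟨n, hn, fun i => e (v i), isConeSimplex_map he.1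
      (map_mem_closure_coneOver_iff hΛ.invariant he) hv,
      hull_image (e : (Fin d → ℝ) →ₗ[ℝ] (Fin d → ℝ)) v⟩, ?_⟩
    rw [coneTrace_image he.1 hge]
    exact hinv _ hQ g hg
  · obtain ⟨Z, hZ, hZK, h1⟩ := h.exists_compact_fundamental hΛ.subset hΛ.aut hΛ.cocompact
    exact ⟨Z, hZ, hZK, fun p hp hpi => h1 p (h.mem_coneOver_of_mem_closure hΛ.closed hp hpi)⟩
  · intro Z hZ hZK
    -- Linear independence bounds the number of vertices by d, and local finiteness was proved for
    -- each number separately.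
    refine ((Set.finite_Iic d).biUnion fun n _ => h.finite_of_isIsolated (ι := Fin n) hiso hPK hPs
      isClosed_closure hZ hZK).subset ?_
    rintro Q ⟨⟨⟨n, -, v, hv, rfl⟩, hQ⟩, hQZ⟩
    have hcard := (h.cone.linearIndependent hPK hv).fintype_card_le_finrank
    rw [Fintype.card_fin, Module.finrank_fin_fun] at hcard
    exact mem_iUnion₂.2 ⟨n, hcard, ⟨v, hv, rfl⟩, hQ, hQZ⟩
  · obtain ⟨D, hD, h1⟩ := hcc
    refine ⟨Real.exp (2 * D), Real.exp_pos _, fun n v hn hv => ?_⟩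
    have hvP := hull_subset_of_cone hP0 hPa hPs hv.mem
    obtain ⟨S, hSS, hvS⟩ := h1 _ (h.isProperlyEmbeddedSimplex hΛ.closed hn hv hvP)
    obtain ⟨m, hm, u, hu, rfl⟩ := h.exists_isConeSimplex hΛ.subset hΛ.closed (hS S hSS)
    refine ⟨hull u, ⟨⟨m, hm, u, hu, rfl⟩, hSS⟩, fun i => ?_⟩
    have huK := (hull_subset_of_cone hP0 hPa hPs hu.mem).trans hPK
    -- The neighborhoods of coarse completeness only see interior points, so the vertex is
    -- approached from inside the simplex. The constant is independent of m, hence passes to the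
    -- limit.
    have hlim : Tendsto (fun m : ℕ => v i + ((1 : ℝ) / (m + 1)) • ∑ j, v j) (hyperfilter ℕ)
        (𝓝 (v i + (0 : ℝ) • ∑ j, v j)) :=
      ((tendsto_one_div_add_atTop_nhds_zero_nat.smul_const _).const_add _).mono_left
        Nat.hyperfilter_le_atTop
    rw [zero_smul, add_zero] at hlim
    refine h.cone.coneNear_of_tendsto
      (OrderedCone.isClosed_hull (h.cone.linearIndependent hPK hu)) huK hlim ?_
    refine Eventually.of_forall fun m => ?_
    have hm : (0 : ℝ) < 1 / (m + 1) := by positivity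
    have h2 : v i + ((1 : ℝ) / (m + 1)) • ∑ j, v j ∈ interior K := by
      rw [add_comm]
      exact h.add_mem_interior (h.cone.smul_mem_interior hv.sum_mem hm) (hPK (hv.mem i))
    have h3 := lifts_mk (h.ne_zero h2)
    refine h.coneNear_of_mem_hilbertNhd huK (hull_smul u) h2 h3 (hvS ⟨_, ⟨?_, h2⟩, h3⟩)
    exact hull_add v _ (mem_hull_self v i) _ (hull_smul v _ hm.le _
      (by simpa using sum_mem_hull v Finset.univ (fun _ => 1) (by simp)))

/-- The order of the cone and the order of a simplex agree on the simplex, up to constants. -/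
lemma exists_smul_sub_mem_hull {ι : Type*} [Fintype ι] {v : ι → Fin d → ℝ} (hP : P ⊆ K)
    (hv : IsConeSimplex K P v) (hX : X ∈ hull v) (hY : Y ∈ hull v) {M : ℝ} (hM : 0 < M)
    (hXY : M • X - Y ∈ K) : ∃ N : ℝ, ∀ N', N ≤ N' → N' • X - Y ∈ hull v := by
  classical
  obtain ⟨t, ht, rfl⟩ := hX
  obtain ⟨s, hs, rfl⟩ := hY
  have hs0 : ∀ i, t i = 0 → s i = 0 := by
    intro i hi
    have hc : 0 < M * (1 + ∑ j, t j) :=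
      mul_pos hM (add_pos_of_pos_of_nonneg one_pos (Finset.sum_nonneg fun j _ => ht j))
    refine h.cone.coeff_eq_zero_of_sub_mem hP hv hs (J := Finset.univ.filter fun j => t j ≠ 0) hc ?_
      (i := i) (by simp [hi])
    have h1 : (1 + ∑ j, t j) • ∑ j ∈ Finset.univ.filter (fun j => t j ≠ 0), v j - ∑ j, t j • v j ∈ K := by
      have e : ∑ j, t j • v j = ∑ j ∈ Finset.univ.filter (fun j => t j ≠ 0), t j • v j := by
        refine (Finset.sum_subset (Finset.subset_univ _) fun j _ hj => ?_).symm
        have : t j = 0 := by simpa using hj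
        rw [this, zero_smul]
      rw [e, Finset.smul_sum, ← Finset.sum_sub_distrib]
      refine Finset.sum_induction _ (· ∈ K) (fun a b ha hb => h.cone.add_mem a ha b hb)
        h.cone.zero_mem fun j _ => ?_
      rw [← sub_smul]
      refine h.cone.smul_mem _ ?_ _ (hP (hv.mem j))
      have := Finset.single_le_sum (f := t) (fun j _ => ht j) (Finset.mem_univ j)
      linarith
    have h2 := h.cone.add_mem _ (h.cone.smul_mem M hM.le _ h1) _ hXY
    rwa [smul_sub, smul_smul, sub_add_sub_cancel] at h2
  refine ⟨∑ i, s i / t i, fun N' hN' => ⟨fun i => N' * t i - s i, fun i => ?_, ?_⟩⟩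
  · rcases (ht i).eq_or_lt with h0 | h0
    · simp [← h0, hs0 i h0.symm]
    · have h1 := Finset.single_le_sum (f := fun i => s i / t i)
        (fun j _ => div_nonneg (hs j) (ht j)) (Finset.mem_univ i)
      have h2 : s i / t i ≤ N' := h1.trans hN'
      rw [div_le_iff₀ h0] at h2
      exact sub_nonneg.2 h2
  · simp only [sub_smul, mul_smul, Finset.sum_sub_distrib, Finset.smul_sum]

/-- Comparability for K, restricted to the hull, implies comparability for the smaller order of the
hull. The segment through both points can then be taken within the closed simplex. -/
lemma mem_openFace_coneTrace {ι : Type*} [Fintype ι] {v : ι → Fin d → ℝ} (hP : P ⊆ K)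
    (hv : IsConeSimplex K P v) (hX : X ∈ hull v) (hY : Y ∈ hull v) (hYX : ConeComparable K Y X)
    {p q : ProjSpace d} (hXp : Lifts X p) (hYq : Lifts Y q) :
    q ∈ openFace (coneTrace K (hull v)) p := by
  obtain ⟨M, hM, h1, h2⟩ := hYX
  obtain ⟨N₁, hN₁⟩ := h.exists_smul_sub_mem_hull hP hv hX hY hM h1
  obtain ⟨N₂, hN₂⟩ := h.exists_smul_sub_mem_hull hP hv hY hX hM h2
  refine mem_openFace_of_sub_mem (M := max 2 (max N₁ N₂)) (hull_add v) (hull_smul v)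
    (fun Z hZ r hr => h.mem_closure_coneTrace hP hv hZ hr) hXp hYq
    (lt_of_lt_of_le one_lt_two (le_max_left _ _)) (hN₁ _ (by simp)) (hN₂ _ (by simp))

lemma hilbertHausdorffDist_le {ι : Type*} [Fintype ι] {v : ι → Fin d → ℝ} (hC : C ⊆ Ω)
    (hv : IsConeSimplex K (closure (coneOver K C)) v) (hvC : coneTrace K (hull v) ⊆ C)
    (hvP : hull v ⊆ closure (coneOver K C)) {D D₁ : ℝ}
    (hD₁ : (1 / 2) * Real.log D ≤ D₁) (hD₁0 : 0 ≤ D₁)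
    (hnear : ∀ X ∈ hull v, X ∉ interior K → ∀ Y ∈ closure (coneOver K C),
      ConeComparable K Y X → ConeNear K D (hull v) Y)
    {x : ProjSpace d} (hx : x ∈ bdry (coneTrace K (hull v))) :
    hilbertHausdorffDist (openFace Ω x) (closure C ∩ openFace Ω x)
      (openFace (coneTrace K (hull v)) x) ≤ ENNReal.ofReal D₁ := by
  have hPK := h.closure_coneOver_subset (C := C)
  obtain ⟨X, hXK, hXx⟩ := h.exists_lift_cone (closure_mono (hvC.trans hC) hx.1)
  have hX := h.mem_hull_of_mem_closure hPK hv hvP hXK hXx hx.1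
  have hXi := h.notMem_interior_of_mem_bdry hPK hv hX hXx hx
  have hF := h.openFace_eq hXK hXx
  -- Core points of the face are near the simplex by hypothesis, and the approximating point q is
  -- comparable to X, so it lies in the right face of the simplex. Conversely, the face of the
  -- simplex already lies in the closure of the core.
  refine max_le (iSup₂_le ?_) (iSup₂_le ?_)
  · rintro a ⟨haC, haF⟩
    rw [hF] at haF
    obtain ⟨Y, hY, hYa, hYX⟩ := haF
    obtain ⟨q, hq, h1, h2⟩ :=
      hnear X hX hXi Y (h.mem_closure_coneOver hC hY hYa haC) hYX
    have hqK := hPK (hvP hq)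
    have hq0 : q ≠ 0 := by
      rintro rfl
      rw [smul_zero, zero_sub] at h2
      exact hYa.ne_zero (h.eq_zero_of_neg_mem hY h2)
    have hqY : ConeComparable K q Y :=
      ConeComparable.of_sub_mem h.cone hqK hY (a := 1) (by rwa [one_smul]) h2
    have hqX := hqY.trans h.cone hYX
    have hqb := lifts_mk hq0
    refine iInf₂_le_of_le _ (h.mem_openFace_coneTrace hPK hv hX hq hqX hXx hqb) ?_
    refine ENNReal.ofReal_le_ofReal ?_
    have h3 := h.hilbertDist_le hXK hF hY hqK hqX hYa hqb one_pos (by rwa [one_smul]) h2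
    rw [div_one] at h3
    exact h3.trans hD₁
  · intro b hb
    have hbΩ := openFace_mono (closure_mono (hvC.trans hC)) x hb
    refine iInf₂_le_of_le b ⟨closure_mono hvC (openFace_subset_closure hx.1 hb), hbΩ⟩ ?_
    refine ENNReal.ofReal_le_ofReal ?_
    rw [hF] at hbΩ
    obtain ⟨Y, hY, hYb, hYX⟩ := hbΩ
    have h3 := h.hilbertDist_le hXK hF hY hY hYX hYb hYb one_pos (β := 1)
      (by simpa using h.cone.zero_mem) (by simpa using h.cone.zero_mem)
    rw [div_one, Real.log_one, mul_zero] at h3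
    exact h3.trans hD₁0

end IsConeOver

end ConvexProjective

end

open ConvexProjective in
theorem theorem7 {d : ℕ} (Ω C : Set (ProjSpace d)) (Λ : Subgroup PGL(Fin d, ℝ))
    (hΛ : IsNaiveConvexCocompactTriple Ω C Λ)
    (𝒮₀ : Set (Set (ProjSpace d)))
    (hmax : ∀ S ∈ 𝒮₀, IsMaximalProperlyEmbeddedSimplex C S)
    (hiso : IsIsolated Ω 𝒮₀) (hcc : IsCoarselyComplete Ω C 𝒮₀) (hinv : IsInvariantFamily Λ 𝒮₀) :
    ∃ 𝒮 ⊆ 𝒮₀, IsIsolated Ω 𝒮 ∧ IsCoarselyComplete Ω C 𝒮 ∧ IsInvariantFamily Λ 𝒮 ∧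
      ∃ D₁ : ℝ, 0 < D₁ ∧ ∀ S ∈ 𝒮, ∀ x ∈ bdry S,
        hilbertHausdorffDist (openFace Ω x) (closure C ∩ openFace Ω x) (openFace S x) ≤
          ENNReal.ofReal D₁ := by
  obtain ⟨K, f, h⟩ := exists_isConeOver hΛ.domain
  have hPK := h.closure_coneOver_subset (C := C)
  have hS₀ : ∀ S ∈ 𝒮₀, IsProperlyEmbeddedSimplex C S := fun S hS => (hmax S hS).prop
  have hsys := h.isConeSystem hΛ hiso hS₀ hcc hinv
  obtain ⟨𝒞, h𝒞, hmap, ⟨D, hD, hcomplete⟩, D', hD', hnear⟩ := h.cone.exists_subsystem hsys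
  have hQK : ∀ Q ∈ 𝒞, Q ⊆ closure (coneOver K C) := fun Q hQ => by
    obtain ⟨⟨n, -, v, hv, rfl⟩, -⟩ := h𝒞 hQ
    exact OrderedCone.hull_subset_of_cone hsys.zero_mem hsys.add_mem hsys.smul_mem hv.mem
  -- The order constants D and D' become the radii (1/2) log D and (1/2) log D'. The absolute value
  -- plus one makes them positive and the strict inequalities true.
  refine ⟨{S | ∃ Q ∈ 𝒞, S = coneTrace K Q}, ?_, ?_, ?_, ?_, |(1 / 2) * Real.log D'| + 1,
    by positivity, ?_⟩
  · rintro S ⟨Q, hQ, rfl⟩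
    exact (h𝒞 hQ).2
  · refine hiso.mono ?_
    rintro S ⟨Q, hQ, rfl⟩
    exact (h𝒞 hQ).2
  · refine ⟨|(1 / 2) * Real.log D| + 1, by positivity, fun S hS => ?_⟩
    obtain ⟨n, hn, v, hv, rfl⟩ := h.exists_isConeSimplex hΛ.subset hΛ.closed hS
    obtain ⟨Q, hQ, hvQ⟩ := hcomplete n v hn hv
    refine ⟨_, ⟨Q, hQ, rfl⟩, ?_⟩
    rintro p ⟨X, ⟨hX, hX'⟩, hXp⟩
    exact h.mem_hilbertNhd_of_coneNear ((hQK Q hQ).trans hPK) hD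
      ((le_abs_self _).trans_lt (lt_add_one _)) hX' hXp (hvQ X hX)
  · rintro S ⟨Q, hQ, rfl⟩ g hg
    obtain ⟨e, he⟩ := h.exists_linearLift g (hΛ.aut g hg)
    refine ⟨_, hmap e ⟨he.1, g, hg, he.2⟩ Q hQ, ?_⟩
    exact (coneTrace_image he.1 he.2 Q).symm
  · rintro S ⟨Q, hQ, rfl⟩ x hx
    obtain ⟨⟨n, hn, v, hv, rfl⟩, hQS⟩ := h𝒞 hQ
    exact h.hilbertHausdorffDist_le hΛ.subset hv (hS₀ _ hQS).2.1 (hQK _ hQ)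
      ((le_abs_self _).trans (lt_add_one _).le) (by positivity) (hnear _ hQ) hx
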